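/- **Setting.** Let $d\in\{1,2,3\}$, $T>0$, and let $\Omega\subset\mathbb R^d$ be open and bounded. Let $\mathbf D\in L^\infty(\Omega;\mathbb R^{d\times d})$ be symmetric and uniformly elliptic ($\mathbf D(\mathbf x)\xi\cdot\xi\ge c_1|\xi|^2$ with $c_1>0$), and let $\mathbf q\in C^1(\overline\Omega;\mathbb R^d)$ with $\nabla\cdot\mathbf q=0$. Let $R:\overline\Omega\times[0,T]\times\mathbb R\to\mathbb R$ satisfy $|R(\mathbf x,t,u)-R(\mathbf x,t,v)|\le L|u-v|$ for all $\mathbf x,t,u,v$, and be Lipschitz in $(\mathbf x,t)$ uniformly for $u$ in bounded sets. Let $X$ be a classical solution of $$\partial_tX-\nabla\cdot(\mathbf D\nabla X)+\mathbf q\cdot\nabla X=R(\mathbf x,t,X)\ \text{ in }\Omega\times[0,T],\qquad X=0\ \text{ on }\partial\Omega,\qquad X(0)=X_0 ,$$ that is, $X,\nabla X,\nabla^2X$ are continuous on $\overline\Omega\times[0,T]$ (so that $X_0\in H^2(\Omega)\cap H^1_0(\Omega)=\mathcal D(A)$), $X$ is differentiable in $t$, and, since $\mathbf D$ may be discontinuous,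 the equation holds in the form $\frac{d}{dt}\int_\Omega X\varphi+\int_\Omega\mathbf D\nabla X\cdot\nabla\varphi+\int_\Omega(\mathbf q\cdot\nabla X)\varphi=\int_\Omega R(\cdot,t,X)\varphi$ for all $\varphi\in C_c^\infty(\Omega)$ and $t\in[0,T]$. Fix $c_0\ge0$ (the term $c_0X$ is added to both sides of the equation before discretizing) and $\zeta_1,\zeta_2>0$. **Meshes.** An admissible mesh $\mathcal T$ consists of finitely many disjoint non-empty open convex polytopes $i\subset\Omega$ (control volumes) with $\overline\Omega=\bigcup_i\overline i$; closed edges $\sigma$, each in a hyperplane, such that $\partial i$ is the union of a finite set $\mathcal E_i$ of edges that overlap only in $(d-1)$-dimensional null sets, and every edge is either contained in $\partial\Omega$ or of the form $\sigma=i|j=\overline i\cap\overline j$, lying in $\Omega$ up to a null set; centers $\mathbf x_i\in\overline i$; and points $\mathbf y_\sigma\in\sigma$ such that, for all $\sigma\in\mathcal E_i$, the line through $\mathbf x_i$ and $\mathbf y_\sigma$ is perpendicular to $\sigma$ for the inner product induced by $\mathbf D_i^{-1}$, where $\mathbf D_i=\frac1{\mathrm{mes}(i)}\int_i\mathbf D$.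 Let $h$ be the largest diameter of a control volume, $\mathbf n_{i,\sigma}$ the unit normal to $\sigma$ outward to $i$, $d_{i,\sigma}=|\mathbf x_i-\mathbf y_\sigma|$, and $d_\sigma=|\mathbf x_i-\mathbf x_j|$ if $\sigma=i|j$, $d_\sigma=d_{i,\sigma}$ if $\sigma\subset\partial\Omega$. The mesh is regular with constants $\zeta_1,\zeta_2$ if $\mathbf D|_i\in C^1(\overline i)$ for every $i$ and $$\zeta_1h^d\le\mathrm{mes}(i)\le\zeta_2h^d,\qquad \zeta_1h^{d-1}\le\mathrm{mes}(\sigma)\le\zeta_2h^{d-1},\qquad \zeta_1h\le d_\sigma\le\zeta_2h .$$ **Scheme.** Put $D_{i,\sigma}=|\mathbf D_i\mathbf n_{i,\sigma}|$, $q_{i,\sigma}=\int_\sigma\mathbf q\cdot\mathbf n_{i,\sigma}\,d\sigma$, and $$\tau_\sigma=\mathrm{mes}(\sigma)\frac{D_{i,\sigma}D_{j,\sigma}}{D_{j,\sigma}d_{i,\sigma}+D_{i,\sigma}d_{j,\sigma}}\ \ (\sigma=i|j),\qquad \tau_\sigma=\mathrm{mes}(\sigma)\frac{D_{i,\sigma}}{d_{i,\sigma}}\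 \ (\sigma\subset\partial\Omega).$$ For nodal vectors $u=(u_i)_{i\in\mathcal T}$ (values at the centers of functions of the discrete space $V_h$) let $$(A_hu)_i=\frac1{\mathrm{mes}(i)}\sum_{\sigma\in\mathcal E_i}\bigl(-\tau_\sigma(u_j-u_i)+q_{i,\sigma}u_{\sigma,+}\bigr)+c_0u_i ,$$ where $u_j$ is the value in the control volume on the other side of $\sigma$, replaced by $0$ if $\sigma\subset\partial\Omega$, and $u_{\sigma,+}=u_i$ if $q_{i,\sigma}\ge0$, $u_{\sigma,+}=u_j$ otherwise. Let $\|u\|_{0,h}^2=\sum_i\mathrm{mes}(i)u_i^2$, where a function is evaluated through its values at the centers, and let $P_h$ be the orthogonal projection onto $V_h$ for the corresponding scalar product, i.e. $(P_hf)_i=f(\mathbf x_i)$. For $\Delta t>0$ and $t_m=m\Delta t$ the ETD1 approximations are $X_h^0=P_hX_0$ and $$X_h^{m+1}=X_h^m+\Delta t\,\varphi_1(-\Delta tA_h)\bigl(-A_hX_h^m+F_h^m\bigr),\qquad (F_h^m)_i=R(\mathbf x_i,t_m,(X_h^m)_i)+c_0(X_h^m)_i,$$ where $\varphi_1(-\Delta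 tA_h)=\frac1{\Delta t}\int_0^{\Delta t}e^{-(\Delta t-s)A_h}\,ds$. **Theorem.** There is a constant $C>0$, depending only on $\Omega,X,R,\mathbf D,\mathbf q,T,\zeta_1,\zeta_2$ and $c_0$, such that for every admissible mesh that is regular with constants $\zeta_1,\zeta_2$, every $\Delta t>0$ and every $m\in\mathbb N$ with $t_m=m\Delta t\le T$, $$\|X(t_m)-X_h^m\|_{0,h}\le C(\Delta t+h).$$ -/

import Mathlib

open MeasureTheory Set
open scoped RealInnerProductSpace ContDiff

noncomputable section

namespace FVETD

/-- The ambient space `ℝ^d` with its Euclidean norm. -/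
abbrev Sp (d : ℕ) : Type := EuclideanSpace ℝ (Fin d)

/-! ### Data of the continuous problem -/

/-- `f ∈ C¹(closure U)` for an open set `U`: `f` is differentiable in `U`, and `f` and its derivative
are continuous up to the boundary of `U`. -/
def C1UpTo {d : ℕ} {F : Type*} [NormedAddCommGroup F] [NormedSpace ℝ F]
    (U : Set (Sp d)) (f : Sp d → F) : Prop :=
  ∃ f' : Sp d → Sp d →L[ℝ] F, ContinuousOn f (closure U) ∧ ContinuousOn f' (closure U) ∧
    ∀ x ∈ U, HasFDerivAt f (f' x) x

/-- Divergence of a vector field. -/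
def divergence {d : ℕ} (q : Sp d → Sp d) (x : Sp d) : ℝ :=
  ∑ k : Fin d, fderiv ℝ q x (EuclideanSpace.single k 1) k

/-- The diffusion tensor: `D ∈ L^∞(Ω)`, symmetric and uniformly elliptic. -/
structure IsDiffusionTensor {d : ℕ} (Ω : Set (Sp d)) (D : Sp d → Sp d →L[ℝ] Sp d) : Prop where
  memLp : MemLp D ⊤ (volume.restrict Ω)
  symm : ∀ x ∈ Ω, ∀ ξ η : Sp d, ⟪D x ξ, η⟫ = ⟪ξ, D x η⟫
  elliptic : ∃ c₁ : ℝ, 0 < c₁ ∧ ∀ x ∈ Ω, ∀ ξ : Sp d, c₁ * ‖ξ‖ ^ 2 ≤ ⟪D x ξ, ξ⟫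

/-- The velocity: `q ∈ C¹(closure Ω)` and `div q = 0`. -/
structure IsVelocity {d : ℕ} (Ω : Set (Sp d)) (q : Sp d → Sp d) : Prop where
  c1 : C1UpTo Ω q
  div_free : ∀ x ∈ Ω, divergence q x = 0

/-- The reaction term `R(x, t, u)`: Lipschitz in `u` uniformly in `(x, t)`, and Lipschitz in `(x, t)`
for `u` in bounded sets. -/
structure IsReaction {d : ℕ} (Ω : Set (Sp d)) (T : ℝ) (R : Sp d → ℝ → ℝ → ℝ) : Prop where
  lip : ∃ L : ℝ, 0 < L ∧ ∀ x ∈ closure Ω, ∀ t ∈ Icc 0 T, ∀ u v : ℝ,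
    |R x t u - R x t v| ≤ L * |u - v|
  lip_xt : ∀ M : ℝ, ∃ K : ℝ, ∀ x ∈ closure Ω, ∀ y ∈ closure Ω, ∀ t ∈ Icc 0 T, ∀ s ∈ Icc 0 T,
    ∀ u : ℝ, |u| ≤ M → |R x t u - R y s u| ≤ K * (‖x - y‖ + |t - s|)

/-- `X` (written `X t x`) is a classical solution of
`∂ₜX - div(D ∇X) + q·∇X = R(x,t,X)` in `Ω × [0,T]`, `X = 0` on `∂Ω`, `X(0) = X₀`.
As `D` need not be continuous, the equation is tested with functions of `C_c^∞(Ω)`. -/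
structure IsClassicalSolution {d : ℕ} (Ω : Set (Sp d)) (T : ℝ) (D : Sp d → Sp d →L[ℝ] Sp d)
    (q : Sp d → Sp d) (R : Sp d → ℝ → ℝ → ℝ) (X₀ : Sp d → ℝ) (X : ℝ → Sp d → ℝ) : Prop where
  /-- `X`, `∇X` and `∇²X` are continuous on `closure Ω × [0,T]`. -/
  c2 : ∃ (G : ℝ → Sp d → Sp d) (H : ℝ → Sp d → Sp d →L[ℝ] Sp d),
    ContinuousOn (fun p : ℝ × Sp d => X p.1 p.2) (Icc 0 T ×ˢ closure Ω) ∧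
    ContinuousOn (fun p : ℝ × Sp d => G p.1 p.2) (Icc 0 T ×ˢ closure Ω) ∧
    ContinuousOn (fun p : ℝ × Sp d => H p.1 p.2) (Icc 0 T ×ˢ closure Ω) ∧
    ∀ t ∈ Icc 0 T, ∀ x ∈ Ω, HasGradientAt (X t) (G t x) x ∧ HasFDerivAt (G t) (H t x) x
  diff_time : ∀ x ∈ Ω, DifferentiableOn ℝ (fun t => X t x) (Icc 0 T)
  boundary : ∀ t ∈ Icc 0 T, ∀ x ∈ frontier Ω, X t x = 0
  initial : ∀ x ∈ closure Ω, X 0 x = X₀ x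
  equation : ∀ φ : Sp d → ℝ, ContDiff ℝ ∞ φ → HasCompactSupport φ → tsupport φ ⊆ Ω →
    ∀ t ∈ Icc 0 T,
      HasDerivWithinAt (fun s => ∫ x in Ω, X s x * φ x)
        (∫ x in Ω, (R x t (X t x) * φ x - ⟪D x (gradient (X t) x), gradient φ x⟫
          - ⟪q x, gradient (X t) x⟫ * φ x)) (Icc 0 T) t

/-! ### Admissible meshes -/

/-- The mean value `D_K` of the diffusion tensor over a control volume `K`. -/
def meanTensor {d : ℕ} (D : Sp d → Sp d →L[ℝ] Sp d) (K : Set (Sp d)) : Sp d →L[ℝ] Sp d :=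
  (volume.real K)⁻¹ • ∫ x in K, D x

/-- An admissible mesh of `Ω` for the diffusion tensor `D`. Control volumes are indexed by `ι`,
edges by `ε`; `edges i` is the set `E_i` of edges of the control volume `i`. For `σ ∈ edges i`,
`nbr i σ = some j` means that `σ = i|j` is an interior edge, `nbr i σ = none` that `σ ⊆ ∂Ω`. -/
structure AdmissibleMesh {d : ℕ} (Ω : Set (Sp d)) (D : Sp d → Sp d →L[ℝ] Sp d)
    (ι ε : Type) [Fintype ι] where
  cell : ι → Set (Sp d)
  center : ι → Sp d
  edges : ι → Finset ε
  face : ε → Set (Sp d)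
  nbr : ι → ε → Option ι
  /-- Unit normal to `σ` outward to `i`. -/
  normal : ι → ε → Sp d
  /-- The point at which the lines through the adjacent centers, perpendicular to `σ`, meet `σ`. -/
  foot : ε → Sp d
  cell_open : ∀ i, IsOpen (cell i)
  cell_convex : ∀ i, Convex ℝ (cell i)
  cell_nonempty : ∀ i, (cell i).Nonempty
  cell_subset : ∀ i, cell i ⊆ Ω
  cell_disjoint : ∀ i j, i ≠ j → Disjoint (cell i) (cell j)
  cell_cover : closure Ω = ⋃ i, closure (cell i)
  face_closed : ∀ i, ∀ σ ∈ edges i, IsClosed (face σ)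
  cell_frontier : ∀ i, frontier (cell i) = ⋃ σ ∈ edges i, face σ
  face_inter : ∀ i, ∀ σ ∈ edges i, ∀ σ' ∈ edges i, σ ≠ σ' → μHE[d - 1] (face σ ∩ face σ') = 0
  normal_norm : ∀ i, ∀ σ ∈ edges i, ‖normal i σ‖ = 1
  /-- `σ` lies in a hyperplane with normal `normal i σ`, and `i` on its inner side. -/
  face_plane : ∀ i, ∀ σ ∈ edges i, ∀ x ∈ face σ, ⟪normal i σ, x - foot σ⟫ = 0
  cell_side : ∀ i, ∀ σ ∈ edges i, ∀ x ∈ cell i, ⟪normal i σ, x - foot σ⟫ < 0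
  boundary_edge : ∀ i, ∀ σ ∈ edges i, nbr i σ = none → face σ ⊆ frontier Ω
  interior_edge : ∀ i, ∀ σ ∈ edges i, ∀ j, nbr i σ = some j →
    j ≠ i ∧ σ ∈ edges j ∧ nbr j σ = some i ∧
    face σ = closure (cell i) ∩ closure (cell j) ∧ μHE[d - 1] (face σ ∩ frontier Ω) = 0
  center_mem : ∀ i, center i ∈ closure (cell i)
  foot_mem : ∀ i, ∀ σ ∈ edges i, foot σ ∈ face σ
  /-- The line through `center i` and `foot σ` is perpendicular to `σ` for the inner product
  induced by `D_i⁻¹`: here `w = D_i⁻¹ (foot σ - center i)`. -/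
  perp : ∀ i, ∀ σ ∈ edges i, ∃ w : Sp d, meanTensor D (cell i) w = foot σ - center i ∧
    ∀ v : Sp d, ⟪normal i σ, v⟫ = 0 → ⟪w, v⟫ = 0

namespace AdmissibleMesh

variable {d : ℕ} {Ω : Set (Sp d)} {D : Sp d → Sp d →L[ℝ] Sp d} {ι ε : Type} [Fintype ι]

/-- The mesh size `h`, the largest diameter of a control volume. -/
def size (𝒯 : AdmissibleMesh Ω D ι ε) : ℝ := ⨆ i, Metric.diam (𝒯.cell i)

/-- `mes(i)`. -/
def mesCell (𝒯 : AdmissibleMesh Ω D ι ε) (i : ι) : ℝ := volume.real (𝒯.cell i)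

/-- `mes(σ)`, the `(d-1)`-dimensional Lebesgue measure of the edge. -/
def mesEdge (𝒯 : AdmissibleMesh Ω D ι ε) (σ : ε) : ℝ :=
  (μHE[d - 1] : Measure (Sp d)).real (𝒯.face σ)

/-- `d_{i,σ}`, the distance from the center of `i` to `σ` along the perpendicular line. -/
def distEdge (𝒯 : AdmissibleMesh Ω D ι ε) (i : ι) (σ : ε) : ℝ := dist (𝒯.center i) (𝒯.foot σ)

/-- `d_σ`: equal to `d_{i,j}` if `σ = i|j` and to `d_{i,σ}` if `σ ⊆ ∂Ω`. -/
def distSigma (𝒯 : AdmissibleMesh Ω D ι ε) (i : ι) (σ : ε) : ℝ :=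
  match 𝒯.nbr i σ with
  | some j => dist (𝒯.center i) (𝒯.center j)
  | none => 𝒯.distEdge i σ

/-- `D_{i,σ} = |D_i n_{i,σ}|`. -/
def diffEdge (𝒯 : AdmissibleMesh Ω D ι ε) (i : ι) (σ : ε) : ℝ :=
  ‖meanTensor D (𝒯.cell i) (𝒯.normal i σ)‖

/-- `μ_σ`, so that the two one-sided diffusive fluxes through `σ = i|j` agree. -/
def mu (𝒯 : AdmissibleMesh Ω D ι ε) (i : ι) (σ : ε) : ℝ :=
  match 𝒯.nbr i σ with
  | some j => dist (𝒯.center i) (𝒯.center j) * (𝒯.diffEdge i σ * 𝒯.diffEdge j σ /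
      (𝒯.diffEdge j σ * 𝒯.distEdge i σ + 𝒯.diffEdge i σ * 𝒯.distEdge j σ))
  | none => 𝒯.diffEdge i σ

/-- The transmissibility `τ_σ = mes(σ) μ_σ / d_σ`. -/
def tau (𝒯 : AdmissibleMesh Ω D ι ε) (i : ι) (σ : ε) : ℝ :=
  𝒯.mesEdge σ * 𝒯.mu i σ / 𝒯.distSigma i σ

/-- `q_{i,σ}`, the integral of `q · n_{i,σ}` over `σ`. -/
def flux (𝒯 : AdmissibleMesh Ω D ι ε) (q : Sp d → Sp d) (i : ι) (σ : ε) : ℝ :=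
  ∫ x in 𝒯.face σ, ⟪q x, 𝒯.normal i σ⟫ ∂μHE[d - 1]

/-- The value on the other side of `σ` seen from `i`: `u_j` if `σ = i|j`, and `0` if `σ ⊆ ∂Ω`. -/
def across (𝒯 : AdmissibleMesh Ω D ι ε) (u : ι → ℝ) (i : ι) (σ : ε) : ℝ :=
  match 𝒯.nbr i σ with
  | some j => u j
  | none => 0

/-- The upwind value `u_{σ,+}`. -/
def upwind (𝒯 : AdmissibleMesh Ω D ι ε) (q : Sp d → Sp d) (u : ι → ℝ) (i : ι) (σ : ε) : ℝ :=
  if 0 ≤ 𝒯.flux q i σ then u i else 𝒯.across u i σ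

/-- Regularity of the mesh with constants `ζ₁`, `ζ₂`, and of `D` on the control volumes. -/
structure Regular (𝒯 : AdmissibleMesh Ω D ι ε) (ζ₁ ζ₂ : ℝ) : Prop where
  tensor_c1 : ∀ i, ∃ g : Sp d → Sp d →L[ℝ] Sp d, C1UpTo (𝒯.cell i) g ∧ EqOn D g (𝒯.cell i)
  mes_cell : ∀ i, ζ₁ * 𝒯.size ^ d ≤ 𝒯.mesCell i ∧ 𝒯.mesCell i ≤ ζ₂ * 𝒯.size ^ d
  mes_edge : ∀ i, ∀ σ ∈ 𝒯.edges i,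
    ζ₁ * 𝒯.size ^ (d - 1) ≤ 𝒯.mesEdge σ ∧ 𝒯.mesEdge σ ≤ ζ₂ * 𝒯.size ^ (d - 1)
  dist_sigma : ∀ i, ∀ σ ∈ 𝒯.edges i,
    ζ₁ * 𝒯.size ≤ 𝒯.distSigma i σ ∧ 𝒯.distSigma i σ ≤ ζ₂ * 𝒯.size

/-! ### The scheme

Elements of the discrete space `V_h` are determined by, and identified with, their values at the
centers, that is, with the elements of `ι → ℝ`. -/

/-- The discrete scalar product `⟨u, v⟩_{0,h}`. -/
def inner0 (𝒯 : AdmissibleMesh Ω D ι ε) (u v : ι → ℝ) : ℝ := ∑ i, 𝒯.mesCell i * u i * v i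

/-- The discrete `L²` norm `‖u‖_{0,h}`. -/
def norm0 (𝒯 : AdmissibleMesh Ω D ι ε) (u : ι → ℝ) : ℝ := √(𝒯.inner0 u u)

/-- Values at the centers; this is the orthogonal projection `P_h` for `⟨·,·⟩_{0,h}`. -/
def proj (𝒯 : AdmissibleMesh Ω D ι ε) (f : Sp d → ℝ) : ι → ℝ := fun i => f (𝒯.center i)

/-- The bilinear form `a_h`, for the operator shifted by `c₀`. -/
def form (𝒯 : AdmissibleMesh Ω D ι ε) (q : Sp d → Sp d) (c₀ : ℝ) (u v : ι → ℝ) : ℝ :=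
  ∑ i, ((∑ σ ∈ 𝒯.edges i,
    (-(𝒯.tau i σ * (𝒯.across u i σ - u i)) + 𝒯.flux q i σ * 𝒯.upwind q u i σ)) * v i
      + c₀ * 𝒯.mesCell i * u i * v i)

/-- The discrete operator `A_h`, with `⟨A_h u, v⟩_{0,h} = a_h(u, v)` (see `inner0_operator`). -/
def operator (𝒯 : AdmissibleMesh Ω D ι ε) (q : Sp d → Sp d) (c₀ : ℝ) :
    (ι → ℝ) →L[ℝ] (ι → ℝ) :=
  LinearMap.toContinuousLinearMap
    { toFun := fun u i => (𝒯.mesCell i)⁻¹ * (∑ σ ∈ 𝒯.edges i,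
        (-(𝒯.tau i σ * (𝒯.across u i σ - u i)) + 𝒯.flux q i σ * 𝒯.upwind q u i σ)) + c₀ * u i
      map_add' := by
        intro u v
        funext i
        simp only [Pi.add_apply]
        rw [show ∀ m a b x y : ℝ, m * a + c₀ * x + (m * b + c₀ * y) = m * (a + b) + c₀ * (x + y) by
          intros; ring, ← Finset.sum_add_distrib]
        refine congrArg (fun z => (𝒯.mesCell i)⁻¹ * z + c₀ * (u i + v i)) ?_
        refine Finset.sum_congr rfl fun σ _ => ?_
        unfold upwind across
        cases 𝒯.nbr i σ <;> split_ifs <;> simp <;> ring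
      map_smul' := by
        intro c u
        funext i
        simp only [Pi.smul_apply, smul_eq_mul, RingHom.id_apply]
        rw [show ∀ m a x : ℝ, c * (m * a + c₀ * x) = m * (c * a) + c₀ * (c * x) by
          intros; ring, Finset.mul_sum _ _ c]
        refine congrArg (fun z => (𝒯.mesCell i)⁻¹ * z + c₀ * (c * u i)) ?_
        refine Finset.sum_congr rfl fun σ _ => ?_
        unfold upwind across
        cases 𝒯.nbr i σ <;> split_ifs <;> simp <;> ring }

theorem mesCell_pos (𝒯 : AdmissibleMesh Ω D ι ε) (hΩ : Bornology.IsBounded Ω) (i : ι) :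
    0 < 𝒯.mesCell i := by
  have hb : Bornology.IsBounded (𝒯.cell i) := hΩ.subset (𝒯.cell_subset i)
  exact ENNReal.toReal_pos ((𝒯.cell_open i).measure_pos volume (𝒯.cell_nonempty i)).ne'
    hb.measure_lt_top.ne

theorem inner0_operator (𝒯 : AdmissibleMesh Ω D ι ε) (hΩ : Bornology.IsBounded Ω)
    (q : Sp d → Sp d) (c₀ : ℝ) (u v : ι → ℝ) :
    𝒯.inner0 (𝒯.operator q c₀ u) v = 𝒯.form q c₀ u v := by
  unfold inner0 form
  refine Finset.sum_congr rfl fun i _ => ?_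
  have h := (𝒯.mesCell_pos hΩ i).ne'
  simp only [operator, LinearMap.coe_toContinuousLinearMap', LinearMap.coe_mk, AddHom.coe_mk]
  field_simp

/-- `P_h f` is the only element of `V_h` with `⟨P_h f, χ⟩_{0,h} = ⟨f, χ⟩_{0,h}` for all `χ`. -/
theorem eq_proj_iff (𝒯 : AdmissibleMesh Ω D ι ε) (hΩ : Bornology.IsBounded Ω)
    (f : Sp d → ℝ) (u : ι → ℝ) :
    (∀ χ : ι → ℝ, 𝒯.inner0 u χ = ∑ i, 𝒯.mesCell i * f (𝒯.center i) * χ i) ↔ u = 𝒯.proj f := by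
  classical
  constructor
  · intro h
    funext i
    have h1 := h (Pi.single i 1)
    simp only [inner0, Pi.single_apply, mul_ite, mul_one, mul_zero, Finset.sum_ite_eq',
      Finset.mem_univ, if_true] at h1
    exact mul_left_cancel₀ (𝒯.mesCell_pos hΩ i).ne' h1
  · rintro rfl χ
    rfl

end AdmissibleMesh

/-- `φ₁(-Δt A) = (1/Δt) ∫₀^{Δt} e^{-(Δt - s) A} ds`. -/
def phi1 {ι : Type} [Fintype ι] (A : (ι → ℝ) →L[ℝ] (ι → ℝ)) (Δt : ℝ) : (ι → ℝ) →L[ℝ] (ι → ℝ) :=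
  Δt⁻¹ • ∫ s in (0 : ℝ)..Δt, NormedSpace.exp (-(Δt - s) • A)

/-- The ETD1 approximations `X_h^m`, started from `X_h^0 = P_h X₀`:
`X_h^{m+1} = X_h^m + Δt φ₁(-Δt A_h)(-A_h X_h^m + P_h R(X_h^m))` at `t_m = m Δt`. The term `c₀ X` has
been added to both sides of the equation, hence `c₀` in `A_h` and in the reaction term. -/
def etd1 {d : ℕ} {Ω : Set (Sp d)} {D : Sp d → Sp d →L[ℝ] Sp d} {ι ε : Type} [Fintype ι]
    (𝒯 : AdmissibleMesh Ω D ι ε) (q : Sp d → Sp d) (R : Sp d → ℝ → ℝ → ℝ) (c₀ : ℝ)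
    (X₀ : Sp d → ℝ) (Δt : ℝ) : ℕ → ι → ℝ
  | 0 => 𝒯.proj X₀
  | m + 1 => etd1 𝒯 q R c₀ X₀ Δt m + Δt • phi1 (𝒯.operator q c₀) Δt
      (-(𝒯.operator q c₀ (etd1 𝒯 q R c₀ X₀ Δt m)) +
        fun i => R (𝒯.center i) (m * Δt) (etd1 𝒯 q R c₀ X₀ Δt m i)
          + c₀ * etd1 𝒯 q R c₀ X₀ Δt m i)

end FVETD

end

/-! The exact solution enters in two forms: its means over the control volumes (`cellAvg`), which
satisfy an exact balance of fluxes, and its values at the centers (`proj`), on which the scheme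
acts. Inserting center values into the numerical fluxes leaves on each edge an error of order `h *
mes(σ)`. After division by `mes(i)` this is only O(1), so the scheme is not shown to be consistent
in the discrete `L²` norm. The edge errors are however opposite from the two sides of an interior
edge, and summation by parts turns the pairing of the residual with `ψ` into at most `C h |ψ|_{1,h}`
(`abs_residual_le`).

That the exact fluxes are opposite needs proof, as `D` may jump across edges. Inside a control
volume the weak equation holds pointwise; reinserting this into the weak equation on `Ω` leaves only
face integrals against arbitrary test functions, so the flux jumps vanish almost everywhere on the
faces (`exactFlux_conservative`). The divergence theorem on convex polytopes, for the area measure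
on the faces, is proved by slicing along the coordinate directions.

One step of ETD1 is the exact flow of `Y' + A_h Y = F` with frozen source (`exists_flow`). The error
at `t_m` is therefore tested with the dual solution `ψ(s) = exp(-(t_m - s)A') v`, where `A'` is the
adjoint of `A_h`. Its smoothing properties `|ψ|_{1,h} ≤ C (t_m - s)^(-1/2) ‖v‖` and `‖A'ψ‖ ≤ C (t_m
- s)^(-1) ‖v‖` follow from one weighted energy functional, with constants uniform in the mesh,
because the upwind convection is nonnegative and its first argument is needed only in `L²`
(`Stable.semigroup_bounds`). The first bound makes the residual integrable in time.

The difference `ρ` between center values and means produces the term `⟨ρ, A'ψ⟩`, for which `(t_m -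
s)^(-1)` alone would not be integrable. Replacing `ρ(s)` by `ρ(s) - ρ(t_m)` repairs this: the
difference is at most `C h √(t_m - s)`, since `∇X` is Hölder continuous of order 1/2 in time, by
interpolation between the Lipschitz bound of `X` in time and the bound of `∇²X`. Every singularity
is then `(t_m - s)^(-1/2)` and no logarithm appears. The reaction term is Lipschitz and is handled
by a discrete Gronwall inequality (`Stable.error_bound`).

For the constant to be independent of the mesh, the `C¹` bounds of `D` must be so too. Bounds
obtained on one regular mesh pass to every other by density, because both see the same tensor
(`TensorBound.transfer`). -/

noncomputable section

namespace FVETD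

/-! ### Slicing along a coordinate and graphs of hyperplanes -/

section Slicing

variable {n : ℕ}

/-- The point of `ℝ^(n+1)` with `k`-th coordinate `s` and remaining coordinates `y`. -/
def ins (k : Fin (n + 1)) (s : ℝ) (y : Sp n) : Sp (n + 1) :=
  WithLp.toLp 2 (k.insertNth (α := fun _ => ℝ) s y.ofLp)

/-- The projection of `ℝ^(n+1)` that forgets the `k`-th coordinate. -/
def dropCoord (k : Fin (n + 1)) : Sp (n + 1) →L[ℝ] Sp n :=
  LinearMap.toContinuousLinearMap
    { toFun := fun x => WithLp.toLp 2 fun j => x (k.succAbove j)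
      map_add' := fun _ _ => rfl
      map_smul' := fun _ _ => rfl }

@[simp] theorem ins_same (k : Fin (n + 1)) (s : ℝ) (y : Sp n) : ins k s y k = s := by
  simp [ins]

@[simp] theorem ins_succAbove (k : Fin (n + 1)) (s : ℝ) (y : Sp n) (j : Fin n) :
    ins k s y (k.succAbove j) = y j := by
  simp [ins]

@[simp] theorem dropCoord_apply (k : Fin (n + 1)) (x : Sp (n + 1)) (j : Fin n) :
    dropCoord k x j = x (k.succAbove j) := rfl

@[simp] theorem dropCoord_ins (k : Fin (n + 1)) (s : ℝ) (y : Sp n) :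
    dropCoord k (ins k s y) = y := by
  ext j; simp

theorem ext_succAbove (k : Fin (n + 1)) {x x' : Sp (n + 1)} (h : x k = x' k)
    (h' : ∀ j, x (k.succAbove j) = x' (k.succAbove j)) : x = x' := by
  ext i
  rcases Fin.eq_self_or_eq_succAbove k i with rfl | ⟨j, rfl⟩
  exacts [h, h' j]

@[simp] theorem ins_dropCoord (k : Fin (n + 1)) (x : Sp (n + 1)) :
    ins k (x k) (dropCoord k x) = x :=
  ext_succAbove k (by simp) (by simp)

theorem ins_sub_ins (k : Fin (n + 1)) (s s' : ℝ) (y : Sp n) :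
    ins k s y - ins k s' y = EuclideanSpace.single k (s - s') :=
  ext_succAbove k (by simp) (by simp)

theorem continuous_ins (k : Fin (n + 1)) : Continuous fun z : ℝ × Sp n => ins k z.1 z.2 := by
  unfold ins
  refine (PiLp.continuous_toLp 2 _).comp ?_
  exact Continuous.finInsertNth (A := fun _ => ℝ) k continuous_fst
    ((PiLp.continuous_ofLp 2 fun _ : Fin n => ℝ).comp continuous_snd)

theorem inner_eq_succAbove (k : Fin (n + 1)) (x x' : Sp (n + 1)) :
    ⟪x, x'⟫ = x k * x' k + ∑ j, x (k.succAbove j) * x' (k.succAbove j) := by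
  rw [PiLp.inner_apply, Fin.sum_univ_succAbove _ k]
  simp [mul_comm]

theorem measurePreserving_ins (k : Fin (n + 1)) :
    MeasurePreserving (fun z : ℝ × Sp n => ins k z.1 z.2) := by
  have h1 : MeasurePreserving (fun z : ℝ × Sp n => (z.1, z.2.ofLp)) volume volume :=
    (MeasurePreserving.id volume).prod (PiLp.volume_preserving_ofLp (Fin n))
  have h2 := (volume_preserving_piFinSuccAbove (fun _ : Fin (n + 1) => ℝ) k).symm
  exact ((PiLp.volume_preserving_toLp (Fin (n + 1))).comp h2).comp h1

theorem measurableEmbedding_ins (k : Fin (n + 1)) :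
    MeasurableEmbedding (fun z : ℝ × Sp n => ins k z.1 z.2) := by
  refine Continuous.measurableEmbedding (continuous_ins k) ?_
  rintro ⟨s, y⟩ ⟨s', y'⟩ h
  simp only at h
  have h1 := congrArg (fun x => x k) h
  have h2 := congrArg (dropCoord k) h
  simp at h1 h2
  simp [h1, h2]

theorem integral_eq_integral_ins (k : Fin (n + 1)) {f : Sp (n + 1) → ℝ} (hf : Integrable f) :
    ∫ x, f x = ∫ y, ∫ s, f (ins k s y) := by
  rw [← (measurePreserving_ins k).integral_comp (measurableEmbedding_ins k)]
  rw [Measure.volume_eq_prod, integral_prod_symm]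
  have := (measurePreserving_ins k).integrable_comp_of_integrable hf
  rwa [Measure.volume_eq_prod] at this

/-- The linear parametrization of `ν^⊥` by the coordinates other than the `k`-th. -/
def graphLin (k : Fin (n + 1)) (ν : Sp (n + 1)) : Sp n →ₗ[ℝ] Sp (n + 1) where
  toFun y := ins k (-(ν k)⁻¹ * ∑ j, ν (k.succAbove j) * y j) y
  map_add' y y' := ext_succAbove k
    (by simp [mul_add, Finset.sum_add_distrib]) (by simp)
  map_smul' c y := ext_succAbove k
    (by simp [Finset.mul_sum]; exact Finset.sum_congr rfl fun j _ => by ring) (by simp)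

/-- The parametrization of the hyperplane through `p` with normal `ν` by the coordinates other than
the `k`-th. -/
def graph (k : Fin (n + 1)) (ν p : Sp (n + 1)) (y : Sp n) : Sp (n + 1) :=
  p + graphLin k ν (y - dropCoord k p)

variable {k : Fin (n + 1)} {ν : Sp (n + 1)}

theorem inner_graphLin (hk : ν k ≠ 0) (y : Sp n) : ⟪ν, graphLin k ν y⟫ = 0 := by
  rw [inner_eq_succAbove k]
  simp [graphLin, hk]

theorem inner_graph_sub (hk : ν k ≠ 0) (p : Sp (n + 1)) (y : Sp n) :
    ⟪ν, graph k ν p y - p⟫ = 0 := by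
  rw [graph, add_sub_cancel_left, inner_graphLin hk]

theorem dropCoord_graphLin (y : Sp n) : dropCoord k (graphLin k ν y) = y := by
  simp [graphLin]

@[simp] theorem dropCoord_graph (p : Sp (n + 1)) (y : Sp n) : dropCoord k (graph k ν p y) = y := by
  simp [graph, dropCoord_graphLin]

theorem graphLin_dropCoord (hk : ν k ≠ 0) {x : Sp (n + 1)} (hx : ⟪ν, x⟫ = 0) :
    graphLin k ν (dropCoord k x) = x := by
  refine ext_succAbove k ?_ (by simp [graphLin])
  rw [inner_eq_succAbove k] at hx
  simp only [graphLin, LinearMap.coe_mk, AddHom.coe_mk, ins_same, dropCoord_apply]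
  field_simp
  linarith

theorem graph_dropCoord (hk : ν k ≠ 0) {p x : Sp (n + 1)} (hx : ⟪ν, x - p⟫ = 0) :
    graph k ν p (dropCoord k x) = x := by
  rw [graph, ← map_sub, graphLin_dropCoord hk hx]; abel

theorem continuous_graph (p : Sp (n + 1)) : Continuous (graph k ν p) := by
  have : Continuous (graphLin k ν) := LinearMap.continuous_of_finiteDimensional _
  unfold graph
  fun_prop

theorem graph_combo (p : Sp (n + 1)) (y y' : Sp n) {a b : ℝ} (hab : a + b = 1) :
    graph k ν p (a • y + b • y') = a • graph k ν p y + b • graph k ν p y' := by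
  have hb : b = 1 - a := by linarith
  subst hb
  simp only [graph, map_sub, map_add, map_smul]
  module

/-- The Gram matrix of the parametrization is the identity plus a rank one matrix, so the matrix
determinant lemma gives its determinant as `1 + ∑ ν_j² / ν_k²` over `j ≠ k`. This is `1 / ν_k²`
because `ν` is a unit vector. -/
theorem normDet_graphLin (hk : ν k ≠ 0) (hν : ‖ν‖ = 1) : (graphLin k ν).normDet = |ν k|⁻¹ := by
  have h1 := (graphLin k ν).normDet_sq_eq_det_gram (EuclideanSpace.basisFun (Fin n) ℝ)
  have h2 : Matrix.gram ℝ (fun i => graphLin k ν (EuclideanSpace.basisFun (Fin n) ℝ i)) =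
      1 + Matrix.replicateCol Unit (fun j => (ν k)⁻¹ * ν (k.succAbove j)) *
        Matrix.replicateRow Unit (fun j => (ν k)⁻¹ * ν (k.succAbove j)) := by
    ext i j
    rw [Matrix.gram_apply, inner_eq_succAbove k]
    simp [graphLin, Matrix.mul_apply, Matrix.one_apply, EuclideanSpace.basisFun_apply]
    ring_nf
    simp [eq_comm]
  rw [h2, Matrix.det_one_add_replicateCol_mul_replicateRow] at h1
  have h3 : ν k * ν k + ∑ j, ν (k.succAbove j) * ν (k.succAbove j) = 1 := by
    rw [← inner_eq_succAbove, real_inner_self_eq_norm_sq, hν]; norm_num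
  have h4 : (1 + (fun j => (ν k)⁻¹ * ν (k.succAbove j)) ⬝ᵥ
      (fun j => (ν k)⁻¹ * ν (k.succAbove j)) : ℝ) = (|ν k|⁻¹) ^ 2 := by
    simp only [dotProduct]
    rw [show ∑ j, (ν k)⁻¹ * ν (k.succAbove j) * ((ν k)⁻¹ * ν (k.succAbove j)) =
      (ν k)⁻¹ ^ 2 * ∑ j, ν (k.succAbove j) * ν (k.succAbove j) by
        rw [Finset.mul_sum]; exact Finset.sum_congr rfl fun j _ => by ring]
    rw [inv_pow, inv_pow, sq_abs]
    field_simp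
    simpa [sq] using h3
  rw [h4] at h1
  have h5 : (graphLin k ν).normDet ^ 2 = (|ν k|⁻¹) ^ 2 := by simpa using h1
  exact (pow_left_inj₀ (LinearMap.normDet_nonneg _) (by positivity) two_ne_zero).1 h5

theorem euclideanHausdorffMeasure_graph_image (hk : ν k ≠ 0) (hν : ‖ν‖ = 1) (p : Sp (n + 1))
    (A : Set (Sp n)) : μHE[n] (graph k ν p '' A) = ENNReal.ofReal |ν k|⁻¹ * volume A := by
  have h1 : graph k ν p '' A = (fun x => p + x) '' (graphLin k ν '' ((fun y => y - dropCoord k p) '' A)) := by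
    simp only [image_image]; rfl
  have h2 := (graphLin k ν).euclideanHausdorffMeasure_image_eq_normDet_mul_volume
    ((fun y => y - dropCoord k p) '' A)
  rw [finrank_euclideanSpace_fin] at h2
  rw [h1, (isometry_add_left p).euclideanHausdorffMeasure_image, h2, normDet_graphLin hk hν]
  simp [sub_eq_add_neg]

theorem measurableEmbedding_graph (p : Sp (n + 1)) : MeasurableEmbedding (graph k ν p) :=
  (continuous_graph p).measurableEmbedding fun y y' h => by
    simpa using congrArg (dropCoord k) h

/-- The area formula for a hyperplane. -/
theorem map_graph_volume (hk : ν k ≠ 0) (hν : ‖ν‖ = 1) (p : Sp (n + 1)) :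
    (volume : Measure (Sp n)).map (graph k ν p) =
      ENNReal.ofReal |ν k| • (μHE[n] : Measure (Sp (n + 1))).restrict (range (graph k ν p)) := by
  ext s hs
  rw [Measure.map_apply (continuous_graph p).measurable hs, Measure.smul_apply,
    Measure.restrict_apply hs, ← image_preimage_eq_inter_range,
    euclideanHausdorffMeasure_graph_image hk hν, smul_eq_mul, ← mul_assoc,
    ← ENNReal.ofReal_mul (abs_nonneg _), mul_inv_cancel₀ (abs_ne_zero.2 hk)]
  simp

/-- The weight `|ν k|` cancels the area density of the graph. The `k`-th component of a boundary
flux thus becomes a Lebesgue integral over the projection of the face, where Fubini's theorem and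
the fundamental theorem of calculus can reach it. -/
theorem abs_mul_setIntegral_face (hk : ν k ≠ 0) (hν : ‖ν‖ = 1) {p : Sp (n + 1)}
    {F : Set (Sp (n + 1))} (hF : MeasurableSet F) (hFp : ∀ x ∈ F, ⟪ν, x - p⟫ = 0)
    (g : Sp (n + 1) → ℝ) :
    |ν k| * ∫ x in F, g x ∂μHE[n] = ∫ y in graph k ν p ⁻¹' F, g (graph k ν p y) := by
  rw [← (measurableEmbedding_graph p).setIntegral_map, map_graph_volume hk hν,
    Measure.restrict_smul, Measure.restrict_restrict hF, integral_smul_measure,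
    inter_eq_left.2, ENNReal.toReal_ofReal (abs_nonneg _), smul_eq_mul]
  exact fun x hx => ⟨_, graph_dropCoord hk (hFp x hx)⟩

theorem euclideanHausdorffMeasure_eq_zero_iff (hk : ν k ≠ 0) (hν : ‖ν‖ = 1) {p : Sp (n + 1)}
    {F : Set (Sp (n + 1))} (hFp : ∀ x ∈ F, ⟪ν, x - p⟫ = 0) :
    (μHE[n] : Measure (Sp (n + 1))) F = 0 ↔ volume (graph k ν p ⁻¹' F) = 0 := by
  have h1 : graph k ν p '' (graph k ν p ⁻¹' F) = F := by
    rw [image_preimage_eq_inter_range, inter_eq_left]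
    exact fun x hx => ⟨_, graph_dropCoord hk (hFp x hx)⟩
  rw [← h1, euclideanHausdorffMeasure_graph_image hk hν, h1]
  simp [hk]

theorem euclideanHausdorffMeasure_lt_top_of_bounded (hk : ν k ≠ 0) (hν : ‖ν‖ = 1) {p : Sp (n + 1)}
    {F : Set (Sp (n + 1))} (hFp : ∀ x ∈ F, ⟪ν, x - p⟫ = 0) (hb : Bornology.IsBounded F) :
    (μHE[n] : Measure (Sp (n + 1))) F < ⊤ := by
  have h1 : graph k ν p '' (dropCoord k '' F) = F := by
    rw [image_image]
    exact (image_congr fun x hx => graph_dropCoord hk (hFp x hx)).trans (image_id _)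
  rw [← h1, euclideanHausdorffMeasure_graph_image hk hν]
  exact ENNReal.mul_lt_top ENNReal.ofReal_lt_top
    ((dropCoord k).lipschitz.isBounded_image hb).measure_lt_top

theorem exists_coord_ne_zero (hν : ‖ν‖ = 1) : ∃ k, ν k ≠ 0 := by
  by_contra! h
  have : ν = 0 := by ext i; simpa using h i
  simp [this] at hν

end Slicing

/-! ### The divergence theorem on a convex polytope -/

/-- A bounded open convex set whose frontier is a finite union of closed faces lying in supporting
hyperplanes and overlapping in null sets. -/
structure IsPolytope {n : ℕ} {ε : Type} (K : Set (Sp (n + 1))) (E : Finset ε)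
    (F : ε → Set (Sp (n + 1))) (ν p : ε → Sp (n + 1)) : Prop where
  isOpen : IsOpen K
  convex : Convex ℝ K
  nonempty : K.Nonempty
  bounded : Bornology.IsBounded K
  closed : ∀ σ ∈ E, IsClosed (F σ)
  frontier_eq : frontier K = ⋃ σ ∈ E, F σ
  inter : ∀ σ ∈ E, ∀ σ' ∈ E, σ ≠ σ' → (μHE[n] : Measure (Sp (n + 1))) (F σ ∩ F σ') = 0
  norm_eq : ∀ σ ∈ E, ‖ν σ‖ = 1
  plane : ∀ σ ∈ E, ∀ x ∈ F σ, ⟪ν σ, x - p σ⟫ = 0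
  side : ∀ σ ∈ E, ∀ x ∈ K, ⟪ν σ, x - p σ⟫ < 0

namespace IsPolytope

variable {n : ℕ} {ε : Type} {K : Set (Sp (n + 1))} {E : Finset ε}
  {F : ε → Set (Sp (n + 1))} {ν p : ε → Sp (n + 1)}

theorem face_subset_frontier (hK : IsPolytope K E F ν p) {σ : ε} (hσ : σ ∈ E) :
    F σ ⊆ frontier K := by
  rw [hK.frontier_eq]
  exact subset_biUnion_of_mem (u := F) (by exact_mod_cast hσ)

theorem face_subset_closure (hK : IsPolytope K E F ν p) {σ : ε} (hσ : σ ∈ E) :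
    F σ ⊆ closure K :=
  (hK.face_subset_frontier hσ).trans frontier_subset_closure

theorem isCompact_closure (hK : IsPolytope K E F ν p) : IsCompact (closure K) :=
  hK.bounded.isCompact_closure

theorem isCompact_face (hK : IsPolytope K E F ν p) {σ : ε} (hσ : σ ∈ E) : IsCompact (F σ) :=
  hK.isCompact_closure.of_isClosed_subset (hK.closed σ hσ) (hK.face_subset_closure hσ)

theorem measure_face_lt_top (hK : IsPolytope K E F ν p) {σ : ε} (hσ : σ ∈ E) :
    (μHE[n] : Measure (Sp (n + 1))) (F σ) < ⊤ := by
  obtain ⟨k, hk⟩ := exists_coord_ne_zero (hK.norm_eq σ hσ)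
  exact euclideanHausdorffMeasure_lt_top_of_bounded hk (hK.norm_eq σ hσ) (hK.plane σ hσ)
    (hK.isCompact_face hσ).isBounded

theorem integrableOn_face (hK : IsPolytope K E F ν p) {σ : ε} (hσ : σ ∈ E)
    {V : Type*} [NormedAddCommGroup V] {g : Sp (n + 1) → V} (hg : ContinuousOn g (closure K)) :
    IntegrableOn g (F σ) μHE[n] := by
  have hc := hg.mono (hK.face_subset_closure hσ)
  obtain ⟨C, hC⟩ := (hK.isCompact_face hσ).exists_bound_of_continuousOn hc
  exact IntegrableOn.of_bound (hK.measure_face_lt_top hσ)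
    (hc.aestronglyMeasurable_of_isCompact (hK.isCompact_face hσ) (hK.closed σ hσ).measurableSet) C
    ((ae_restrict_iff' (hK.closed σ hσ).measurableSet).2 (Filter.Eventually.of_forall hC))

/-- The faces on one side of `K`, seen along a coordinate direction, parametrize the end points of
the slices of `K`. -/
theorem sum_face_eq_setIntegral_endpoint [DecidableEq ε] (hK : IsPolytope K E F ν p)
    (k : Fin (n + 1)) (c : ℝ) (e : Sp n → ℝ)
    (h_close : ∀ y ∈ dropCoord k '' K, e y ∈ closure {s | ins k s y ∈ K})
    (h_not_mem : ∀ y ∈ dropCoord k '' K, ins k (e y) y ∉ K)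
    (h_end : ∀ y ∈ dropCoord k '' K, ∀ s, ins k s y ∈ closure K → 0 ≤ c * (e y - s))
    (h_sign : ∀ y ∈ dropCoord k '' K, ∀ s, ins k s y ∈ K → 0 < c * (e y - s))
    {g : Sp (n + 1) → ℝ} (hg : ContinuousOn g (closure K)) :
    IntegrableOn (fun y => g (ins k (e y) y)) (dropCoord k '' K) ∧
    ∑ σ ∈ E with 0 < c * ν σ k, |ν σ k| * ∫ x in F σ, g x ∂μHE[n] =
      ∫ y in dropCoord k '' K, g (ins k (e y) y) := by
  classical
  have hne : ∀ σ, 0 < c * ν σ k → ν σ k ≠ 0 := fun σ h h0 => by simp [h0] at h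
  have hopen : IsOpen (dropCoord k '' K) :=
    (dropCoord k).isOpenMap (fun y => ⟨ins k 0 y, by simp⟩) K hK.isOpen
  have hconv : Convex ℝ (dropCoord k '' K) := hK.convex.linear_image (dropCoord k).toLinearMap
  have hpm : ∀ σ ∈ E, MeasurableSet (graph k (ν σ) (p σ) ⁻¹' F σ) := fun σ hσ =>
    ((hK.closed σ hσ).preimage (continuous_graph _)).measurableSet
  have hint : ∀ σ ∈ E, IntegrableOn (fun y => g (graph k (ν σ) (p σ) y))
      (graph k (ν σ) (p σ) ⁻¹' F σ) := by
    intro σ hσ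
    have hcl : IsClosed (graph k (ν σ) (p σ) ⁻¹' F σ) :=
      (hK.closed σ hσ).preimage (continuous_graph _)
    have hcomp : IsCompact (graph k (ν σ) (p σ) ⁻¹' F σ) := by
      refine ((hK.isCompact_face hσ).image (dropCoord k).continuous).of_isClosed_subset hcl ?_
      intro y hy
      exact ⟨_, hy, by simp⟩
    refine ContinuousOn.integrableOn_compact hcomp ?_
    exact hg.comp (continuous_graph _).continuousOn fun y hy => hK.face_subset_closure hσ hy
  have hint' : ∀ σ ∈ {σ ∈ E | 0 < c * ν σ k}, Integrable
      ((graph k (ν σ) (p σ) ⁻¹' F σ).indicator fun y => g (graph k (ν σ) (p σ) y)) := fun σ hσ =>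
    (hint σ (Finset.mem_filter.1 hσ).1).integrable_indicator (hpm σ (Finset.mem_filter.1 hσ).1)
  -- Both claims follow once the integrands agree almost everywhere: over almost every `y` in the
  -- projection of `K` there is exactly one face whose normal has the sign of `c`, and it passes
  -- through the end point `e y`; outside the projection there is none. The values `c = 1` and `c =
  -- -1` serve for upper and lower ends.
  suffices hae : (fun y => ∑ σ ∈ E with 0 < c * ν σ k,
      (graph k (ν σ) (p σ) ⁻¹' F σ).indicator (fun y => g (graph k (ν σ) (p σ) y)) y) =ᵐ[volume]
      (dropCoord k '' K).indicator fun y => g (ins k (e y) y) by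
    refine ⟨(integrable_indicator_iff hopen.measurableSet).1
      ((integrable_finsetSum _ hint').congr hae), ?_⟩
    rw [Finset.sum_congr rfl fun σ hσ => abs_mul_setIntegral_face
      (hne σ (Finset.mem_filter.1 hσ).2) (hK.norm_eq σ (Finset.mem_filter.1 hσ).1)
      (hK.closed σ (Finset.mem_filter.1 hσ).1).measurableSet (hK.plane σ (Finset.mem_filter.1 hσ).1) g]
    rw [← integral_indicator hopen.measurableSet,
      Finset.sum_congr rfl fun σ hσ => (integral_indicator (hpm σ (Finset.mem_filter.1 hσ).1)).symm,
      ← integral_finsetSum _ hint']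
    exact integral_congr_ae hae
  -- Two null sets are discarded: the frontier of the projection, which is convex, and the
  -- projections of the overlaps of two faces.
  have hae1 : ∀ᵐ y : Sp n, y ∉ frontier (dropCoord k '' K) :=
    measure_eq_zero_iff_ae_notMem.1 (hconv.addHaar_frontier volume)
  have hae2 : ∀ᵐ y : Sp n, ∀ σ ∈ {σ ∈ E | 0 < c * ν σ k}, ∀ σ' ∈ E, σ ≠ σ' →
      graph k (ν σ) (p σ) y ∉ F σ ∩ F σ' := by
    refine (Finset.eventually_all _).2 fun σ hσ => (Finset.eventually_all _).2 fun σ' hσ' => ?_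
    obtain ⟨hσE, hσk⟩ := Finset.mem_filter.1 hσ
    by_cases hne' : σ = σ'
    · simp [hne']
    · have := (euclideanHausdorffMeasure_eq_zero_iff (hne σ hσk) (hK.norm_eq σ hσE)
        (F := F σ ∩ F σ') (fun x hx => hK.plane σ hσE x hx.1)).1 (hK.inter σ hσE σ' hσ' hne')
      filter_upwards [measure_eq_zero_iff_ae_notMem.1 this] with y hy _ using hy
  filter_upwards [hae1, hae2] with y hy1 hy2
  by_cases hy : y ∈ dropCoord k '' K
  · rw [indicator_of_mem hy]
    have htop : ins k (e y) y ∈ frontier K := by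
      rw [hK.isOpen.frontier_eq]
      refine ⟨?_, h_not_mem y hy⟩
      have hcont : Continuous fun s : ℝ => ins k s y :=
        (continuous_ins k).comp (by fun_prop : Continuous fun s : ℝ => (s, y))
      exact hcont.closure_preimage_subset K (h_close y hy)
    rw [hK.frontier_eq] at htop
    obtain ⟨σ₀, hσ₀, hmem⟩ := mem_iUnion₂.1 htop
    have hpl := hK.plane σ₀ hσ₀ _ hmem
    obtain ⟨s₀, hs₀⟩ : ∃ s₀, ins k s₀ y ∈ K := by
      obtain ⟨x, hx, rfl⟩ := hy
      exact ⟨x k, by simpa using hx⟩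
    have key : ∀ (σ : ε) (s t : ℝ), ⟪ν σ, ins k s y - p σ⟫ - ⟪ν σ, ins k t y - p σ⟫ =
        ν σ k * (s - t) := by
      intro σ s t
      rw [← inner_sub_right, sub_sub_sub_cancel_right, ins_sub_ins]
      simp [EuclideanSpace.inner_single_right, mul_comm]
    have hpos : 0 < c * ν σ₀ k := by
      have h1 := hK.side σ₀ hσ₀ _ hs₀
      have h2 := key σ₀ (e y) s₀
      have h3 := h_sign y hy s₀ hs₀
      have h4 : 0 < ν σ₀ k * (e y - s₀) := by linarith
      have h5 : 0 < (c * ν σ₀ k) * (e y - s₀) ^ 2 := by nlinarith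
      exact pos_of_mul_pos_left h5 (sq_nonneg _)
    -- A face with the right sign cannot lie over `y` strictly before the end point: slice points
    -- beyond it would be on the outer side of its hyperplane.
    have hgr : ∀ σ, σ ∈ E → 0 < c * ν σ k → graph k (ν σ) (p σ) y ∈ F σ →
        graph k (ν σ) (p σ) y = ins k (e y) y := by
      intro σ hσ hσk hm
      have h1 : graph k (ν σ) (p σ) y = ins k (graph k (ν σ) (p σ) y k) y := by
        conv_lhs => rw [← ins_dropCoord k (graph k (ν σ) (p σ) y), dropCoord_graph]
      set s := graph k (ν σ) (p σ) y k with hs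
      rw [h1]
      have h2 := h_end y hy s (by rw [← h1]; exact hK.face_subset_closure hσ hm)
      have hc : c ≠ 0 := fun h => by simp [h] at hσk
      rcases h2.eq_or_lt with h2 | h2
      · have : e y - s = 0 := (mul_eq_zero.1 h2.symm).resolve_left hc
        rw [show s = e y by linarith]
      · exfalso
        have hopen2 : IsOpen {t : ℝ | 0 < c * (t - s)} :=
          isOpen_lt continuous_const (by fun_prop)
        obtain ⟨t, ht1, ht2⟩ := mem_closure_iff.1 (h_close y hy) _ hopen2 h2
        have h3 := hK.side σ hσ _ ht2
        have h4 := key σ t s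
        rw [← h1, hK.plane σ hσ _ hm] at h4
        have h5 : ν σ k * (t - s) < 0 := by linarith
        have ht1 : 0 < c * (t - s) := ht1
        nlinarith [mul_pos hσk ht1, sq_nonneg c, mul_pos (sq_pos_of_ne_zero hc) (neg_pos.2 h5)]
    have hg0 : graph k (ν σ₀) (p σ₀) y = ins k (e y) y := by
      have := graph_dropCoord (k := k) (hne σ₀ hpos) hpl
      rwa [dropCoord_ins] at this
    rw [Finset.sum_eq_single_of_mem σ₀ (Finset.mem_filter.2 ⟨hσ₀, hpos⟩), indicator_of_mem, hg0]
    · change graph k (ν σ₀) (p σ₀) y ∈ F σ₀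
      rwa [hg0]
    · intro σ hσ hne'
      rw [indicator_of_notMem]
      intro hm
      have hm : graph k (ν σ) (p σ) y ∈ F σ := hm
      obtain ⟨hσE, hσk⟩ := Finset.mem_filter.1 hσ
      refine hy2 σ hσ σ₀ hσ₀ hne' ⟨hm, ?_⟩
      rwa [hgr σ hσE hσk hm]
  · rw [indicator_of_notMem hy]
    refine Finset.sum_eq_zero fun σ hσ => ?_
    rw [indicator_of_notMem]
    intro hm
    have hm : graph k (ν σ) (p σ) y ∈ F σ := hm
    apply hy1
    rw [hopen.frontier_eq]
    refine ⟨?_, hy⟩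
    have h1 := hK.face_subset_closure (Finset.mem_filter.1 hσ).1 hm
    have h2 := image_closure_subset_closure_image (dropCoord k).continuous (mem_image_of_mem _ h1)
    rwa [dropCoord_graph] at h2

theorem slice_eq_Ioo (hK : IsPolytope K E F ν p) (k : Fin (n + 1)) {y : Sp n}
    (hy : y ∈ dropCoord k '' K) : ∃ a b, a < b ∧ {s | ins k s y ∈ K} = Ioo a b := by
  have hcont : Continuous fun s : ℝ => ins k s y :=
    (continuous_ins k).comp (by fun_prop : Continuous fun s : ℝ => (s, y))
  have hne : {s | ins k s y ∈ K}.Nonempty := by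
    obtain ⟨x, hx, rfl⟩ := hy
    exact ⟨x k, by simpa using hx⟩
  have hop : IsOpen {s | ins k s y ∈ K} := hK.isOpen.preimage hcont
  have hcv : Convex ℝ {s | ins k s y ∈ K} := by
    intro s hs t ht a b ha hb hab
    have := hK.convex hs ht ha hb hab
    have h2 : ins k (a • s + b • t) y = a • ins k s y + b • ins k t y :=
      ext_succAbove k (by simp) (by
        intro j
        simp only [ins_succAbove, PiLp.add_apply, PiLp.smul_apply, smul_eq_mul]
        rw [← add_mul, hab, one_mul])
    change ins k (a • s + b • t) y ∈ K
    rwa [h2]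
  have hbd : Bornology.IsBounded {s | ins k s y ∈ K} := by
    have h1 := (EuclideanSpace.proj (𝕜 := ℝ) k).lipschitz.isBounded_image hK.bounded
    refine h1.subset fun s hs => ⟨_, hs, by simp⟩
  have hba := hbd.bddAbove
  have hbb := hbd.bddBelow
  refine ⟨sInf {s | ins k s y ∈ K}, sSup {s | ins k s y ∈ K}, ?_, ?_⟩
  · obtain ⟨s, hs⟩ := hne
    obtain ⟨r, hr, hball⟩ := Metric.isOpen_iff.1 hop s hs
    have h1 : s + r / 2 ∈ {s | ins k s y ∈ K} := hball (by simp [abs_of_pos hr]; linarith)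
    have h2 := csInf_le hbb hs
    have h3 := le_csSup hba h1
    linarith
  · refine Subset.antisymm ?_ (IsConnected.Ioo_csInf_csSup_subset ⟨hne, hcv.isPreconnected⟩ hbb hba)
    intro s hs
    obtain ⟨r, hr, hball⟩ := Metric.isOpen_iff.1 hop s hs
    have h1 : s + r / 2 ∈ {s | ins k s y ∈ K} := hball (by simp [abs_of_pos hr]; linarith)
    have h2 : s - r / 2 ∈ {s | ins k s y ∈ K} := hball (by simp [abs_of_pos hr]; linarith)
    have h3 := csInf_le hbb h2
    have h4 := le_csSup hba h1
    constructor <;> linarith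

/-- The sections of a polytope along a coordinate direction, with the flux through both ends. -/
theorem exists_endpoints (hK : IsPolytope K E F ν p) (k : Fin (n + 1)) :
    ∃ a b : Sp n → ℝ, (∀ y ∈ dropCoord k '' K, a y < b y ∧ {s | ins k s y ∈ K} = Ioo (a y) (b y)) ∧
      ∀ g : Sp (n + 1) → ℝ, ContinuousOn g (closure K) →
        (IntegrableOn (fun y => g (ins k (b y) y)) (dropCoord k '' K) ∧
          ∑ σ ∈ E with 0 < ν σ k, |ν σ k| * ∫ x in F σ, g x ∂μHE[n] =
          ∫ y in dropCoord k '' K, g (ins k (b y) y)) ∧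
        (IntegrableOn (fun y => g (ins k (a y) y)) (dropCoord k '' K) ∧
          ∑ σ ∈ E with ν σ k < 0, |ν σ k| * ∫ x in F σ, g x ∂μHE[n] =
          ∫ y in dropCoord k '' K, g (ins k (a y) y)) := by
  classical
  have h := fun y : Sp n => fun hy : y ∈ dropCoord k '' K => hK.slice_eq_Ioo k hy
  choose! a b hlt heq using h
  have hcl : ∀ y ∈ dropCoord k '' K, ∀ s, ins k s y ∈ closure K → s ∈ Icc (a y) (b y) := by
    intro y hy s hs
    obtain ⟨s₀, hs₀⟩ : (Ioo (a y) (b y)).Nonempty := nonempty_Ioo.2 (hlt y hy)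
    have hs₀K : ins k s₀ y ∈ interior K := by
      rw [hK.isOpen.interior_eq]; rw [← heq y hy] at hs₀; exact hs₀
    rw [← closure_Ioo (hlt y hy).ne, ← heq y hy]
    -- By convexity the open segment from a point of the open slice to a point of the closed one
    -- runs inside `K`, so the slice of `closure K` is contained in the closure of the slice of `K`.
    refine closure_mono (s := openSegment ℝ s₀ s) ?_ ?_
    · rintro _ ⟨α, β, hα, hβ, hαβ, rfl⟩
      have h1 := hK.convex.combo_interior_closure_mem_interior hs₀K hs hα hβ.le hαβ
      have h2 : ins k (α • s₀ + β • s) y = α • ins k s₀ y + β • ins k s y :=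
        ext_succAbove k (by simp) (by
          intro j
          simp only [ins_succAbove, PiLp.add_apply, PiLp.smul_apply, smul_eq_mul]
          rw [← add_mul, hαβ, one_mul])
      change ins k (α • s₀ + β • s) y ∈ K
      rw [h2]
      exact interior_subset h1
    · exact segment_subset_closure_openSegment (right_mem_segment ℝ s₀ s)
  have hmem : ∀ y ∈ dropCoord k '' K, ∀ s, ins k s y ∈ K ↔ s ∈ Ioo (a y) (b y) := by
    intro y hy s
    rw [← heq y hy]; rfl
  refine ⟨a, b, fun y hy => ⟨hlt y hy, heq y hy⟩, fun g hg => ⟨?_, ?_⟩⟩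
  · have := hK.sum_face_eq_setIntegral_endpoint k 1 b
      (fun y hy => by rw [heq y hy, closure_Ioo (hlt y hy).ne]; exact ⟨(hlt y hy).le, le_rfl⟩)
      (fun y hy => by rw [hmem y hy]; simp)
      (fun y hy s hs => by have := (hcl y hy s hs).2; linarith)
      (fun y hy s hs => by have := ((hmem y hy s).1 hs).2; linarith) hg
    simpa using this
  · have := hK.sum_face_eq_setIntegral_endpoint k (-1) a
      (fun y hy => by rw [heq y hy, closure_Ioo (hlt y hy).ne]; exact ⟨le_rfl, (hlt y hy).le⟩)
      (fun y hy => by rw [hmem y hy]; simp)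
      (fun y hy s hs => by have := (hcl y hy s hs).1; linarith)
      (fun y hy s hs => by have := ((hmem y hy s).1 hs).1; linarith) hg
    simpa using this

/-- Integration of a partial derivative over a polytope. -/
theorem setIntegral_partial (hK : IsPolytope K E F ν p) (k : Fin (n + 1))
    {g g' : Sp (n + 1) → ℝ} (hg : ContinuousOn g (closure K)) (hg' : ContinuousOn g' (closure K))
    (hd : ∀ x ∈ K, HasLineDerivAt ℝ g (g' x) x (EuclideanSpace.single k 1)) :
    ∫ x in K, g' x = ∑ σ ∈ E, ν σ k * ∫ x in F σ, g x ∂μHE[n] := by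
  classical
  obtain ⟨a, b, hab, hflux⟩ := hK.exists_endpoints k
  obtain ⟨⟨hbi, hb⟩, hai, ha⟩ := hflux g hg
  have hopen : IsOpen (dropCoord k '' K) :=
    (dropCoord k).isOpenMap (fun y => ⟨ins k 0 y, by simp⟩) K hK.isOpen
  have hgi : IntegrableOn g' K :=
    (hg'.integrableOn_compact hK.isCompact_closure).mono_set subset_closure
  have h1 : ∑ σ ∈ E, ν σ k * ∫ x in F σ, g x ∂μHE[n] =
      ∑ σ ∈ E with 0 < ν σ k, |ν σ k| * ∫ x in F σ, g x ∂μHE[n] -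
      ∑ σ ∈ E with ν σ k < 0, |ν σ k| * ∫ x in F σ, g x ∂μHE[n] := by
    rw [Finset.sum_filter, Finset.sum_filter, ← Finset.sum_sub_distrib]
    refine Finset.sum_congr rfl fun σ _ => ?_
    rcases lt_trichotomy (ν σ k) 0 with h | h | h
    · simp [h, h.le.not_gt, abs_of_neg]
    · simp [h]
    · simp [h, h.le.not_gt, abs_of_pos]
  have hcov : ∀ y ∈ dropCoord k '' K, ∀ s ∈ Icc (a y) (b y), ins k s y ∈ closure K := by
    intro y hy s hs
    obtain ⟨hlt, heq⟩ := hab y hy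
    have hcont : Continuous fun s : ℝ => ins k s y :=
      (continuous_ins k).comp (by fun_prop : Continuous fun s : ℝ => (s, y))
    refine hcont.closure_preimage_subset K ?_
    change s ∈ closure {s | ins k s y ∈ K}
    rwa [heq, closure_Ioo hlt.ne]
  have hslice : ∀ y ∈ dropCoord k '' K,
      ∫ s, K.indicator g' (ins k s y) = g (ins k (b y) y) - g (ins k (a y) y) := by
    intro y hy
    obtain ⟨hlt, heq⟩ := hab y hy
    have hcont : Continuous fun s : ℝ => ins k s y :=
      (continuous_ins k).comp (by fun_prop : Continuous fun s : ℝ => (s, y))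
    have h2 : (fun s => K.indicator g' (ins k s y)) =
        (Ioo (a y) (b y)).indicator fun s => g' (ins k s y) := by
      rw [← heq]; rfl
    rw [h2, integral_indicator measurableSet_Ioo, ← integral_Ioc_eq_integral_Ioo,
      ← intervalIntegral.integral_of_le hlt.le]
    refine intervalIntegral.integral_eq_sub_of_hasDerivAt_of_le hlt.le
      (hg.comp hcont.continuousOn (hcov y hy)) ?_ ?_
    · intro s hs
      have hsK : ins k s y ∈ K := by rw [← heq] at hs; exact hs
      have h3 := hd _ hsK
      have h4 : HasDerivAt (fun t : ℝ => g (ins k s y + t • EuclideanSpace.single k 1))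
        (g' (ins k s y)) (s - s) := by rw [sub_self]; exact h3
      have h5 := HasDerivAt.comp (h := fun t => id t - s) s h4 ((hasDerivAt_id s).sub_const s)
      have h6 : (fun t : ℝ => g (ins k t y)) =
          (fun t : ℝ => g (ins k s y + t • EuclideanSpace.single k 1)) ∘ fun t => id t - s := by
        funext t
        simp only [Function.comp, id]
        congr 1
        exact ext_succAbove k (by simp) (by simp)
      change HasDerivAt (fun t : ℝ => g (ins k t y)) _ s
      rw [h6]
      simpa using h5
    · refine ContinuousOn.intervalIntegrable ?_
      rw [uIcc_of_le hlt.le]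
      exact hg'.comp hcont.continuousOn (hcov y hy)
  have hzero : ∀ y ∉ dropCoord k '' K, ∫ s, K.indicator g' (ins k s y) = 0 := by
    intro y hy
    have : (fun s => K.indicator g' (ins k s y)) = fun _ => 0 := by
      funext s
      exact indicator_of_notMem (fun h => hy ⟨_, h, by simp⟩) _
    rw [this, integral_zero]
  rw [← integral_indicator hK.isOpen.measurableSet, integral_eq_integral_ins k
    (hgi.integrable_indicator hK.isOpen.measurableSet), h1, hb, ha]
  rw [← integral_sub hbi hai, ← integral_indicator hopen.measurableSet]
  refine integral_congr_ae (Filter.Eventually.of_forall fun y => ?_)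
  by_cases hy : y ∈ dropCoord k '' K
  · simp only [indicator_of_mem hy, hslice y hy]
  · simp only [indicator_of_notMem hy, hzero y hy]

/-- The divergence theorem. -/
theorem setIntegral_divergence (hK : IsPolytope K E F ν p) {f : Sp (n + 1) → Sp (n + 1)}
    {f' : Sp (n + 1) → Sp (n + 1) →L[ℝ] Sp (n + 1)} (hf : ContinuousOn f (closure K))
    (hf' : ContinuousOn f' (closure K)) (hd : ∀ x ∈ K, HasFDerivAt f (f' x) x) :
    ∫ x in K, ∑ k, f' x (EuclideanSpace.single k 1) k =
      ∑ σ ∈ E, ∫ x in F σ, ⟪f x, ν σ⟫ ∂μHE[n] := by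
  have hfk : ∀ k, ContinuousOn (fun x => f x k) (closure K) := fun k =>
    (EuclideanSpace.proj (𝕜 := ℝ) k).continuous.comp_continuousOn hf
  have hfk' : ∀ k, ContinuousOn (fun x => f' x (EuclideanSpace.single k 1) k) (closure K) :=
    fun k => (EuclideanSpace.proj (𝕜 := ℝ) k).continuous.comp_continuousOn
      (hf'.clm_apply continuousOn_const)
  rw [integral_finsetSum]
  swap
  · intro k _
    exact ((hfk' k).integrableOn_compact hK.isCompact_closure).mono_set subset_closure
  have h1 : ∀ σ ∈ E, ∫ x in F σ, ⟪f x, ν σ⟫ ∂μHE[n] =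
      ∑ k, ν σ k * ∫ x in F σ, f x k ∂μHE[n] := by
    intro σ hσ
    simp_rw [← integral_const_mul]
    rw [← integral_finsetSum]
    · refine integral_congr_ae (Filter.Eventually.of_forall fun x => ?_)
      simp [PiLp.inner_apply]
    · intro k _
      exact (hK.integrableOn_face hσ (hfk k)).const_mul _
  rw [Finset.sum_congr rfl h1, Finset.sum_comm]
  refine Finset.sum_congr rfl fun k _ => ?_
  refine hK.setIntegral_partial k (hfk k) (hfk' k) fun x hx => ?_
  have h2 := ((EuclideanSpace.proj (𝕜 := ℝ) k).hasFDerivAt.comp x (hd x hx)).hasLineDerivAt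
    (EuclideanSpace.single k 1)
  simp only [ContinuousLinearMap.comp_apply, PiLp.proj_apply] at h2
  exact h2

/-- The perimeter of a polytope is controlled by its diameter. -/
theorem sum_measure_face_le (hK : IsPolytope K E F ν p) :
    ∑ σ ∈ E, (μHE[n] : Measure (Sp (n + 1))).real (F σ) ≤
      2 * (n + 1) * (volume : Measure (Sp n)).real (Metric.closedBall 0 1) * Metric.diam K ^ n := by
  classical
  -- The faces with positive `k`-th normal component cover the projection of `K` once, those with
  -- negative component once more; the projection lies in a ball of radius `diam K`.
  have hk : ∀ k : Fin (n + 1), ∑ σ ∈ E, |ν σ k| * (μHE[n] : Measure (Sp (n + 1))).real (F σ) ≤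
      2 * (volume : Measure (Sp n)).real (Metric.closedBall 0 1) * Metric.diam K ^ n := by
    intro k
    obtain ⟨a, b, -, hflux⟩ := hK.exists_endpoints k
    obtain ⟨⟨-, hb⟩, -, ha⟩ := hflux (fun _ => 1) continuousOn_const
    simp only [integral_const, smul_eq_mul, mul_one, measureReal_restrict_apply_univ] at ha hb
    have hvol : (volume : Measure (Sp n)).real (dropCoord k '' K) ≤
        (volume : Measure (Sp n)).real (Metric.closedBall 0 1) * Metric.diam K ^ n := by
      obtain ⟨x₀, hx₀⟩ := hK.nonempty
      have hsub : dropCoord k '' K ⊆ Metric.closedBall (dropCoord k x₀) (Metric.diam K) := by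
        rintro _ ⟨x, hx, rfl⟩
        rw [Metric.mem_closedBall]
        refine le_trans ?_ (Metric.dist_le_diam_of_mem hK.bounded hx hx₀)
        rw [EuclideanSpace.dist_eq, EuclideanSpace.dist_eq]
        refine Real.sqrt_le_sqrt ?_
        rw [Fin.sum_univ_succAbove _ k]
        simp only [dropCoord_apply]
        linarith [sq_nonneg (dist (x k) (x₀ k))]
      refine (measureReal_mono hsub
        (Metric.isBounded_closedBall.measure_lt_top.ne)).trans ?_
      rw [measureReal_def, Measure.addHaar_closedBall' volume _ Metric.diam_nonneg,
        finrank_euclideanSpace_fin, ENNReal.toReal_mul,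
        ENNReal.toReal_ofReal (pow_nonneg Metric.diam_nonneg _), mul_comm]
      rfl
    have hsplit : ∑ σ ∈ E, |ν σ k| * (μHE[n] : Measure (Sp (n + 1))).real (F σ) =
        ∑ σ ∈ E with 0 < ν σ k, |ν σ k| * (μHE[n] : Measure (Sp (n + 1))).real (F σ) +
        ∑ σ ∈ E with ν σ k < 0, |ν σ k| * (μHE[n] : Measure (Sp (n + 1))).real (F σ) := by
      rw [Finset.sum_filter, Finset.sum_filter, ← Finset.sum_add_distrib]
      refine Finset.sum_congr rfl fun σ _ => ?_
      rcases lt_trichotomy (ν σ k) 0 with h | h | h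
      · simp [h, h.le.not_gt]
      · simp [h]
      · simp [h, h.le.not_gt]
    rw [hsplit, ha, hb]
    linarith
  have hone : ∀ σ ∈ E, 1 ≤ ∑ k, |ν σ k| := by
    intro σ hσ
    have h1 := hK.norm_eq σ hσ
    have h2 : ‖ν σ‖ ^ 2 = ∑ k, |ν σ k| ^ 2 := by
      simp [EuclideanSpace.norm_sq_eq]
    have h3 : ∀ k, |ν σ k| ≤ 1 := fun k => by
      simpa [h1] using PiLp.norm_apply_le (ν σ) k
    calc (1 : ℝ) = ∑ k, |ν σ k| ^ 2 := by rw [← h2, h1]; norm_num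
      _ ≤ ∑ k, |ν σ k| := Finset.sum_le_sum fun k _ => by
        nlinarith [abs_nonneg (ν σ k), h3 k]
  calc ∑ σ ∈ E, (μHE[n] : Measure (Sp (n + 1))).real (F σ)
      ≤ ∑ σ ∈ E, (∑ k, |ν σ k|) * (μHE[n] : Measure (Sp (n + 1))).real (F σ) :=
        Finset.sum_le_sum fun σ hσ => le_mul_of_one_le_left measureReal_nonneg (hone σ hσ)
    _ = ∑ k, ∑ σ ∈ E, |ν σ k| * (μHE[n] : Measure (Sp (n + 1))).real (F σ) := by
        rw [Finset.sum_comm]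
        exact Finset.sum_congr rfl fun σ _ => Finset.sum_mul _ _ _
    _ ≤ ∑ k : Fin (n + 1),
        2 * (volume : Measure (Sp n)).real (Metric.closedBall 0 1) * Metric.diam K ^ n :=
        Finset.sum_le_sum fun k _ => hk k
    _ = _ := by simp; ring

end IsPolytope

/-! ### Convex sets touching a hyperplane -/

section Touching

variable {n : ℕ}

/-- Disjoint convex sets on the same side of a hyperplane touch it in almost disjoint sets. -/
theorem measure_touching_same_side {K K' : Set (Sp (n + 1))} (hKo : IsOpen K) (hKo' : IsOpen K')
    (hKc : Convex ℝ K) (hKc' : Convex ℝ K') (hKn : K.Nonempty) (hKn' : K'.Nonempty)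
    (hdisj : Disjoint K K') {ν p : Sp (n + 1)} (hν : ‖ν‖ = 1)
    (hs : ∀ x ∈ K, ⟪ν, x - p⟫ < 0) (hs' : ∀ x ∈ K', ⟪ν, x - p⟫ < 0) :
    (μHE[n] : Measure (Sp (n + 1)))
      {x | ⟪ν, x - p⟫ = 0 ∧ x ∈ closure K ∧ x ∈ closure K'} = 0 := by
  obtain ⟨k, hk⟩ := exists_coord_ne_zero hν
  rw [euclideanHausdorffMeasure_eq_zero_iff hk hν fun x hx => hx.1]
  set C := graph k ν p ⁻¹' {x | ⟪ν, x - p⟫ = 0 ∧ x ∈ closure K ∧ x ∈ closure K'} with hC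
  have hCc : Convex ℝ C := by
    intro y hy y' hy' a b ha hb hab
    refine ⟨inner_graph_sub hk p _, ?_, ?_⟩
    · rw [graph_combo p y y' hab]
      exact hKc.closure hy.2.1 hy'.2.1 ha hb hab
    · rw [graph_combo p y y' hab]
      exact hKc'.closure hy.2.2 hy'.2.2 ha hb hab
  by_contra hpos
  -- A convex set without interior is contained in its frontier, which is null.
  have hint : (interior C).Nonempty := by
    by_contra hemp
    rw [not_nonempty_iff_eq_empty] at hemp
    refine hpos (measure_mono_null ?_ (hCc.addHaar_frontier volume))
    rw [frontier, hemp, sdiff_empty]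
    exact subset_closure
  obtain ⟨y₀, hy₀⟩ := hint
  set z := graph k ν p y₀ with hz
  have key : ∀ L : Set (Sp (n + 1)), IsOpen L → Convex ℝ L → L.Nonempty →
      (∀ x ∈ L, ⟪ν, x - p⟫ < 0) → (∀ y ∈ C, graph k ν p y ∈ closure L) →
      ∀ᶠ t in nhdsWithin (0 : ℝ) (Ioi 0), z - t • ν ∈ L := by
    intro L hLo hLc hLn hLs hLcl
    obtain ⟨x, hx⟩ := hLn
    set c := -⟪ν, x - p⟫ with hc
    have hcpos : 0 < c := by have := hLs x hx; linarith
    -- `P t` is chosen such that `z - t ν = (t/c) x + (1 - t/c) P t`, where `c` is the distance of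
    -- `x` from the hyperplane; hence `P t` lies in the hyperplane and tends to `z`. For small `t`
    -- it belongs to `closure L`, and the convex combination with `x ∈ L` is in `L`. Applied to `K`
    -- and `K'`, this yields a common point.
    set P : ℝ → Sp (n + 1) := fun t => (1 - t / c)⁻¹ • (z - t • ν - (t / c) • x) with hP
    have hP0 : P 0 = z := by simp [hP]
    have hPc : ContinuousAt P 0 := by
      have h1 : ContinuousAt (fun t : ℝ => (1 - t / c)⁻¹) 0 :=
        ContinuousAt.inv₀ (by fun_prop) (by simp)
      exact h1.smul (by fun_prop)
    have hev1 : ∀ᶠ t in nhds (0 : ℝ), dropCoord k (P t) ∈ C := by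
      have : ContinuousAt (fun t => dropCoord k (P t)) 0 :=
        (dropCoord k).continuous.continuousAt.comp hPc
      refine this.eventually_mem ?_
      simp only [hP0, hz, dropCoord_graph]
      exact mem_interior_iff_mem_nhds.1 hy₀
    have hev2 : ∀ᶠ t in nhds (0 : ℝ), t < c := eventually_lt_nhds hcpos
    filter_upwards [nhdsWithin_le_nhds hev1, nhdsWithin_le_nhds hev2, self_mem_nhdsWithin]
      with t ht1 ht2 ht3
    have ht3 : 0 < t := ht3
    have h1 : 0 < 1 - t / c := by rw [sub_pos, div_lt_one hcpos]; exact ht2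
    have hin : ⟪ν, P t - p⟫ = 0 := by
      have e1 : (1 - t / c) • (P t - p) = (z - p) - t • ν - (t / c) • (x - p) := by
        rw [smul_sub, hP]
        simp only
        rw [smul_inv_smul₀ h1.ne']
        module
      have e2 : (1 - t / c) * ⟪ν, P t - p⟫ = 0 := by
        rw [← real_inner_smul_right, e1, inner_sub_right, inner_sub_right, real_inner_smul_right,
          real_inner_smul_right, inner_graph_sub hk, real_inner_self_eq_norm_sq, hν]
        have : ⟪ν, x - p⟫ = -c := by rw [hc]; ring
        rw [this]
        field_simp
        ring
      exact (mul_eq_zero.1 e2).resolve_left h1.ne'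
    have hPt : P t ∈ closure L := by
      have := hLcl _ ht1
      rwa [graph_dropCoord hk hin] at this
    have h2 := hLc.combo_interior_closure_mem_interior (by rwa [hLo.interior_eq]) hPt
      (div_pos ht3 hcpos) h1.le (by ring)
    rw [hLo.interior_eq] at h2
    convert h2 using 1
    rw [hP]
    simp only
    rw [smul_inv_smul₀ h1.ne']
    module
  obtain ⟨t, ht, ht'⟩ := ((key K hKo hKc hKn hs fun y hy => hy.2.1).and
    (key K' hKo' hKc' hKn' hs' fun y hy => hy.2.2)).exists
  exact disjoint_left.1 hdisj ht ht'

/-- Hyperplanes that share a set of positive area are parallel. -/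
theorem eq_or_eq_neg_of_measure_ne_zero {ν ν' p p' : Sp (n + 1)} (hν : ‖ν‖ = 1) (hν' : ‖ν'‖ = 1)
    {A : Set (Sp (n + 1))} (hA : ∀ x ∈ A, ⟪ν, x - p⟫ = 0) (hA' : ∀ x ∈ A, ⟪ν', x - p'⟫ = 0)
    (hpos : (μHE[n] : Measure (Sp (n + 1))) A ≠ 0) : ν' = ν ∨ ν' = -ν := by
  obtain ⟨k, hk⟩ := exists_coord_ne_zero hν
  set C := {y : Sp n | ⟪ν', graph k ν p y - p'⟫ = 0} with hC
  have hCc : Convex ℝ C := by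
    intro y hy y' hy' a b ha hb hab
    have hy : ⟪ν', graph k ν p y - p'⟫ = 0 := hy
    have hy' : ⟪ν', graph k ν p y' - p'⟫ = 0 := hy'
    change ⟪ν', graph k ν p (a • y + b • y') - p'⟫ = 0
    rw [graph_combo p y y' hab]
    have : a • graph k ν p y + b • graph k ν p y' - p' =
        a • (graph k ν p y - p') + b • (graph k ν p y' - p') := by
      have hb : b = 1 - a := by linarith
      subst hb
      module
    rw [this, inner_add_right, real_inner_smul_right, real_inner_smul_right, hy, hy']
    ring
  have hCpos : volume C ≠ 0 := by
    intro h0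
    refine hpos ((euclideanHausdorffMeasure_eq_zero_iff hk hν hA).2 (measure_mono_null ?_ h0))
    exact fun y hy => hA' _ hy
  have hint : (interior C).Nonempty := by
    by_contra hemp
    rw [not_nonempty_iff_eq_empty] at hemp
    refine hCpos (measure_mono_null ?_ (hCc.addHaar_frontier volume))
    rw [frontier, hemp, sdiff_empty]
    exact subset_closure
  obtain ⟨y₀, hy₀⟩ := hint
  -- Around the interior point `y₀` of `C` both hyperplanes coincide, so `ν'` is orthogonal to every
  -- direction of the first one.
  have hlin : ∀ y, ⟪ν', graphLin k ν y⟫ = 0 := by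
    intro y
    have hc : ContinuousAt (fun t : ℝ => y₀ + t • y) 0 := by fun_prop
    have hev : ∀ᶠ t in nhds (0 : ℝ), y₀ + t • y ∈ C :=
      hc.eventually_mem (by simpa using mem_interior_iff_mem_nhds.1 hy₀)
    have hev' : ∀ᶠ t in nhdsWithin (0 : ℝ) (Ioi 0), y₀ + t • y ∈ C := nhdsWithin_le_nhds hev
    obtain ⟨t, ht, ht0⟩ := (hev'.and self_mem_nhdsWithin).exists
    have ht0 : 0 < t := ht0
    have h1 : ⟪ν', graph k ν p (y₀ + t • y) - p'⟫ = 0 := ht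
    have hy₀C : y₀ ∈ C := interior_subset hy₀
    have h2 : ⟪ν', graph k ν p y₀ - p'⟫ = 0 := hy₀C
    have h3 : graph k ν p (y₀ + t • y) - p' = (graph k ν p y₀ - p') + t • graphLin k ν y := by
      simp only [graph, map_sub, map_add, map_smul]
      module
    rw [h3, inner_add_right, h2, real_inner_smul_right, zero_add] at h1
    exact (mul_eq_zero.1 h1).resolve_left ht0.ne'
  have h1 : ν' = ⟪ν, ν'⟫ • ν := by
    set w := ν' - ⟪ν, ν'⟫ • ν with hw
    have hw0 : ⟪ν, w⟫ = 0 := by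
      rw [hw, inner_sub_right, real_inner_smul_right, real_inner_self_eq_norm_sq, hν]; ring
    have hw1 : ⟪ν', w⟫ = 0 := by
      rw [← graphLin_dropCoord hk hw0]; exact hlin _
    have hw2 : ⟪w, w⟫ = 0 := by
      nth_rewrite 1 [hw]
      rw [inner_sub_left, real_inner_smul_left, hw0, hw1]; ring
    exact sub_eq_zero.1 (inner_self_eq_zero.1 hw2)
  have h2 : |⟪ν, ν'⟫| = 1 := by
    have := congrArg norm h1
    rw [norm_smul, hν, hν', mul_one] at this
    exact this.symm
  rcases eq_or_eq_neg_of_abs_eq h2 with h | h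
  · left; rw [h1, h, one_smul]
  · right; rw [h1, h]; simp

end Touching

namespace AdmissibleMesh

/-! ### Summation by parts -/

section Discrete

variable {d : ℕ} {Ω : Set (Sp d)} {D : Sp d → Sp d →L[ℝ] Sp d} {ι ε : Type} [Fintype ι]
variable (𝒯 : AdmissibleMesh Ω D ι ε)

/-- The relation `σ = i|j` is symmetric in `i` and `j`. Written as a triple sum over a common set of
edges, the left side only has its two cell sums exchanged. This is the combinatorial core of
summation by parts. -/
theorem sum_nbr_swap (f : ι → ι → ε → ℝ) :
    ∑ i, ∑ σ ∈ 𝒯.edges i, (match 𝒯.nbr i σ with | some j => f i j σ | none => 0) =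
      ∑ i, ∑ σ ∈ 𝒯.edges i, (match 𝒯.nbr i σ with | some j => f j i σ | none => 0) := by
  classical
  have h : ∀ g : ι → ι → ε → ℝ,
      ∑ i, ∑ σ ∈ 𝒯.edges i, (match 𝒯.nbr i σ with | some j => g i j σ | none => 0) =
      ∑ i, ∑ j, ∑ σ ∈ Finset.univ.biUnion 𝒯.edges,
        if σ ∈ 𝒯.edges i ∧ 𝒯.nbr i σ = some j then g i j σ else 0 := by
    intro g
    refine Finset.sum_congr rfl fun i _ => ?_
    rw [Finset.sum_comm]
    have hsub : 𝒯.edges i ⊆ Finset.univ.biUnion 𝒯.edges :=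
      Finset.subset_biUnion_of_mem _ (Finset.mem_univ i)
    rw [← Finset.sum_subset hsub]
    · refine Finset.sum_congr rfl fun σ hσ => ?_
      cases hn : 𝒯.nbr i σ with
      | none => simp
      | some j => simp [hσ]
    · intro σ _ hσ
      simp [hσ]
  rw [h f, h fun i j σ => f j i σ, Finset.sum_comm]
  refine Finset.sum_congr rfl fun i _ => Finset.sum_congr rfl fun j _ =>
    Finset.sum_congr rfl fun σ _ => ?_
  have hiff : (σ ∈ 𝒯.edges j ∧ 𝒯.nbr j σ = some i) ↔ (σ ∈ 𝒯.edges i ∧ 𝒯.nbr i σ = some j) := by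
    constructor
    · rintro ⟨h1, h2⟩
      obtain ⟨-, h3, h4, -⟩ := 𝒯.interior_edge j σ h1 i h2
      exact ⟨h3, h4⟩
    · rintro ⟨h1, h2⟩
      obtain ⟨-, h3, h4, -⟩ := 𝒯.interior_edge i σ h1 j h2
      exact ⟨h3, h4⟩
  simp only [hiff]

/-- Each interior edge is seen from two control volumes, each boundary edge from one. -/
def edgeWeight (i : ι) (σ : ε) : ℝ :=
  match 𝒯.nbr i σ with
  | some _ => 1 / 2
  | none => 1

theorem edgeWeight_mem (i : ι) (σ : ε) : 1 / 2 ≤ 𝒯.edgeWeight i σ ∧ 𝒯.edgeWeight i σ ≤ 1 := by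
  unfold edgeWeight
  cases 𝒯.nbr i σ <;> norm_num

/-- An edge quantity that changes sign with the side from which the edge is seen. -/
def Conservative (r : ι → ε → ℝ) : Prop :=
  ∀ i, ∀ σ ∈ 𝒯.edges i, ∀ j, 𝒯.nbr i σ = some j → r j σ = -r i σ

variable {𝒯}

/-- Discrete integration by parts. An interior edge contributes `r (u_i - u_j)` and is met twice in
the sum on the right, which the weight `1/2` corrects; a boundary edge is met once, with outer value
`0`. -/
theorem Conservative.sum_mul {r : ι → ε → ℝ} (hr : 𝒯.Conservative r) (u : ι → ℝ) :
    ∑ i, ∑ σ ∈ 𝒯.edges i, r i σ * u i =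
      -∑ i, ∑ σ ∈ 𝒯.edges i, 𝒯.edgeWeight i σ * r i σ * (𝒯.across u i σ - u i) := by
  have h1 := 𝒯.sum_nbr_swap fun i j σ => r i σ * u j
  have h2 : ∑ i, ∑ σ ∈ 𝒯.edges i, (match 𝒯.nbr i σ with | some j => r j σ * u i | none => 0) =
      ∑ i, ∑ σ ∈ 𝒯.edges i, (match 𝒯.nbr i σ with | some _ => -(r i σ * u i) | none => 0) := by
    refine Finset.sum_congr rfl fun i _ => Finset.sum_congr rfl fun σ hσ => ?_
    cases hn : 𝒯.nbr i σ with
    | none => rfl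
    | some j => simp only [hr i σ hσ j hn]; ring
  rw [h2] at h1
  rw [eq_neg_iff_add_eq_zero, ← Finset.sum_add_distrib]
  have h3 : ∀ i, ∑ σ ∈ 𝒯.edges i, r i σ * u i +
      ∑ σ ∈ 𝒯.edges i, 𝒯.edgeWeight i σ * r i σ * (𝒯.across u i σ - u i) =
      1 / 2 * ∑ σ ∈ 𝒯.edges i, (match 𝒯.nbr i σ with | some j => r i σ * u j | none => 0) -
      1 / 2 * ∑ σ ∈ 𝒯.edges i, (match 𝒯.nbr i σ with | some _ => -(r i σ * u i) | none => 0) := by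
    intro i
    rw [Finset.mul_sum, Finset.mul_sum, ← Finset.sum_add_distrib, ← Finset.sum_sub_distrib]
    refine Finset.sum_congr rfl fun σ hσ => ?_
    unfold edgeWeight across
    cases 𝒯.nbr i σ with
    | none => simp only; ring
    | some j => simp only; ring
  rw [Finset.sum_congr rfl fun i _ => h3 i, Finset.sum_sub_distrib, ← Finset.mul_sum,
    ← Finset.mul_sum, h1, sub_self]

variable (𝒯)

/-! ### The discrete forms -/

/-- The square of the discrete `H¹` seminorm. -/
def sq1 (u : ι → ℝ) : ℝ := ∑ i, ∑ σ ∈ 𝒯.edges i, 𝒯.tau i σ * (𝒯.across u i σ - u i) ^ 2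

/-- The diffusive part of the discrete form. -/
def diffForm (u v : ι → ℝ) : ℝ :=
  ∑ i, ∑ σ ∈ 𝒯.edges i, 𝒯.edgeWeight i σ * 𝒯.tau i σ *
    ((𝒯.across u i σ - u i) * (𝒯.across v i σ - v i))

/-- The convective part of the discrete form. -/
def convForm (q : Sp d → Sp d) (u v : ι → ℝ) : ℝ :=
  ∑ i, ∑ σ ∈ 𝒯.edges i, 𝒯.flux q i σ * 𝒯.upwind q u i σ * v i

theorem tau_symm {i j : ι} {σ : ε} (hσ : σ ∈ 𝒯.edges i) (hn : 𝒯.nbr i σ = some j) :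
    𝒯.tau j σ = 𝒯.tau i σ := by
  obtain ⟨-, -, hn', -⟩ := 𝒯.interior_edge i σ hσ j hn
  have h1 : 𝒯.mu j σ = 𝒯.mu i σ := by
    simp only [mu, hn, hn']
    rw [dist_comm, mul_comm (𝒯.diffEdge j σ) (𝒯.diffEdge i σ), add_comm]
  have h2 : 𝒯.distSigma j σ = 𝒯.distSigma i σ := by
    simp only [distSigma, hn, hn']
    rw [dist_comm]
  unfold tau
  rw [h1, h2]

theorem across_some {u : ι → ℝ} {i j : ι} {σ : ε} (hn : 𝒯.nbr i σ = some j) :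
    𝒯.across u i σ = u j := by
  simp [across, hn]

theorem across_none {u : ι → ℝ} {i : ι} {σ : ε} (hn : 𝒯.nbr i σ = none) :
    𝒯.across u i σ = 0 := by
  simp [across, hn]

theorem conservative_tau (u : ι → ℝ) :
    𝒯.Conservative fun i σ => -(𝒯.tau i σ * (𝒯.across u i σ - u i)) := by
  intro i σ hσ j hn
  obtain ⟨-, -, hn', -⟩ := 𝒯.interior_edge i σ hσ j hn
  simp only [𝒯.tau_symm hσ hn, 𝒯.across_some hn, 𝒯.across_some hn']
  ring

/-- The upwind value belongs to the edge, not to the side: when the flux changes sign the roles of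
`u_i` and `u_j` are exchanged as well. The choice is ambiguous only if the flux vanishes, and then
the product is zero. -/
theorem conservative_flux_upwind {q : Sp d → Sp d} (hq : 𝒯.Conservative (𝒯.flux q)) (u : ι → ℝ) :
    𝒯.Conservative fun i σ => 𝒯.flux q i σ * 𝒯.upwind q u i σ := by
  intro i σ hσ j hn
  obtain ⟨-, -, hn', -⟩ := 𝒯.interior_edge i σ hσ j hn
  simp only [upwind, hq i σ hσ j hn, 𝒯.across_some hn, 𝒯.across_some hn']
  rcases lt_trichotomy (𝒯.flux q i σ) 0 with h | h | h
  · simp [h.not_ge, h.le]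
  · simp [h]
  · simp [h.not_ge, h.le]

theorem form_eq (q : Sp d → Sp d) (c₀ : ℝ) (u v : ι → ℝ) :
    𝒯.form q c₀ u v = 𝒯.diffForm u v + 𝒯.convForm q u v + c₀ * 𝒯.inner0 u v := by
  have h1 : 𝒯.diffForm u v =
      ∑ i, ∑ σ ∈ 𝒯.edges i, -(𝒯.tau i σ * (𝒯.across u i σ - u i)) * v i := by
    rw [(𝒯.conservative_tau u).sum_mul v, ← Finset.sum_neg_distrib, diffForm]
    refine Finset.sum_congr rfl fun i _ => ?_
    rw [← Finset.sum_neg_distrib]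
    exact Finset.sum_congr rfl fun σ _ => by ring
  rw [h1, convForm, inner0, form, Finset.mul_sum, ← Finset.sum_add_distrib,
    ← Finset.sum_add_distrib]
  refine Finset.sum_congr rfl fun i _ => ?_
  rw [Finset.sum_mul, ← Finset.sum_add_distrib]
  congr 1
  · exact Finset.sum_congr rfl fun σ _ => by ring
  · ring

variable {𝒯}

theorem sq1_nonneg (hτ : ∀ i, ∀ σ ∈ 𝒯.edges i, 0 ≤ 𝒯.tau i σ) (u : ι → ℝ) : 0 ≤ 𝒯.sq1 u :=
  Finset.sum_nonneg fun i _ => Finset.sum_nonneg fun σ hσ =>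
    mul_nonneg (hτ i σ hσ) (sq_nonneg _)

theorem half_sq1_le (hτ : ∀ i, ∀ σ ∈ 𝒯.edges i, 0 ≤ 𝒯.tau i σ) (u : ι → ℝ) :
    1 / 2 * 𝒯.sq1 u ≤ 𝒯.diffForm u u := by
  unfold sq1 diffForm
  rw [Finset.mul_sum]
  refine Finset.sum_le_sum fun i _ => ?_
  rw [Finset.mul_sum]
  refine Finset.sum_le_sum fun σ hσ => ?_
  have h1 := mul_nonneg (hτ i σ hσ) (sq_nonneg (𝒯.across u i σ - u i))
  nlinarith [(𝒯.edgeWeight_mem i σ).1]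

theorem diffForm_le_sq1 (hτ : ∀ i, ∀ σ ∈ 𝒯.edges i, 0 ≤ 𝒯.tau i σ) (u : ι → ℝ) :
    𝒯.diffForm u u ≤ 𝒯.sq1 u := by
  unfold sq1 diffForm
  refine Finset.sum_le_sum fun i _ => Finset.sum_le_sum fun σ hσ => ?_
  have h1 := mul_nonneg (hτ i σ hσ) (sq_nonneg (𝒯.across u i σ - u i))
  nlinarith [(𝒯.edgeWeight_mem i σ).2]

/-- On each edge, upwinding gives `-q u₊ (u_j - u_i) = -q (u_j² - u_i²)/2 + |q| (u_j - u_i)²/2`. The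
first part sums to zero because the discrete divergence of the fluxes vanishes; the second is
numerical diffusion and is nonnegative. -/
theorem convForm_self_nonneg {q : Sp d → Sp d} (hq : 𝒯.Conservative (𝒯.flux q))
    (hdiv : ∀ i, ∑ σ ∈ 𝒯.edges i, 𝒯.flux q i σ = 0) (u : ι → ℝ) : 0 ≤ 𝒯.convForm q u u := by
  have h1 := hq.sum_mul fun i => u i ^ 2
  have h2 : ∑ i, ∑ σ ∈ 𝒯.edges i, 𝒯.flux q i σ * u i ^ 2 = 0 :=
    Finset.sum_eq_zero fun i _ => by rw [← Finset.sum_mul, hdiv i, zero_mul]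
  rw [h2] at h1
  have h3 : ∀ i σ, 𝒯.across (fun i => u i ^ 2) i σ = 𝒯.across u i σ ^ 2 := by
    intro i σ
    unfold across
    cases 𝒯.nbr i σ <;> simp
  have h4 : 𝒯.convForm q u u = 1 / 2 *
      ∑ i, ∑ σ ∈ 𝒯.edges i, 𝒯.edgeWeight i σ * (|𝒯.flux q i σ| * (𝒯.across u i σ - u i) ^ 2) := by
    have h5 : 𝒯.convForm q u u = 𝒯.convForm q u u + 1 / 2 *
        ∑ i, ∑ σ ∈ 𝒯.edges i, 𝒯.edgeWeight i σ * 𝒯.flux q i σ *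
          (𝒯.across (fun i => u i ^ 2) i σ - u i ^ 2) := by linarith
    rw [h5, convForm, (𝒯.conservative_flux_upwind hq u).sum_mul u, Finset.mul_sum, Finset.mul_sum,
      ← Finset.sum_neg_distrib, ← Finset.sum_add_distrib]
    refine Finset.sum_congr rfl fun i _ => ?_
    rw [Finset.mul_sum, Finset.mul_sum, ← Finset.sum_neg_distrib, ← Finset.sum_add_distrib]
    refine Finset.sum_congr rfl fun σ _ => ?_
    rw [h3, upwind]
    split_ifs with h
    · rw [abs_of_nonneg h]; ring
    · rw [abs_of_neg (not_le.1 h)]; ring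
  rw [h4]
  refine mul_nonneg (by norm_num) (Finset.sum_nonneg fun i _ => Finset.sum_nonneg fun σ _ => ?_)
  exact mul_nonneg (by linarith [(𝒯.edgeWeight_mem i σ).1])
    (mul_nonneg (abs_nonneg _) (sq_nonneg _))

/-- A conservative edge quantity defines a functional bounded in the discrete `H¹` seminorm. -/
theorem Conservative.abs_sum_mul_le {r : ι → ε → ℝ} (hr : 𝒯.Conservative r)
    (hτ : ∀ i, ∀ σ ∈ 𝒯.edges i, 0 < 𝒯.tau i σ) {B : ℝ}
    (hB : ∑ i, ∑ σ ∈ 𝒯.edges i, r i σ ^ 2 / 𝒯.tau i σ ≤ B) (w : ι → ℝ) :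
    |∑ i, ∑ σ ∈ 𝒯.edges i, r i σ * w i| ≤ √B * √(𝒯.sq1 w) := by
  rw [hr.sum_mul w, abs_neg]
  -- The factors `r/√τ` and `√τ |w_j - w_i|` are prepared for the Cauchy-Schwarz inequality over all
  -- pairs of a cell and one of its edges.
  have h1 : |∑ i, ∑ σ ∈ 𝒯.edges i, 𝒯.edgeWeight i σ * r i σ * (𝒯.across w i σ - w i)| ≤
      ∑ x ∈ Finset.univ.sigma 𝒯.edges, (|r x.1 x.2| / √(𝒯.tau x.1 x.2)) *
        (√(𝒯.tau x.1 x.2) * |𝒯.across w x.1 x.2 - w x.1|) := by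
    rw [Finset.sum_sigma]
    refine (Finset.abs_sum_le_sum_abs _ _).trans (Finset.sum_le_sum fun i _ => ?_)
    refine (Finset.abs_sum_le_sum_abs _ _).trans (Finset.sum_le_sum fun σ hσ => ?_)
    have h2 := Real.sqrt_pos.2 (hτ i σ hσ)
    rw [abs_mul, abs_mul, abs_of_nonneg (by linarith [(𝒯.edgeWeight_mem i σ).1])]
    have h3 : |r i σ| / √(𝒯.tau i σ) * (√(𝒯.tau i σ) * |𝒯.across w i σ - w i|) =
        |r i σ| * |𝒯.across w i σ - w i| := by field_simp
    simp only [h3]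
    rw [mul_assoc]
    exact mul_le_of_le_one_left (by positivity) (𝒯.edgeWeight_mem i σ).2
  refine h1.trans ((Real.sum_mul_le_sqrt_mul_sqrt _ _ _).trans ?_)
  refine mul_le_mul (Real.sqrt_le_sqrt ?_) (Real.sqrt_le_sqrt ?_) (Real.sqrt_nonneg _)
    (Real.sqrt_nonneg _)
  · rw [Finset.sum_sigma]
    refine le_trans (le_of_eq ?_) hB
    refine Finset.sum_congr rfl fun i _ => Finset.sum_congr rfl fun σ hσ => ?_
    rw [div_pow, sq_abs, Real.sq_sqrt (hτ i σ hσ).le]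
  · rw [Finset.sum_sigma]
    refine le_of_eq ?_
    refine Finset.sum_congr rfl fun i _ => Finset.sum_congr rfl fun σ hσ => ?_
    rw [mul_pow, sq_abs, Real.sq_sqrt (hτ i σ hσ).le]

/-- Summation by parts moves all differences to `w`, so that `z` is needed only in `L²`. The
smoothing estimate relies on this, because there `z = A' w` has no controlled discrete gradient. The
bound `m` depends on the edge alone, so values across an edge can be charged to the neighbouring
cell. -/
theorem convForm_le {q : Sp d → Sp d} (hq : 𝒯.Conservative (𝒯.flux q))
    (hτ : ∀ i, ∀ σ ∈ 𝒯.edges i, 0 < 𝒯.tau i σ) {C : ℝ} {m : ε → ℝ}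
    (hm : ∀ i, ∀ σ ∈ 𝒯.edges i, 𝒯.flux q i σ ^ 2 / 𝒯.tau i σ ≤ m σ)
    (hC : ∀ i, ∑ σ ∈ 𝒯.edges i, m σ ≤ C * 𝒯.mesCell i) (z w : ι → ℝ) :
    |𝒯.convForm q z w| ≤ √(2 * C * 𝒯.inner0 z z) * √(𝒯.sq1 w) := by
  refine (𝒯.conservative_flux_upwind hq z).abs_sum_mul_le hτ ?_ w
  have hm0 : ∀ i, ∀ σ ∈ 𝒯.edges i, 0 ≤ m σ := fun i σ hσ =>
    (div_nonneg (sq_nonneg _) (hτ i σ hσ).le).trans (hm i σ hσ)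
  have hsum : ∑ i, ∑ σ ∈ 𝒯.edges i, m σ * z i ^ 2 ≤ C * 𝒯.inner0 z z := by
    rw [inner0, Finset.mul_sum]
    refine Finset.sum_le_sum fun i _ => ?_
    rw [← Finset.sum_mul]
    nlinarith [hC i, sq_nonneg (z i)]
  have hswap : ∑ i, ∑ σ ∈ 𝒯.edges i, m σ * 𝒯.across z i σ ^ 2 ≤
      ∑ i, ∑ σ ∈ 𝒯.edges i, m σ * z i ^ 2 := by
    have h1 := 𝒯.sum_nbr_swap fun i j σ => m σ * z j ^ 2
    have h2 : ∀ i, ∀ σ, m σ * 𝒯.across z i σ ^ 2 =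
        (match 𝒯.nbr i σ with | some j => m σ * z j ^ 2 | none => 0) := by
      intro i σ
      unfold across
      cases 𝒯.nbr i σ <;> simp
    simp only [h2, h1]
    refine Finset.sum_le_sum fun i _ => Finset.sum_le_sum fun σ hσ => ?_
    cases 𝒯.nbr i σ with
    | none => exact mul_nonneg (hm0 i σ hσ) (sq_nonneg _)
    | some j => exact le_rfl
  calc ∑ i, ∑ σ ∈ 𝒯.edges i, (𝒯.flux q i σ * 𝒯.upwind q z i σ) ^ 2 / 𝒯.tau i σ
      ≤ ∑ i, ∑ σ ∈ 𝒯.edges i, (m σ * z i ^ 2 + m σ * 𝒯.across z i σ ^ 2) := by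
        refine Finset.sum_le_sum fun i _ => Finset.sum_le_sum fun σ hσ => ?_
        have h1 : 𝒯.upwind q z i σ ^ 2 ≤ z i ^ 2 + 𝒯.across z i σ ^ 2 := by
          unfold upwind
          split_ifs
          · nlinarith [sq_nonneg (𝒯.across z i σ)]
          · nlinarith [sq_nonneg (z i)]
        calc (𝒯.flux q i σ * 𝒯.upwind q z i σ) ^ 2 / 𝒯.tau i σ
            = 𝒯.flux q i σ ^ 2 / 𝒯.tau i σ * 𝒯.upwind q z i σ ^ 2 := by ring
          _ ≤ m σ * (z i ^ 2 + 𝒯.across z i σ ^ 2) :=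
            mul_le_mul (hm i σ hσ) h1 (sq_nonneg _) (hm0 i σ hσ)
          _ = _ := by ring
    _ ≤ 2 * C * 𝒯.inner0 z z := by
        simp only [Finset.sum_add_distrib]
        linarith

/-! ### The discrete scalar product -/

variable (𝒯)

theorem inner0_comm (u v : ι → ℝ) : 𝒯.inner0 u v = 𝒯.inner0 v u :=
  Finset.sum_congr rfl fun i _ => by ring

theorem inner0_self_nonneg (u : ι → ℝ) : 0 ≤ 𝒯.inner0 u u :=
  Finset.sum_nonneg fun i _ => by
    rw [mul_assoc]; exact mul_nonneg measureReal_nonneg (mul_self_nonneg _)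

theorem norm0_nonneg (u : ι → ℝ) : 0 ≤ 𝒯.norm0 u := Real.sqrt_nonneg _

theorem norm0_sq (u : ι → ℝ) : 𝒯.norm0 u ^ 2 = 𝒯.inner0 u u :=
  Real.sq_sqrt (𝒯.inner0_self_nonneg u)

theorem inner0_add_left (u v w : ι → ℝ) :
    𝒯.inner0 (u + v) w = 𝒯.inner0 u w + 𝒯.inner0 v w := by
  simp only [inner0, ← Finset.sum_add_distrib]
  exact Finset.sum_congr rfl fun i _ => by simp; ring

theorem inner0_sub_left (u v w : ι → ℝ) :
    𝒯.inner0 (u - v) w = 𝒯.inner0 u w - 𝒯.inner0 v w := by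
  simp only [inner0, ← Finset.sum_sub_distrib]
  exact Finset.sum_congr rfl fun i _ => by simp; ring

theorem inner0_neg_left (u w : ι → ℝ) : 𝒯.inner0 (-u) w = -𝒯.inner0 u w := by
  simp only [inner0, ← Finset.sum_neg_distrib]
  exact Finset.sum_congr rfl fun i _ => by simp

theorem inner0_neg_right (u w : ι → ℝ) : 𝒯.inner0 u (-w) = -𝒯.inner0 u w := by
  rw [inner0_comm, inner0_neg_left, inner0_comm]

theorem abs_inner0_le (u v : ι → ℝ) : |𝒯.inner0 u v| ≤ 𝒯.norm0 u * 𝒯.norm0 v := by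
  have hm : ∀ i, 0 ≤ 𝒯.mesCell i := fun i => measureReal_nonneg
  have h1 : |𝒯.inner0 u v| ≤ ∑ i, (√(𝒯.mesCell i) * |u i|) * (√(𝒯.mesCell i) * |v i|) := by
    refine (Finset.abs_sum_le_sum_abs _ _).trans (Finset.sum_le_sum fun i _ => le_of_eq ?_)
    rw [abs_mul, abs_mul, abs_of_nonneg (hm i)]
    rw [mul_mul_mul_comm, Real.mul_self_sqrt (hm i), mul_assoc]
  refine h1.trans ((Real.sum_mul_le_sqrt_mul_sqrt _ _ _).trans (le_of_eq ?_))
  have h2 : ∀ u : ι → ℝ, ∑ i, (√(𝒯.mesCell i) * |u i|) ^ 2 = 𝒯.inner0 u u := fun u =>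
    Finset.sum_congr rfl fun i _ => by
      rw [mul_pow, Real.sq_sqrt (hm i), sq_abs]; ring
  rw [h2, h2, norm0, norm0]

theorem norm0_add_le (u v : ι → ℝ) : 𝒯.norm0 (u + v) ≤ 𝒯.norm0 u + 𝒯.norm0 v := by
  refine abs_le_of_sq_le_sq' ?_ (add_nonneg (𝒯.norm0_nonneg u) (𝒯.norm0_nonneg v)) |>.2
  have h1 := (abs_le.1 (𝒯.abs_inner0_le u v)).2
  have h2 : 𝒯.inner0 (u + v) (u + v) = 𝒯.inner0 u u + 2 * 𝒯.inner0 u v + 𝒯.inner0 v v := by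
    rw [inner0_add_left, 𝒯.inner0_comm u, 𝒯.inner0_comm v (u + v), inner0_add_left,
      inner0_add_left, 𝒯.inner0_comm v u]
    ring
  rw [norm0_sq, h2, ← norm0_sq, ← norm0_sq]
  nlinarith

theorem norm0_le_of_forall {u : ι → ℝ} {C : ℝ} (hC : 0 ≤ C)
    (h : ∀ v, 𝒯.inner0 u v ≤ C * 𝒯.norm0 v) : 𝒯.norm0 u ≤ C := by
  have h1 := h u
  rw [← norm0_sq] at h1
  rcases (𝒯.norm0_nonneg u).eq_or_lt with h0 | h0
  · rw [← h0]; exact hC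
  · nlinarith

theorem exists_adjoint (hΩ : Bornology.IsBounded Ω) (A : (ι → ℝ) →L[ℝ] (ι → ℝ)) :
    ∃ A' : (ι → ℝ) →L[ℝ] (ι → ℝ), ∀ u v, 𝒯.inner0 (A u) v = 𝒯.inner0 u (A' v) := by
  classical
  refine ⟨LinearMap.toContinuousLinearMap
    { toFun := fun v i => (𝒯.mesCell i)⁻¹ * 𝒯.inner0 (A (Pi.single i 1)) v
      map_add' := ?_
      map_smul' := ?_ }, ?_⟩
  · intro v w
    funext i
    rw [inner0_comm, inner0_add_left, 𝒯.inner0_comm v, 𝒯.inner0_comm w]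
    simp; ring
  · intro c v
    funext i
    simp only [inner0, Pi.smul_apply, smul_eq_mul, RingHom.id_apply, Finset.mul_sum]
    exact Finset.sum_congr rfl fun j _ => by ring
  · intro u v
    have h1 : u = ∑ i, u i • (Pi.single i (1 : ℝ) : ι → ℝ) := by
      funext j
      simp [Finset.sum_apply, Pi.single_apply]
    have h2 : 𝒯.inner0 (A u) v = ∑ i, u i * 𝒯.inner0 (A (Pi.single i 1)) v := by
      conv_lhs => rw [h1, map_sum]
      simp only [map_smul, inner0, Finset.sum_apply, Pi.smul_apply, smul_eq_mul, Finset.mul_sum,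
        Finset.sum_mul]
      rw [Finset.sum_comm]
      exact Finset.sum_congr rfl fun i _ => Finset.sum_congr rfl fun j _ => by ring
    rw [h2]
    refine Finset.sum_congr rfl fun i _ => ?_
    have := (𝒯.mesCell_pos hΩ i).ne'
    simp only [LinearMap.coe_toContinuousLinearMap', LinearMap.coe_mk, AddHom.coe_mk]
    field_simp

theorem hasDerivAt_inner0 {u v : ℝ → ι → ℝ} {u' v' : ι → ℝ} {t : ℝ} (hu : HasDerivAt u u' t)
    (hv : HasDerivAt v v' t) :
    HasDerivAt (fun s => 𝒯.inner0 (u s) (v s)) (𝒯.inner0 u' (v t) + 𝒯.inner0 (u t) v') t := by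
  have h1 := hasDerivAt_pi.1 hu
  have h2 := hasDerivAt_pi.1 hv
  have h3 := HasDerivAt.fun_sum (u := Finset.univ) fun i _ =>
    ((h1 i).const_mul (𝒯.mesCell i)).mul (h2 i)
  refine HasDerivAt.congr_deriv (f := fun s => 𝒯.inner0 (u s) (v s)) h3 ?_
  simp only [inner0, ← Finset.sum_add_distrib]

theorem hasDerivAt_diffForm_self {u : ℝ → ι → ℝ} {u' : ι → ℝ} {t : ℝ} (hu : HasDerivAt u u' t) :
    HasDerivAt (fun s => 𝒯.diffForm (u s) (u s)) (2 * 𝒯.diffForm u' (u t)) t := by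
  have h1 := hasDerivAt_pi.1 hu
  have h2 : ∀ i σ, HasDerivAt (fun s => 𝒯.across (u s) i σ - u s i) (𝒯.across u' i σ - u' i) t := by
    intro i σ
    refine HasDerivAt.sub ?_ (h1 i)
    unfold across
    cases 𝒯.nbr i σ with
    | none => exact hasDerivAt_const t (0 : ℝ)
    | some j => exact h1 j
  have h3 := HasDerivAt.fun_sum (u := Finset.univ) fun i _ =>
    HasDerivAt.fun_sum (u := 𝒯.edges i) fun σ _ =>
      ((h2 i σ).mul (h2 i σ)).const_mul (𝒯.edgeWeight i σ * 𝒯.tau i σ)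
  refine HasDerivAt.congr_deriv (f := fun s => 𝒯.diffForm (u s) (u s)) h3 ?_
  rw [diffForm, Finset.mul_sum]
  refine Finset.sum_congr rfl fun i _ => ?_
  rw [Finset.mul_sum]
  exact Finset.sum_congr rfl fun σ _ => by ring

end Discrete

end AdmissibleMesh

/-! ### Exponentials of operators -/

section Exponential

variable {ι : Type} [Fintype ι]

theorem hasDerivAt_exp_neg_smul_apply (A : (ι → ℝ) →L[ℝ] (ι → ℝ)) (v : ι → ℝ) (t : ℝ) :
    HasDerivAt (fun s : ℝ => NormedSpace.exp (-s • A) v) (-(A (NormedSpace.exp (-t • A) v))) t := by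
  have h1 := hasDerivAt_exp_smul_const' (𝕂 := ℝ) A (-t)
  have h2 := HasDerivAt.scomp t h1 (hasDerivAt_neg t)
  have h3 := h2.clm_apply (hasDerivAt_const t v)
  refine HasDerivAt.congr_deriv (f := fun s : ℝ => NormedSpace.exp (-s • A) v) h3 ?_
  rw [map_zero, add_zero, neg_one_smul]
  rfl

/-- One step of the scheme is the flow at time `Δt` of the linear problem with frozen source. -/
theorem exists_flow (A : (ι → ℝ) →L[ℝ] (ι → ℝ)) (y F : ι → ℝ) {Δt : ℝ} (hΔt : 0 < Δt) :
    ∃ Y : ℝ → ι → ℝ, Y 0 = y ∧ Y Δt = y + Δt • phi1 A Δt (-(A y) + F) ∧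
      ∀ s, HasDerivAt Y (-(A (Y s)) + F) s := by
  set S : ℝ → (ι → ℝ) →L[ℝ] (ι → ℝ) := fun r => NormedSpace.exp (-r • A) with hS
  have hSd : ∀ r, HasDerivAt S (-(A * S r)) r := by
    intro r
    have h1 := hasDerivAt_exp_smul_const' (𝕂 := ℝ) A (-r)
    have h2 := HasDerivAt.scomp r h1 (hasDerivAt_neg r)
    refine HasDerivAt.congr_deriv (f := S) h2 ?_
    rw [neg_one_smul]
  have hSc : Continuous S := continuous_iff_continuousAt.2 fun r => (hSd r).continuousAt
  set Z : ℝ → (ι → ℝ) →L[ℝ] (ι → ℝ) := fun s => ∫ r in (0 : ℝ)..s, S r with hZ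
  have hZd : ∀ s, HasDerivAt Z (S s) s := fun s =>
    intervalIntegral.integral_hasDerivAt_right (hSc.intervalIntegrable _ _)
      (hSc.stronglyMeasurableAtFilter _ _) hSc.continuousAt
  -- The identity `A ∫₀ˢ exp(-rA) dr = 1 - exp(-sA)` verifies the differential equation without
  -- inverting `A`.
  have hAZ : ∀ s, A * Z s = 1 - S s := by
    intro s
    have h1 : ∫ r in (0 : ℝ)..s, -(A * S r) = S s - S 0 :=
      intervalIntegral.integral_eq_sub_of_hasDerivAt (fun r _ => hSd r)
        ((continuous_const.mul hSc).neg.intervalIntegrable _ _)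
    have h2 : ∫ r in (0 : ℝ)..s, A * S r = A * Z s :=
      (ContinuousLinearMap.mul ℝ ((ι → ℝ) →L[ℝ] (ι → ℝ)) A).intervalIntegral_comp_comm
        (hSc.intervalIntegrable _ _)
    rw [intervalIntegral.integral_neg, h2] at h1
    have h3 : S 0 = 1 := by simp [hS]
    rw [h3] at h1
    rw [← neg_inj, h1]; abel
  have hphi : Δt • phi1 A Δt = Z Δt := by
    rw [phi1, smul_inv_smul₀ hΔt.ne']
    have := intervalIntegral.integral_comp_sub_left (a := 0) (b := Δt) S Δt
    rw [sub_self, sub_zero] at this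
    exact this
  refine ⟨fun s => y + Z s (-(A y) + F), ?_, ?_, ?_⟩
  · simp [hZ]
  · change y + Z Δt (-(A y) + F) = _
    rw [← hphi]; rfl
  · intro s
    have h1 := ((hZd s).clm_apply (hasDerivAt_const s (-(A y) + F))).const_add y
    refine h1.congr_deriv ?_
    have h2 : A (Z s (-(A y) + F)) = (-(A y) + F) - S s (-(A y) + F) := by
      have := congrArg (fun B : (ι → ℝ) →L[ℝ] (ι → ℝ) => B (-(A y) + F)) (hAZ s)
      simpa using this
    simp only [map_add, map_zero, add_zero] at h2 ⊢
    rw [h2]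
    abel

end Exponential

namespace AdmissibleMesh

/-! ### Uniform stability and smoothing of the discrete semigroup -/

section Stability

variable {d : ℕ} {Ω : Set (Sp d)} {D : Sp d → Sp d →L[ℝ] Sp d} {ι ε : Type} [Fintype ι]

/-- The structural properties of the discrete operator on which its stability rests. -/
structure Stable (𝒯 : AdmissibleMesh Ω D ι ε) (q : Sp d → Sp d) (C : ℝ) : Prop where
  tau_pos : ∀ i, ∀ σ ∈ 𝒯.edges i, 0 < 𝒯.tau i σ
  conservative : 𝒯.Conservative (𝒯.flux q)
  div_free : ∀ i, ∑ σ ∈ 𝒯.edges i, 𝒯.flux q i σ = 0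
  conv_le : ∀ z w, |𝒯.convForm q z w| ≤ C * 𝒯.norm0 z * √(𝒯.sq1 w)

variable {𝒯 : AdmissibleMesh Ω D ι ε} {q : Sp d → Sp d} {C : ℝ}

/-- Smoothing properties of the semigroup generated by the adjoint of the discrete operator. -/
theorem Stable.semigroup_bounds (hst : 𝒯.Stable q C) (hΩ : Bornology.IsBounded Ω) {c₀ T : ℝ}
    (hc₀ : 0 ≤ c₀) {A' : (ι → ℝ) →L[ℝ] (ι → ℝ)}
    (hA' : ∀ u v, 𝒯.inner0 (𝒯.operator q c₀ u) v = 𝒯.inner0 u (A' v)) (v : ι → ℝ) {t : ℝ}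
    (ht : t ∈ Icc 0 T) :
    𝒯.norm0 (NormedSpace.exp (-t • A') v) ≤ 𝒯.norm0 v ∧
    t * 𝒯.sq1 (NormedSpace.exp (-t • A') v) ≤
      2 * (1 + 2 * T * C ^ 2 + T * c₀) * 𝒯.norm0 v ^ 2 ∧
    t ^ 2 * 𝒯.norm0 (A' (NormedSpace.exp (-t • A') v)) ^ 2 ≤
      2 * (1 + 2 * T * C ^ 2 + T * c₀) * 𝒯.norm0 v ^ 2 := by
  -- In the derivative of `Φ`, the part `1 + 2TC²` absorbs the Dirichlet terms produced by diffusion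
  -- and convection, and `T c₀` absorbs the term `2 s c₀² ‖w‖²` produced by the shift.
  set K := 1 + 2 * T * C ^ 2 + T * c₀ with hK
  have hT : 0 ≤ T := ht.1.trans ht.2
  have hKpos : 0 < K := by positivity
  have hτ : ∀ i, ∀ σ ∈ 𝒯.edges i, 0 ≤ 𝒯.tau i σ := fun i σ hσ => (hst.tau_pos i σ hσ).le
  set w : ℝ → ι → ℝ := fun s => NormedSpace.exp (-s • A') v with hw
  have hwd : ∀ s, HasDerivAt w (-(A' (w s))) s := hasDerivAt_exp_neg_smul_apply A' v
  have hzd : ∀ s, HasDerivAt (fun s => A' (w s)) (-(A' (A' (w s)))) s := by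
    intro s
    have := A'.hasFDerivAt.comp_hasDerivAt s (hwd s)
    rw [map_neg] at this
    exact this
  have hcoer : ∀ u, 1 / 2 * 𝒯.sq1 u + c₀ * 𝒯.inner0 u u ≤ 𝒯.inner0 (A' u) u := by
    intro u
    rw [𝒯.inner0_comm (A' u) u, ← hA', inner0_operator _ hΩ, form_eq]
    have h1 := half_sq1_le hτ u
    have h2 := convForm_self_nonneg hst.conservative hst.div_free u
    linarith
  -- The three terms carry the three bounds, each with the power of `s` that makes it vanish at `s =
  -- 0` or start from `‖v‖²`. As `Φ` is nonincreasing and `Φ 0 = K ‖v‖²`, all of them are read off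
  -- at once.
  set Φ : ℝ → ℝ := fun s => 1 / 2 * s ^ 2 * 𝒯.inner0 (A' (w s)) (A' (w s)) +
    s * 𝒯.diffForm (w s) (w s) + K * 𝒯.inner0 (w s) (w s) with hΦ
  have hΦd : ∀ s, HasDerivAt Φ
      ((s * 𝒯.inner0 (A' (w s)) (A' (w s)) - s ^ 2 * 𝒯.inner0 (A' (A' (w s))) (A' (w s))) +
        (𝒯.diffForm (w s) (w s) - 2 * s * 𝒯.diffForm (A' (w s)) (w s)) -
        2 * K * 𝒯.inner0 (A' (w s)) (w s)) s := by
    intro s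
    have h1 := 𝒯.hasDerivAt_inner0 (hzd s) (hzd s)
    have h2 := 𝒯.hasDerivAt_diffForm_self (hwd s)
    have h3 := 𝒯.hasDerivAt_inner0 (hwd s) (hwd s)
    have h4 := (((hasDerivAt_pow 2 s).const_mul (1 / 2 : ℝ)).mul h1).add
      (((hasDerivAt_id s).mul h2)) |>.add (h3.const_mul K)
    refine HasDerivAt.congr_deriv (f := Φ) h4 ?_
    have h5 : 𝒯.diffForm (-(A' (w s))) (w s) = -𝒯.diffForm (A' (w s)) (w s) := by
      simp only [diffForm, ← Finset.sum_neg_distrib]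
      refine Finset.sum_congr rfl fun i _ => Finset.sum_congr rfl fun σ _ => ?_
      have : 𝒯.across (-(A' (w s))) i σ = -𝒯.across (A' (w s)) i σ := by
        unfold across
        cases 𝒯.nbr i σ <;> simp
      rw [this]
      simp only [Pi.neg_apply]
      ring
    simp only [inner0_neg_left, inner0_neg_right, h5, id]
    rw [𝒯.inner0_comm (A' (w s)) (A' (A' (w s))), 𝒯.inner0_comm (w s) (A' (w s))]
    norm_num
    ring
  have hΦle : ∀ s ∈ Icc 0 T, (s * 𝒯.inner0 (A' (w s)) (A' (w s)) -
      s ^ 2 * 𝒯.inner0 (A' (A' (w s))) (A' (w s))) +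
        (𝒯.diffForm (w s) (w s) - 2 * s * 𝒯.diffForm (A' (w s)) (w s)) -
        2 * K * 𝒯.inner0 (A' (w s)) (w s) ≤ 0 := by
    intro s hs
    set z := A' (w s) with hz
    -- Since `z = A' w`, the form satisfies `a_h(z, w) = ⟨z, A' w⟩ = ⟨z, z⟩`. Hence `-2s` times the
    -- diffusive form contributes `-2s ‖z‖²`, which outweighs `s ‖z‖²` and pays for the convective
    -- and shift terms.
    have h1 : 𝒯.diffForm z (w s) = 𝒯.inner0 z z - 𝒯.convForm q z (w s) - c₀ * 𝒯.inner0 z (w s) := by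
      have := hA' z (w s)
      rw [inner0_operator _ hΩ, form_eq] at this
      linarith
    have h2 := hcoer z
    have h3 := hcoer (w s)
    have h4 := diffForm_le_sq1 hτ (w s)
    have h5 := (abs_le.1 (hst.conv_le z (w s))).2
    have h6 := (abs_le.1 (𝒯.abs_inner0_le z (w s))).2
    have h7 := 𝒯.inner0_self_nonneg z
    have h8 := sq1_nonneg hτ z
    have h9 := sq1_nonneg hτ (w s)
    have h10 := 𝒯.inner0_self_nonneg (w s)
    have h11 := Real.sq_sqrt h9
    have h12 := 𝒯.norm0_sq z
    have h13 := 𝒯.norm0_sq (w s)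
    have h14 : 0 ≤ 𝒯.inner0 (A' z) z := by nlinarith
    have h15 : 2 * 𝒯.convForm q z (w s) ≤ 1 / 2 * 𝒯.inner0 z z + 2 * C ^ 2 * 𝒯.sq1 (w s) := by
      nlinarith [sq_nonneg (𝒯.norm0 z - 2 * C * √(𝒯.sq1 (w s)))]
    have h16 : 2 * (c₀ * 𝒯.inner0 z (w s)) ≤
        1 / 2 * 𝒯.inner0 z z + 2 * c₀ ^ 2 * 𝒯.inner0 (w s) (w s) := by
      have := mul_le_mul_of_nonneg_left h6 hc₀
      nlinarith [sq_nonneg (𝒯.norm0 z - 2 * c₀ * 𝒯.norm0 (w s))]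
    have e1 := mul_nonneg (sq_nonneg s) h14
    have e2 := mul_le_mul_of_nonneg_left h15 hs.1
    have e3 := mul_le_mul_of_nonneg_left h16 hs.1
    have e4 := mul_le_mul_of_nonneg_left h3 hKpos.le
    have e5 := mul_nonneg (sub_nonneg.2 hs.2) (mul_nonneg (sq_nonneg C) h9)
    have e6 := mul_nonneg (sub_nonneg.2 hs.2) (mul_nonneg (sq_nonneg c₀) h10)
    have e7 : 0 ≤ T * c₀ * 𝒯.sq1 (w s) := by positivity
    have e8 : 0 ≤ (1 + 2 * T * C ^ 2) * c₀ * 𝒯.inner0 (w s) (w s) := by positivity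
    have e9 : K * (1 / 2 * 𝒯.sq1 (w s) + c₀ * 𝒯.inner0 (w s) (w s)) =
        1 / 2 * 𝒯.sq1 (w s) + T * C ^ 2 * 𝒯.sq1 (w s) + 1 / 2 * (T * c₀ * 𝒯.sq1 (w s)) +
        (1 + 2 * T * C ^ 2) * c₀ * 𝒯.inner0 (w s) (w s) +
        T * c₀ ^ 2 * 𝒯.inner0 (w s) (w s) := by rw [hK]; ring
    rw [h1]
    nlinarith
  have hanti : AntitoneOn Φ (Icc 0 T) := by
    refine antitoneOn_of_deriv_nonpos (convex_Icc _ _)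
      (fun s _ => (hΦd s).continuousAt.continuousWithinAt)
      (fun s _ => (hΦd s).differentiableAt.differentiableWithinAt) ?_
    intro s hs
    rw [(hΦd s).deriv]
    exact hΦle s (interior_subset hs)
  have hfin := hanti ⟨le_rfl, hT⟩ ht ht.1
  have hΦ0 : Φ 0 = K * 𝒯.norm0 v ^ 2 := by
    simp [hΦ, hw, norm0_sq]
  rw [hΦ0] at hfin
  have p1 : 0 ≤ 1 / 2 * t ^ 2 * 𝒯.inner0 (A' (w t)) (A' (w t)) :=
    mul_nonneg (by positivity) (𝒯.inner0_self_nonneg _)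
  have p2' := half_sq1_le hτ (w t)
  have p2 : 1 / 2 * (t * 𝒯.sq1 (w t)) ≤ t * 𝒯.diffForm (w t) (w t) := by
    have := mul_le_mul_of_nonneg_left p2' ht.1
    linarith
  have p3 : 0 ≤ t * 𝒯.sq1 (w t) := mul_nonneg ht.1 (sq1_nonneg hτ _)
  have p4 : 0 ≤ K * 𝒯.inner0 (w t) (w t) := mul_nonneg hKpos.le (𝒯.inner0_self_nonneg _)
  have hfin' : 1 / 2 * t ^ 2 * 𝒯.inner0 (A' (w t)) (A' (w t)) + t * 𝒯.diffForm (w t) (w t) +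
    K * 𝒯.inner0 (w t) (w t) ≤ K * 𝒯.norm0 v ^ 2 := hfin
  refine ⟨?_, ?_, ?_⟩
  · have h1 : K * 𝒯.norm0 (w t) ^ 2 ≤ K * 𝒯.norm0 v ^ 2 := by rw [𝒯.norm0_sq (w t)]; linarith
    exact (abs_le_of_sq_le_sq' (le_of_mul_le_mul_left h1 hKpos) (𝒯.norm0_nonneg v)).2
  · linarith
  · rw [𝒯.norm0_sq (A' _)]
    linarith

/-! ### The error bound -/

/-- A discrete Gronwall inequality. -/
theorem le_of_le_add_sum {E : ℕ → ℝ} {a b : ℝ} (hb : 0 ≤ b) {m : ℕ}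
    (h : ∀ k ≤ m, E k ≤ a + b * ∑ l ∈ Finset.range k, E l) : E m ≤ a * (1 + b) ^ m := by
  have key : ∀ k ≤ m, a + b * ∑ l ∈ Finset.range k, E l ≤ a * (1 + b) ^ k := by
    intro k
    induction k with
    | zero => simp
    | succ k ih =>
      intro hk
      have h1 := ih (by omega)
      have h2 := h k (by omega)
      rw [Finset.sum_range_succ, pow_succ]
      nlinarith
  exact (h m le_rfl).trans (key m le_rfl)

/-- The error of the scheme against a function `Xt` of center values and a function `Xb` of mean
values that satisfies the discrete equation up to a residual. -/
theorem Stable.error_bound (hst : 𝒯.Stable q C) (hΩ : Bornology.IsBounded Ω) {c₀ T : ℝ}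
    (hc₀ : 0 ≤ c₀) (hT : 0 ≤ T) {h Cr Cρ CF Δt : ℝ} (hh : 0 ≤ h) (hCr : 0 ≤ Cr) (hCρ : 0 ≤ Cρ)
    (hCF : 0 ≤ CF) (hΔt : 0 < Δt) {Xb Xt Xb' Fb : ℝ → ι → ℝ}
    (hXbc : ContinuousOn Xb (Icc 0 T)) (hXbd : ∀ t ∈ Ioo 0 T, HasDerivAt Xb (Xb' t) t)
    (hres : ∀ t ∈ Ioo 0 T, ∀ ψ, |𝒯.inner0 (Xb' t + 𝒯.operator q c₀ (Xt t) - Fb t) ψ| ≤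
      Cr * h * √(𝒯.sq1 ψ))
    (hρ : ∀ s ∈ Icc 0 T, ∀ t ∈ Icc 0 T,
      𝒯.norm0 ((Xt t - Xb t) - (Xt s - Xb s)) ≤ Cρ * h * √|t - s|)
    {y F : ℕ → ι → ℝ} {M : ℕ} (hM : M * Δt ≤ T)
    (hy0 : y 0 = Xt 0)
    (hy : ∀ k, y (k + 1) = y k + Δt • phi1 (𝒯.operator q c₀) Δt (-(𝒯.operator q c₀ (y k)) + F k))
    (hF : ∀ k < M, ∀ t ∈ Icc (k * Δt) ((k + 1 : ℕ) * Δt),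
      𝒯.norm0 (Fb t - F k) ≤ CF * (Δt + h) + CF * 𝒯.norm0 (Xt (k * Δt) - y k)) :
    𝒯.norm0 (Xt (M * Δt) - y M) ≤
      ((2 * (√(2 * (1 + 2 * T * C ^ 2 + T * c₀)) * (Cr + Cρ)) + Cρ) * √T + CF * T) *
        Real.exp (CF * T) * (Δt + h) := by
  set A := 𝒯.operator q c₀ with hA
  obtain ⟨A', hA'⟩ := 𝒯.exists_adjoint hΩ A
  set K := 2 * (1 + 2 * T * C ^ 2 + T * c₀) with hK
  have hK0 : 0 ≤ K := by positivity
  set κ := √K * (Cr + Cρ) with hκ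
  have hκ0 : 0 ≤ κ := by positivity
  set E : ℕ → ℝ := fun k => 𝒯.norm0 (Xt (k * Δt) - y k) with hE
  have hE0 : ∀ k, 0 ≤ E k := fun k => 𝒯.norm0_nonneg _
  have hmain : ∀ m ≤ M, E m ≤ ((2 * κ + Cρ) * √T + CF * T) * (Δt + h) +
      CF * Δt * ∑ k ∈ Finset.range m, E k := by
    intro m hm
    set tm : ℝ := m * Δt with htm
    have htm0 : 0 ≤ tm := by positivity
    have htmT : tm ≤ T := le_trans (mul_le_mul_of_nonneg_right (by exact_mod_cast hm) hΔt.le) hM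
    -- The error is bounded by duality, with `ψ` the solution of the adjoint problem that ends at
    -- `v` at time `tm`.
    refine 𝒯.norm0_le_of_forall ?_ fun v => ?_
    · have := Finset.sum_nonneg fun k (_ : k ∈ Finset.range m) => hE0 k
      positivity
    set ψ : ℝ → ι → ℝ := fun s => NormedSpace.exp (-(tm - s) • A') v with hψ
    have hψd : ∀ s, HasDerivAt ψ (A' (ψ s)) s := by
      intro s
      have h1 := hasDerivAt_exp_neg_smul_apply A' v (tm - s)
      have h2 := HasDerivAt.scomp s h1 ((hasDerivAt_id s).const_sub tm)
      refine HasDerivAt.congr_deriv (f := ψ) h2 ?_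
      simp [hψ]
    set ρm := Xt tm - Xb tm with hρm
    -- The means are corrected by the constant vector `ρm`. At `tm` this gives exactly the error of
    -- the center values, and in the derivative `ρ` appears only through `ρm - ρ(s)`.
    set P : ℕ → ℝ := fun k => 𝒯.inner0 (Xb (k * Δt) + ρm - y k) (ψ (k * Δt)) with hP
    set Q : ℕ → ℝ := fun k => √(tm - k * Δt) with hQ
    have hstep : ∀ k < m, P (k + 1) - P k ≤ 𝒯.norm0 v * (2 * κ * h * (Q k - Q (k + 1)) +
        (CF * (Δt + h) + CF * E k) * Δt) := by
      intro k hk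
      set a : ℝ := k * Δt with ha
      set b : ℝ := (k + 1 : ℕ) * Δt with hb
      have hba : b = a + Δt := by rw [hb, ha]; push_cast; ring
      have hab : a ≤ b := by linarith
      have ha0 : 0 ≤ a := by positivity
      have hbm : b ≤ tm := mul_le_mul_of_nonneg_right (by exact_mod_cast hk) hΔt.le
      obtain ⟨Y, hY0, hY1, hYd⟩ := exists_flow A (y k) (F k) hΔt
      set Bk := CF * (Δt + h) + CF * E k with hBk
      set p : ℝ → ℝ := fun s => 𝒯.inner0 (Xb s + ρm - Y (s - a)) (ψ s) with hp
      -- `Λ` is a primitive of the bound `‖v‖ (κ h / √(tm - s) + Bk)` for the derivative of `p`.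
      -- Comparing `p` with `Λ` avoids integrating a function that is singular at the last end
      -- point.
      set Λ : ℝ → ℝ := fun s => 𝒯.norm0 v * (-(2 * κ * h) * √(tm - s) + Bk * s) with hΛ
      have hYd' : ∀ s, HasDerivAt (fun s => Y (s - a)) (-(A (Y (s - a))) + F k) s := by
        intro s
        have := HasDerivAt.scomp s (hYd (s - a)) ((hasDerivAt_id s).sub_const a)
        rw [one_smul] at this
        exact this
      have hpc : ContinuousOn p (Icc a b) := by
        have h1 : ContinuousOn (fun s => Xb s + ρm - Y (s - a)) (Icc a b) := by
          refine ContinuousOn.sub (ContinuousOn.add (hXbc.mono ?_) continuousOn_const) ?_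
          · exact Icc_subset_Icc ha0 (hbm.trans htmT)
          · exact fun s _ => (hYd' s).continuousAt.continuousWithinAt
        have h2 : ContinuousOn ψ (Icc a b) :=
          fun s _ => (hψd s).continuousAt.continuousWithinAt
        simp only [hp, inner0]
        refine continuousOn_finsetSum _ fun i _ => ?_
        exact (continuousOn_const.mul ((continuous_apply i).comp_continuousOn h1)).mul
          ((continuous_apply i).comp_continuousOn h2)
      -- The terms with `A Y` cancel against the derivative of `ψ`. What remains is the residual of
      -- the exact solution, the error of freezing the source, and `⟨ρm - ρ(s), A' ψ⟩`.
      have hpd : ∀ s ∈ Ioo a b, HasDerivAt p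
          (𝒯.inner0 (Xb' s + A (Xt s) - Fb s) (ψ s) + 𝒯.inner0 (Fb s - F k) (ψ s) +
            𝒯.inner0 ((Xt tm - Xb tm) - (Xt s - Xb s)) (A' (ψ s))) s := by
        intro s hs
        have hsT : s ∈ Ioo 0 T := ⟨ha0.trans_lt hs.1, hs.2.trans_le (hbm.trans htmT)⟩
        have h1 := ((hXbd s hsT).add_const ρm).sub (hYd' s)
        have h2 := 𝒯.hasDerivAt_inner0 h1 (hψd s)
        refine HasDerivAt.congr_deriv (f := p) h2 ?_
        simp only [inner0_sub_left, inner0_add_left, inner0_neg_left, hρm, hA', Pi.sub_apply]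
        ring
      have hΛd : ∀ s ∈ Ioo a b, HasDerivAt Λ (𝒯.norm0 v * (κ * h / √(tm - s) + Bk)) s := by
        intro s hs
        have hpos : 0 < tm - s := by linarith [hs.2]
        have h1 := ((hasDerivAt_id s).const_sub tm).sqrt hpos.ne'
        have h2 := ((h1.const_mul (-(2 * κ * h))).add ((hasDerivAt_id s).const_mul Bk)).const_mul
          (𝒯.norm0 v)
        refine HasDerivAt.congr_deriv (f := Λ) h2 ?_
        have := Real.sqrt_pos.2 hpos
        simp only [id]
        field_simp
      have hbound : ∀ s ∈ Ioo a b,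
          𝒯.inner0 (Xb' s + A (Xt s) - Fb s) (ψ s) + 𝒯.inner0 (Fb s - F k) (ψ s) +
            𝒯.inner0 ((Xt tm - Xb tm) - (Xt s - Xb s)) (A' (ψ s)) ≤
          𝒯.norm0 v * (κ * h / √(tm - s) + Bk) := by
        intro s hs
        have hpos : 0 < tm - s := by linarith [hs.2]
        have hs0 : 0 < s := ha0.trans_lt hs.1
        have hsT : s ∈ Ioo 0 T := ⟨hs0, hs.2.trans_le (hbm.trans htmT)⟩
        obtain ⟨b1, b2, b3⟩ := hst.semigroup_bounds hΩ hc₀ hA' v (t := tm - s) (T := T)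
          ⟨hpos.le, by linarith⟩
        set r := √(tm - s) with hr
        have hrpos : 0 < r := Real.sqrt_pos.2 hpos
        have hr2 : r ^ 2 = tm - s := Real.sq_sqrt hpos.le
        have hKs : √K ^ 2 = K := Real.sq_sqrt hK0
        have nv := 𝒯.norm0_nonneg v
        have hτ : ∀ i, ∀ σ ∈ 𝒯.edges i, 0 ≤ 𝒯.tau i σ := fun i σ hσ => (hst.tau_pos i σ hσ).le
        have c2 : r * √(𝒯.sq1 (ψ s)) ≤ √K * 𝒯.norm0 v := by
          refine (abs_le_of_sq_le_sq' ?_ (by positivity)).2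
          rw [mul_pow, mul_pow, hr2, hKs, Real.sq_sqrt (sq1_nonneg hτ _)]
          exact b2
        have c3 : r ^ 2 * 𝒯.norm0 (A' (ψ s)) ≤ √K * 𝒯.norm0 v := by
          refine (abs_le_of_sq_le_sq' ?_ (by positivity)).2
          rw [mul_pow, mul_pow, hr2, hKs]
          exact b3
        have t1 : 𝒯.inner0 (Xb' s + A (Xt s) - Fb s) (ψ s) ≤ Cr * h * (√K * 𝒯.norm0 v / r) := by
          refine (le_abs_self _).trans ((hres s hsT (ψ s)).trans ?_)
          refine mul_le_mul_of_nonneg_left ?_ (by positivity)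
          rw [le_div_iff₀ hrpos]; linarith
        have t2 : 𝒯.inner0 (Fb s - F k) (ψ s) ≤ Bk * 𝒯.norm0 v := by
          refine (le_abs_self _).trans ((𝒯.abs_inner0_le _ _).trans ?_)
          exact mul_le_mul (hF k (by omega) s ⟨hs.1.le, hs.2.le⟩) b1 (𝒯.norm0_nonneg _)
            ((𝒯.norm0_nonneg _).trans (hF k (by omega) s ⟨hs.1.le, hs.2.le⟩))
        have t3 : 𝒯.inner0 ((Xt tm - Xb tm) - (Xt s - Xb s)) (A' (ψ s)) ≤
            Cρ * h * (√K * 𝒯.norm0 v / r) := by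
          refine (le_abs_self _).trans ((𝒯.abs_inner0_le _ _).trans ?_)
          have h1 := hρ s ⟨hs0.le, hsT.2.le⟩ tm ⟨htm0, htmT⟩
          rw [abs_of_pos hpos] at h1
          have h1' : 𝒯.norm0 ((Xt tm - Xb tm) - (Xt s - Xb s)) ≤ Cρ * h * r := h1
          refine (mul_le_mul_of_nonneg_right h1' (𝒯.norm0_nonneg _)).trans ?_
          rw [mul_assoc (Cρ * h)]
          refine mul_le_mul_of_nonneg_left ?_ (by positivity)
          rw [le_div_iff₀ hrpos]
          linarith
        have t4 : 𝒯.norm0 v * (κ * h / r + Bk) = Cr * h * (√K * 𝒯.norm0 v / r) +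
            Bk * 𝒯.norm0 v + Cρ * h * (√K * 𝒯.norm0 v / r) := by
          rw [hκ]; field_simp; ring
        rw [t4]
        linarith
      have hanti : AntitoneOn (fun s => p s - Λ s) (Icc a b) := by
        refine antitoneOn_of_deriv_nonpos (convex_Icc _ _) (hpc.sub ?_) ?_ ?_
        · simp only [hΛ]; fun_prop
        · intro s hs
          rw [interior_Icc] at hs
          exact ((hpd s hs).sub (hΛd s hs)).differentiableAt.differentiableWithinAt
        · intro s hs
          rw [interior_Icc] at hs
          have : HasDerivAt (fun s => p s - Λ s) _ s := (hpd s hs).sub (hΛd s hs)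
          rw [this.deriv]
          exact sub_nonpos.2 (hbound s hs)
      have hfin := hanti (left_mem_Icc.2 hab) (right_mem_Icc.2 hab) hab
      have hpa : p a = P k := by simp only [hp, hP, sub_self, hY0, ha]
      have hpb : p b = P (k + 1) := by
        simp only [hp, hP]
        rw [show b - a = Δt by linarith, hY1, hy k]
      have hΛab : Λ b - Λ a =
          𝒯.norm0 v * (2 * κ * h * (Q k - Q (k + 1)) + Bk * Δt) := by
        simp only [hΛ, hQ]
        rw [← hb, ← ha, hba]
        ring
      simp only at hfin
      rw [hpa, hpb] at hfin
      linarith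
    have hsum := Finset.sum_le_sum fun k (hk : k ∈ Finset.range m) =>
      hstep k (Finset.mem_range.1 hk)
    rw [Finset.sum_range_sub, ← Finset.mul_sum, Finset.sum_add_distrib, ← Finset.mul_sum,
      Finset.sum_range_sub', ← Finset.sum_mul, Finset.sum_add_distrib] at hsum
    have hPm : P m = 𝒯.inner0 (Xt tm - y m) v := by
      have h1 : Xb tm + ρm - y m = Xt tm - y m := by rw [hρm]; abel
      simp only [hP]
      rw [← htm, h1]
      simp [hψ]
    -- The scheme starts from the center values, so the initial defect is `ρm - ρ(0)`, again of
    -- order `h`.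
    have hP0 : P 0 ≤ Cρ * h * √T * 𝒯.norm0 v := by
      have h1 : Xb 0 + ρm - y 0 = (Xt tm - Xb tm) - (Xt 0 - Xb 0) := by
        rw [hy0, hρm]; abel
      simp only [hP, Nat.cast_zero, zero_mul]
      rw [h1]
      refine (le_abs_self _).trans ((𝒯.abs_inner0_le _ _).trans ?_)
      have h2 := hρ 0 ⟨le_rfl, hT⟩ tm ⟨htm0, htmT⟩
      rw [sub_zero, abs_of_nonneg htm0] at h2
      have h3 := (hst.semigroup_bounds hΩ hc₀ hA' v (t := tm - 0) (T := T)
        ⟨by linarith, by linarith⟩).1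
      refine mul_le_mul (h2.trans ?_) h3 (𝒯.norm0_nonneg _) (by positivity)
      exact mul_le_mul_of_nonneg_left (Real.sqrt_le_sqrt htmT) (by positivity)
    have hQ0 : Q 0 - Q m ≤ √T := by
      have h1 : Q 0 ≤ √T := Real.sqrt_le_sqrt (by simpa using htmT)
      have h2 : 0 ≤ Q m := Real.sqrt_nonneg _
      linarith
    have hfin : 𝒯.inner0 (Xt tm - y m) v ≤ Cρ * h * √T * 𝒯.norm0 v +
        𝒯.norm0 v * (2 * κ * h * √T +
          (m * (CF * (Δt + h)) + CF * ∑ k ∈ Finset.range m, E k) * Δt) := by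
      rw [← hPm]
      have h1 : 2 * κ * h * (Q 0 - Q m) ≤ 2 * κ * h * √T :=
        mul_le_mul_of_nonneg_left hQ0 (by positivity)
      have h2 := mul_le_mul_of_nonneg_left h1 (𝒯.norm0_nonneg v)
      simp only [Finset.sum_const, Finset.card_range, nsmul_eq_mul] at hsum
      rw [← Finset.mul_sum (Finset.range m) E CF] at hsum
      linarith
    refine hfin.trans ?_
    have nv := 𝒯.norm0_nonneg v
    have g1 : m * (CF * (Δt + h)) * Δt ≤ CF * T * (Δt + h) := by
      have : m * (CF * (Δt + h)) * Δt = CF * (Δt + h) * tm := by rw [htm]; ring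
      rw [this]
      have := mul_le_mul_of_nonneg_left htmT (by positivity : 0 ≤ CF * (Δt + h))
      linarith
    have g2 : (2 * κ + Cρ) * √T * h ≤ (2 * κ + Cρ) * √T * (Δt + h) :=
      mul_le_mul_of_nonneg_left (by linarith) (by positivity)
    have g3 := mul_le_mul_of_nonneg_left (add_le_add g1 g2) nv
    have hgoal : 𝒯.norm0 v * (CF * T * (Δt + h) + (2 * κ + Cρ) * √T * (Δt + h)) +
        𝒯.norm0 v * (CF * Δt * ∑ k ∈ Finset.range m, E k) =
        (((2 * κ + Cρ) * √T + CF * T) * (Δt + h) + CF * Δt * ∑ k ∈ Finset.range m, E k) *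
          𝒯.norm0 v := by ring
    rw [← hgoal]
    have hl : Cρ * h * √T * 𝒯.norm0 v + 𝒯.norm0 v * (2 * κ * h * √T +
        (m * (CF * (Δt + h)) + CF * ∑ k ∈ Finset.range m, E k) * Δt) =
        𝒯.norm0 v * (m * (CF * (Δt + h)) * Δt + (2 * κ + Cρ) * √T * h) +
        𝒯.norm0 v * (CF * Δt * ∑ k ∈ Finset.range m, E k) := by ring
    rw [hl]
    linarith
  have hg := le_of_le_add_sum (by positivity : 0 ≤ CF * Δt) hmain
  refine hg.trans ?_
  have h1 : (1 + CF * Δt) ^ M ≤ Real.exp (CF * T) := by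
    have h2 : 1 + CF * Δt ≤ Real.exp (CF * Δt) := by
      have := Real.add_one_le_exp (CF * Δt); linarith
    calc (1 + CF * Δt) ^ M ≤ Real.exp (CF * Δt) ^ M := pow_le_pow_left₀ (by positivity) h2 M
      _ = Real.exp (CF * (M * Δt)) := by rw [← Real.exp_nat_mul]; ring_nf
      _ ≤ Real.exp (CF * T) := Real.exp_le_exp.2 (mul_le_mul_of_nonneg_left hM hCF)
  have h2 : 0 ≤ ((2 * κ + Cρ) * √T + CF * T) * (Δt + h) := by positivity
  calc ((2 * κ + Cρ) * √T + CF * T) * (Δt + h) * (1 + CF * Δt) ^ M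
      ≤ ((2 * κ + Cρ) * √T + CF * T) * (Δt + h) * Real.exp (CF * T) :=
        mul_le_mul_of_nonneg_left h1 h2
    _ = _ := by ring

end Stability

end AdmissibleMesh

/-! ### Functions that are smooth up to the boundary of a convex set -/

section UpTo

variable {d : ℕ} {V : Type*} [NormedAddCommGroup V] [NormedSpace ℝ V] {K : Set (Sp d)}

theorem norm_sub_le_of_convex_closure (hK : Convex ℝ K) {f : Sp d → V}
    {f' : Sp d → Sp d →L[ℝ] V} {L : ℝ} (hf : ContinuousOn f (closure K))
    (hd : ∀ x ∈ K, HasFDerivAt f (f' x) x) (hL : ∀ x ∈ K, ‖f' x‖ ≤ L) {x y : Sp d}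
    (hx : x ∈ closure K) (hy : y ∈ closure K) : ‖f y - f x‖ ≤ L * ‖y - x‖ := by
  obtain ⟨x₀, hx₀⟩ : K.Nonempty := closure_nonempty_iff.1 ⟨x, hx⟩
  have hL0 : 0 ≤ L := (norm_nonneg _).trans (hL x₀ hx₀)
  have h1 : LipschitzOnWith ⟨L, hL0⟩ f K := LipschitzOnWith.of_dist_le_mul fun a ha b hb => by
    rw [dist_eq_norm, dist_eq_norm]
    exact hK.norm_image_sub_le_of_norm_hasFDerivWithin_le
      (fun z hz => (hd z hz).hasFDerivWithinAt) hL hb ha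
  have h2 := (LipschitzOnWith.closure hf h1).dist_le_mul y hy x hx
  rwa [dist_eq_norm, dist_eq_norm] at h2

/-- First order Taylor expansion up to the boundary of a convex set. -/
theorem abs_taylor_le_of_convex_closure (hK : Convex ℝ K) {f : Sp d → ℝ}
    {G : Sp d → Sp d} {H : Sp d → Sp d →L[ℝ] Sp d} {L : ℝ} (hf : ContinuousOn f (closure K))
    (hG : ContinuousOn G (closure K)) (hfd : ∀ x ∈ K, HasGradientAt f (G x) x)
    (hGd : ∀ x ∈ K, HasFDerivAt G (H x) x) (hL : ∀ x ∈ K, ‖H x‖ ≤ L) {x y : Sp d}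
    (hx : x ∈ closure K) (hy : y ∈ closure K) :
    |f y - f x - ⟪G x, y - x⟫| ≤ L * ‖y - x‖ ^ 2 := by
  have hin : ∀ a ∈ K, ∀ b ∈ K, |f b - f a - ⟪G a, b - a⟫| ≤ L * ‖b - a‖ ^ 2 := by
    intro a ha b hb
    have h1 : ∀ z ∈ K ∩ Metric.closedBall a ‖b - a‖,
        ‖(InnerProductSpace.toDual ℝ (Sp d)) (G z) - (InnerProductSpace.toDual ℝ (Sp d)) (G a)‖ ≤
          L * ‖b - a‖ := by
      intro z hz
      rw [← map_sub, LinearIsometryEquiv.norm_map]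
      refine (norm_sub_le_of_convex_closure hK hG hGd hL (subset_closure ha)
        (subset_closure hz.1)).trans ?_
      have hL0 : 0 ≤ L := (norm_nonneg _).trans (hL a ha)
      exact mul_le_mul_of_nonneg_left (by simpa [dist_eq_norm] using hz.2) hL0
    have h2 := Convex.norm_image_sub_le_of_norm_hasFDerivWithin_le'
      (fun z (hz : z ∈ K ∩ Metric.closedBall a ‖b - a‖) => (hfd z hz.1).hasFDerivAt.hasFDerivWithinAt)
      h1 (hK.inter (convex_closedBall a _)) ⟨ha, by simp⟩ ⟨hb, by simp [dist_eq_norm]⟩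
    rw [Real.norm_eq_abs] at h2
    simpa [sq, mul_assoc] using h2
  -- Both sides are continuous on `closure K ×ˢ closure K`, so the inequality passes to the closure
  -- in both points together.
  have hcl : (x, y) ∈ closure (K ×ˢ K) := by rw [closure_prod_eq]; exact ⟨hx, hy⟩
  have hsub : K ×ˢ K ⊆ closure K ×ˢ closure K := prod_mono subset_closure subset_closure
  refine ContinuousWithinAt.closure_le (s := K ×ˢ K)
    (f := fun z : Sp d × Sp d => |f z.2 - f z.1 - ⟪G z.1, z.2 - z.1⟫|)
    (g := fun z : Sp d × Sp d => L * ‖z.2 - z.1‖ ^ 2) hcl ?_ ?_ fun z hz => hin _ hz.1 _ hz.2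
  · have hc : ContinuousOn (fun z : Sp d × Sp d => |f z.2 - f z.1 - ⟪G z.1, z.2 - z.1⟫|)
        (closure K ×ˢ closure K) := by
      have c1 : ContinuousOn (fun z : Sp d × Sp d => f z.2) (closure K ×ˢ closure K) :=
        hf.comp continuousOn_snd fun z hz => hz.2
      have c2 : ContinuousOn (fun z : Sp d × Sp d => f z.1) (closure K ×ˢ closure K) :=
        hf.comp continuousOn_fst fun z hz => hz.1
      have c3 : ContinuousOn (fun z : Sp d × Sp d => G z.1) (closure K ×ˢ closure K) :=
        hG.comp continuousOn_fst fun z hz => hz.1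
      exact ((c1.sub c2).sub (c3.inner (𝕜 := ℝ) (by fun_prop))).abs
    exact (hc (x, y) ⟨hx, hy⟩).mono hsub
  · exact Continuous.continuousWithinAt (by fun_prop)

theorem le_on_closure {Y : Type*} [TopologicalSpace Y] {S C : Set Y} {f : Y → ℝ} {M : ℝ}
    (hf : ContinuousOn f C) (hSC : S ⊆ C) (hCS : C ⊆ closure S) (h : ∀ x ∈ S, f x ≤ M) :
    ∀ x ∈ C, f x ≤ M := fun x hx =>
  ContinuousWithinAt.closure_le (hCS hx) ((hf x hx).mono hSC) continuousWithinAt_const h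

end UpTo

/-- `g` is a `C¹` extension of `D` to the closure of `K`, bounded by `M` and with derivative `g'`
bounded by `L`. -/
structure IsCellTensor {d : ℕ} (K : Set (Sp d)) (D g : Sp d → Sp d →L[ℝ] Sp d)
    (g' : Sp d → Sp d →L[ℝ] Sp d →L[ℝ] Sp d) (M L : ℝ) : Prop where
  eqOn : EqOn D g K
  cont : ContinuousOn g (closure K)
  cont' : ContinuousOn g' (closure K)
  deriv : ∀ x ∈ K, HasFDerivAt g (g' x) x
  bound : ∀ x ∈ closure K, ‖g x‖ ≤ M
  bound' : ∀ x ∈ closure K, ‖g' x‖ ≤ L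

namespace AdmissibleMesh

/-! ### Control volumes and their covering of the domain -/

section Basic

variable {d : ℕ} {Ω : Set (Sp d)} {D : Sp d → Sp d →L[ℝ] Sp d} {ι ε : Type} [Fintype ι]
  (𝒯 : AdmissibleMesh Ω D ι ε)

theorem cell_bounded (hΩ : Bornology.IsBounded Ω) (i : ι) : Bornology.IsBounded (𝒯.cell i) :=
  hΩ.subset (𝒯.cell_subset i)

theorem closure_cell_subset (i : ι) : closure (𝒯.cell i) ⊆ closure Ω :=
  closure_mono (𝒯.cell_subset i)

theorem center_mem_closure (i : ι) : 𝒯.center i ∈ closure Ω :=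
  𝒯.closure_cell_subset i (𝒯.center_mem i)

theorem face_subset_closure {i : ι} {σ : ε} (hσ : σ ∈ 𝒯.edges i) :
    𝒯.face σ ⊆ closure (𝒯.cell i) := by
  refine Subset.trans ?_ frontier_subset_closure
  rw [𝒯.cell_frontier i]
  exact subset_biUnion_of_mem (u := 𝒯.face) (by exact_mod_cast hσ)

theorem diam_cell_le (i : ι) : Metric.diam (𝒯.cell i) ≤ 𝒯.size :=
  le_ciSup (f := fun i => Metric.diam (𝒯.cell i)) (Finite.bddAbove_range _) i

theorem norm_sub_le_size (hΩ : Bornology.IsBounded Ω) {i : ι} {x y : Sp d}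
    (hx : x ∈ closure (𝒯.cell i)) (hy : y ∈ closure (𝒯.cell i)) : ‖x - y‖ ≤ 𝒯.size := by
  rw [← dist_eq_norm]
  refine (Metric.dist_le_diam_of_mem (𝒯.cell_bounded hΩ i).closure hx hy).trans ?_
  rw [Metric.diam_closure]
  exact 𝒯.diam_cell_le i

theorem size_nonneg : 0 ≤ 𝒯.size := Real.iSup_nonneg fun _ => Metric.diam_nonneg

theorem dense_cells : closure Ω = closure (⋃ i, 𝒯.cell i) := by
  rw [closure_iUnion_of_finite, 𝒯.cell_cover]

/-- The control volumes miss only parts of their own frontiers, and frontiers of convex sets are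
null. -/
theorem ae_eq_cells : (Ω : Set (Sp d)) =ᵐ[volume] ⋃ i, 𝒯.cell i := by
  refine (Filter.EventuallyLE.antisymm ?_ (LE.le.eventuallyLE
    (iUnion_subset 𝒯.cell_subset)))
  have h1 : ∀ᵐ x : Sp d, ∀ i, x ∉ frontier (𝒯.cell i) :=
    ae_all_iff.2 fun i => measure_eq_zero_iff_ae_notMem.1 ((𝒯.cell_convex i).addHaar_frontier volume)
  filter_upwards [h1] with x hx hxΩ
  have hxc : x ∈ closure Ω := subset_closure hxΩ
  rw [𝒯.cell_cover] at hxc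
  obtain ⟨i, hi⟩ := mem_iUnion.1 hxc
  refine mem_iUnion.2 ⟨i, ?_⟩
  by_contra hni
  exact hx i (by rw [(𝒯.cell_open i).frontier_eq]; exact ⟨hi, hni⟩)

theorem setIntegral_eq_sum {f : Sp d → ℝ}
    (hf : ∀ i, IntegrableOn f (𝒯.cell i)) :
    ∫ x in Ω, f x = ∑ i, ∫ x in 𝒯.cell i, f x := by
  rw [setIntegral_congr_set 𝒯.ae_eq_cells]
  exact integral_iUnion_fintype (fun i => (𝒯.cell_open i).measurableSet)
    (fun i j hij => 𝒯.cell_disjoint i j hij) hf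

theorem sum_mesCell (hΩb : Bornology.IsBounded Ω) :
    ∑ i, 𝒯.mesCell i = volume.real Ω := by
  have h := 𝒯.setIntegral_eq_sum (f := fun _ => 1) fun i =>
    integrableOn_const (𝒯.cell_bounded hΩb i).measure_lt_top.ne
  simpa [mesCell] using h.symm

end Basic

/-! ### Geometry of neighbouring control volumes -/

section Geometry

variable {n : ℕ} {Ω : Set (Sp (n + 1))} {D : Sp (n + 1) → Sp (n + 1) →L[ℝ] Sp (n + 1)}
  {ι ε : Type} [Fintype ι] {𝒯 : AdmissibleMesh Ω D ι ε}

theorem isPolytope (hΩ : Bornology.IsBounded Ω) (i : ι) :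
    IsPolytope (𝒯.cell i) (𝒯.edges i) 𝒯.face (𝒯.normal i) 𝒯.foot where
  isOpen := 𝒯.cell_open i
  convex := 𝒯.cell_convex i
  nonempty := 𝒯.cell_nonempty i
  bounded := 𝒯.cell_bounded hΩ i
  closed := 𝒯.face_closed i
  frontier_eq := 𝒯.cell_frontier i
  inter := 𝒯.face_inter i
  norm_eq := 𝒯.normal_norm i
  plane := 𝒯.face_plane i
  side := 𝒯.cell_side i

theorem size_pos (hΩ : Bornology.IsBounded Ω) (i : ι) : 0 < 𝒯.size := by
  refine lt_of_lt_of_le ?_ (𝒯.diam_cell_le i)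
  obtain ⟨x, hx⟩ := 𝒯.cell_nonempty i
  have hnt : (𝒯.cell i).Nontrivial := by
    by_contra h
    rw [not_nontrivial_iff] at h
    have h1 : 𝒯.cell i = {x} := h.eq_singleton_of_mem hx
    have h2 := 𝒯.cell_open i
    rw [h1] at h2
    exact not_isOpen_singleton x h2
  exact Metric.diam_pos hnt (𝒯.cell_bounded hΩ i)

theorem mesEdge_eq (σ : ε) : 𝒯.mesEdge σ = (μHE[n] : Measure (Sp (n + 1))).real (𝒯.face σ) := rfl

/-- If the faces share a point, equal normals force equal hyperplanes, and both control volumes lie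
on the same side of it. Being disjoint and convex, they can touch it jointly only in a null set. -/
theorem measure_inter_of_normal_eq {i k : ι} (hik : i ≠ k) {σ σ' : ε} (hσ : σ ∈ 𝒯.edges i)
    (hσ' : σ' ∈ 𝒯.edges k) (hn : 𝒯.normal k σ' = 𝒯.normal i σ) :
    (μHE[n] : Measure (Sp (n + 1))) (𝒯.face σ ∩ 𝒯.face σ') = 0 := by
  rcases (𝒯.face σ ∩ 𝒯.face σ').eq_empty_or_nonempty with h0 | ⟨x₀, hx₀⟩
  · simp [h0]
  have key : ∀ i' σ₁, σ₁ ∈ 𝒯.edges i' → x₀ ∈ 𝒯.face σ₁ → ∀ x,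
      ⟪𝒯.normal i' σ₁, x - x₀⟫ = ⟪𝒯.normal i' σ₁, x - 𝒯.foot σ₁⟫ := by
    intro i' σ₁ h1 h2 x
    have h3 := 𝒯.face_plane i' σ₁ h1 x₀ h2
    rw [← sub_add_sub_cancel x x₀ (𝒯.foot σ₁), inner_add_right, h3, add_zero]
  refine measure_mono_null ?_ (measure_touching_same_side (𝒯.cell_open i) (𝒯.cell_open k)
    (𝒯.cell_convex i) (𝒯.cell_convex k) (𝒯.cell_nonempty i) (𝒯.cell_nonempty k)
    (𝒯.cell_disjoint i k hik) (𝒯.normal_norm i σ hσ) (p := x₀) ?_ ?_)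
  · rintro x ⟨hx, hx'⟩
    refine ⟨?_, 𝒯.face_subset_closure hσ hx, 𝒯.face_subset_closure hσ' hx'⟩
    rw [key i σ hσ hx₀.1]
    exact 𝒯.face_plane i σ hσ x hx
  · intro x hx
    rw [key i σ hσ hx₀.1]
    exact 𝒯.cell_side i σ hσ x hx
  · intro x hx
    rw [← hn, key k σ' hσ' hx₀.2]
    exact 𝒯.cell_side k σ' hσ' x hx

/-- Both normals are orthogonal to the same set of positive area, hence parallel; they cannot be
equal, because two disjoint cells on the same side would share only a null set. -/
theorem normal_neg (hpos : ∀ i, ∀ σ ∈ 𝒯.edges i, 0 < 𝒯.mesEdge σ) {i j : ι} {σ : ε}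
    (hσ : σ ∈ 𝒯.edges i) (hn : 𝒯.nbr i σ = some j) : 𝒯.normal j σ = -𝒯.normal i σ := by
  obtain ⟨hji, hσj, -⟩ := 𝒯.interior_edge i σ hσ j hn
  have hne : (μHE[n] : Measure (Sp (n + 1))) (𝒯.face σ) ≠ 0 := by
    intro h
    have := hpos i σ hσ
    rw [mesEdge_eq, measureReal_def, h] at this
    simp at this
  refine (eq_or_eq_neg_of_measure_ne_zero (𝒯.normal_norm i σ hσ) (𝒯.normal_norm j σ hσj)
    (𝒯.face_plane i σ hσ) (𝒯.face_plane j σ hσj) hne).resolve_left fun h => hne ?_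
  have := measure_inter_of_normal_eq hji.symm hσ hσj h
  rwa [inter_self] at this

/-- A face of a third control volume meets an interior edge in a null set. -/
theorem measure_inter_third (hpos : ∀ i, ∀ σ ∈ 𝒯.edges i, 0 < 𝒯.mesEdge σ) {i j k : ι} {σ σ' : ε}
    (hσ : σ ∈ 𝒯.edges i) (hn : 𝒯.nbr i σ = some j) (hki : k ≠ i) (hkj : k ≠ j)
    (hσ' : σ' ∈ 𝒯.edges k) : (μHE[n] : Measure (Sp (n + 1))) (𝒯.face σ ∩ 𝒯.face σ') = 0 := by
  obtain ⟨-, hσj, -⟩ := 𝒯.interior_edge i σ hσ j hn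
  by_contra hne
  rcases eq_or_eq_neg_of_measure_ne_zero (𝒯.normal_norm i σ hσ) (𝒯.normal_norm k σ' hσ')
    (fun x hx => 𝒯.face_plane i σ hσ x hx.1) (fun x hx => 𝒯.face_plane k σ' hσ' x hx.2) hne
    with h | h
  · exact hne (measure_inter_of_normal_eq hki.symm hσ hσ' h)
  · rw [← normal_neg hpos hσ hn] at h
    exact hne (measure_inter_of_normal_eq hkj.symm hσj hσ' h)

theorem sum_mesEdge_le (hΩ : Bornology.IsBounded Ω) (i : ι) :
    ∑ σ ∈ 𝒯.edges i, 𝒯.mesEdge σ ≤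
      2 * (n + 1) * (volume : Measure (Sp n)).real (Metric.closedBall 0 1) * 𝒯.size ^ n := by
  refine (isPolytope hΩ i).sum_measure_face_le.trans ?_
  refine mul_le_mul_of_nonneg_left (pow_le_pow_left₀ Metric.diam_nonneg (𝒯.diam_cell_le i) n) ?_
  have : 0 ≤ (volume : Measure (Sp n)).real (Metric.closedBall 0 1) := measureReal_nonneg
  positivity

end Geometry

/-! ### Bounds of the diffusion tensor that are uniform over all meshes -/

section Tensor

variable {d : ℕ} {Ω : Set (Sp d)} {D : Sp d → Sp d →L[ℝ] Sp d} {ι ε : Type} [Fintype ι]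
  {𝒯 : AdmissibleMesh Ω D ι ε}

/-- The tensor is `C¹` on every control volume, with the bounds `M` and `L`. -/
def TensorBound (𝒯 : AdmissibleMesh Ω D ι ε) (M L : ℝ) : Prop :=
  ∀ i, ∃ g g', IsCellTensor (𝒯.cell i) D g g' M L

theorem Regular.exists_tensorBound (hΩ : Bornology.IsBounded Ω) {ζ₁ ζ₂ : ℝ}
    (hreg : 𝒯.Regular ζ₁ ζ₂) : ∃ M L, 0 < M ∧ 0 < L ∧ 𝒯.TensorBound M L := by
  have h : ∀ i, ∃ (g : Sp d → Sp d →L[ℝ] Sp d) (g' : Sp d → Sp d →L[ℝ] Sp d →L[ℝ] Sp d) (B : ℝ),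
      ContinuousOn g (closure (𝒯.cell i)) ∧
      ContinuousOn g' (closure (𝒯.cell i)) ∧ (∀ x ∈ 𝒯.cell i, HasFDerivAt g (g' x) x) ∧
      EqOn D g (𝒯.cell i) ∧ (∀ x ∈ closure (𝒯.cell i), ‖g x‖ ≤ B) ∧
      (∀ x ∈ closure (𝒯.cell i), ‖g' x‖ ≤ B) := by
    intro i
    obtain ⟨g, ⟨g', h1, h2, h3⟩, h4⟩ := hreg.tensor_c1 i
    have hc := (𝒯.cell_bounded hΩ i).isCompact_closure
    obtain ⟨B₁, hB₁⟩ := hc.exists_bound_of_continuousOn h1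
    obtain ⟨B₂, hB₂⟩ := hc.exists_bound_of_continuousOn h2
    exact ⟨g, g', max B₁ B₂, h1, h2, h3, h4, fun x hx => (hB₁ x hx).trans (le_max_left _ _),
      fun x hx => (hB₂ x hx).trans (le_max_right _ _)⟩
  choose g g' B h1 h2 h3 h4 h5 h6 using h
  set S := 1 + ∑ i, |B i| with hS
  have hle : ∀ i, B i ≤ S := fun i => by
    have := Finset.single_le_sum (f := fun i => |B i|) (fun i _ => abs_nonneg _) (Finset.mem_univ i)
    have h' := le_abs_self (B i)
    linarith
  have hpos : 0 < S := by
    have := Finset.sum_nonneg fun i (_ : i ∈ Finset.univ) => abs_nonneg (B i)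
    linarith
  exact ⟨S, S, hpos, hpos, fun i => ⟨g i, g' i, h4 i, h1 i, h2 i, h3 i,
    fun x hx => (h5 i x hx).trans (hle i), fun x hx => (h6 i x hx).trans (hle i)⟩⟩

/-- The bounds of the tensor on one mesh are valid on all of them. -/
theorem TensorBound.transfer {ι₀ ε₀ : Type} [Fintype ι₀] {𝒯₀ : AdmissibleMesh Ω D ι₀ ε₀} {M L : ℝ}
    (h₀ : 𝒯₀.TensorBound M L) {ζ₁ ζ₂ : ℝ} (hreg : 𝒯.Regular ζ₁ ζ₂) : 𝒯.TensorBound M L := by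
  intro i
  obtain ⟨g, ⟨g', h1, h2, h3⟩, h4⟩ := hreg.tensor_c1 i
  -- The cells of the reference mesh are dense in `Ω`. On an overlap both extensions equal `D` in a
  -- neighbourhood, so values and derivatives agree there, and continuity carries the bounds to the
  -- closed cell.
  have hdense : closure (𝒯.cell i) ⊆ closure (𝒯.cell i ∩ ⋃ j, 𝒯₀.cell j) := by
    refine closure_minimal ?_ isClosed_closure
    refine Subset.trans ?_ ((𝒯.cell_open i).inter_closure)
    intro x hx
    refine ⟨hx, ?_⟩
    rw [← 𝒯₀.dense_cells]
    exact subset_closure (𝒯.cell_subset i hx)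
  have hsub : 𝒯.cell i ∩ ⋃ j, 𝒯₀.cell j ⊆ closure (𝒯.cell i) :=
    inter_subset_left.trans subset_closure
  have key : ∀ x ∈ 𝒯.cell i ∩ ⋃ j, 𝒯₀.cell j, ‖g x‖ ≤ M ∧ ‖g' x‖ ≤ L := by
    rintro x ⟨hx, hx'⟩
    obtain ⟨j, hj⟩ := mem_iUnion.1 hx'
    obtain ⟨g₀, g₀', ht⟩ := h₀ j
    have hev : g =ᶠ[nhds x] g₀ := by
      filter_upwards [(𝒯.cell_open i).mem_nhds hx, (𝒯₀.cell_open j).mem_nhds hj] with z hz hz'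
      rw [← h4 hz, ht.eqOn hz']
    have hd : g' x = g₀' x := (h3 x hx).unique ((ht.deriv x hj).congr_of_eventuallyEq hev)
    rw [hev.eq_of_nhds, hd]
    exact ⟨ht.bound x (subset_closure hj), ht.bound' x (subset_closure hj)⟩
  exact ⟨g, g', h4, h1, h2, h3, le_on_closure h1.norm hsub hdense fun x hx => (key x hx).1,
    le_on_closure h2.norm hsub hdense fun x hx => (key x hx).2⟩

end Tensor

end AdmissibleMesh

/-! ### The mean tensor -/

section Mean

variable {d : ℕ} {K : Set (Sp d)} {D g : Sp d → Sp d →L[ℝ] Sp d}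
  {g' : Sp d → Sp d →L[ℝ] Sp d →L[ℝ] Sp d} {M L : ℝ}

theorem IsCellTensor.integrableOn (h : IsCellTensor K D g g' M L) (hKo : IsOpen K)
    (hb : Bornology.IsBounded K) : IntegrableOn D K :=
  ((h.cont.integrableOn_compact hb.isCompact_closure).mono_set subset_closure).congr_fun
    h.eqOn.symm hKo.measurableSet

theorem IsCellTensor.inner_meanTensor (h : IsCellTensor K D g g' M L) (hKo : IsOpen K)
    (hb : Bornology.IsBounded K) (ξ η : Sp d) :
    ⟪meanTensor D K ξ, η⟫ = (volume.real K)⁻¹ * ∫ x in K, ⟪D x ξ, η⟫ := by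
  have hi := h.integrableOn hKo hb
  have h1 : (∫ x in K, D x) ξ = ∫ x in K, D x ξ := ContinuousLinearMap.integral_apply hi ξ
  have h2 : ⟪∫ x in K, D x ξ, η⟫ = ∫ x in K, ⟪D x ξ, η⟫ := by
    rw [real_inner_comm, ← integral_inner (hi.apply_continuousLinearMap ξ)]
    simp_rw [real_inner_comm]
  rw [meanTensor, _root_.smul_apply, real_inner_smul_left, h1, h2]

theorem IsCellTensor.meanTensor_symm (h : IsCellTensor K D g g' M L) (hKo : IsOpen K)
    (hb : Bornology.IsBounded K)
    (hs : ∀ x ∈ K, ∀ ξ η : Sp d, ⟪D x ξ, η⟫ = ⟪ξ, D x η⟫) (ξ η : Sp d) :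
    ⟪meanTensor D K ξ, η⟫ = ⟪ξ, meanTensor D K η⟫ := by
  rw [h.inner_meanTensor hKo hb, real_inner_comm, h.inner_meanTensor hKo hb]
  congr 1
  refine setIntegral_congr_fun hKo.measurableSet fun x hx => ?_
  rw [hs x hx, real_inner_comm]

theorem IsCellTensor.meanTensor_elliptic (h : IsCellTensor K D g g' M L) (hKo : IsOpen K)
    (hb : Bornology.IsBounded K) (hne : K.Nonempty) {c₁ : ℝ}
    (he : ∀ x ∈ K, ∀ ξ : Sp d, c₁ * ‖ξ‖ ^ 2 ≤ ⟪D x ξ, ξ⟫) (ξ : Sp d) :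
    c₁ * ‖ξ‖ ^ 2 ≤ ⟪meanTensor D K ξ, ξ⟫ := by
  have hpos : 0 < volume.real K :=
    ENNReal.toReal_pos (hKo.measure_pos volume hne).ne' hb.measure_lt_top.ne
  rw [h.inner_meanTensor hKo hb, ← div_eq_inv_mul, le_div_iff₀ hpos]
  have hi : IntegrableOn (fun x => ⟪D x ξ, ξ⟫) K :=
    ((h.integrableOn hKo hb).apply_continuousLinearMap ξ).inner_const ξ
  have h1 := setIntegral_mono_on (integrableOn_const hb.measure_lt_top.ne) hi hKo.measurableSet
    fun x hx => he x hx ξ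
  simpa [mul_comm] using h1

theorem IsCellTensor.norm_meanTensor_sub_le (h : IsCellTensor K D g g' M L) (hKo : IsOpen K)
    (hb : Bornology.IsBounded K) (hc : Convex ℝ K) (hne : K.Nonempty) {s : ℝ} (hL : 0 ≤ L)
    {z : Sp d} (hz : z ∈ closure K) (hs : ∀ x ∈ K, ‖x - z‖ ≤ s) :
    ‖meanTensor D K - g z‖ ≤ L * s := by
  have hpos : 0 < volume.real K :=
    ENNReal.toReal_pos (hKo.measure_pos volume hne).ne' hb.measure_lt_top.ne
  have hi := h.integrableOn hKo hb
  have hconst : IntegrableOn (fun _ : Sp d => g z) K :=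
    integrableOn_const (C := g z) hb.measure_lt_top.ne (by simp)
  have h1 : meanTensor D K - g z = (volume.real K)⁻¹ • ∫ x in K, (D x - g z) := by
    rw [integral_sub hi hconst, setIntegral_const, smul_sub, inv_smul_smul₀ hpos.ne', meanTensor]
  have h2 : ‖∫ x in K, (D x - g z)‖ ≤ L * s * volume.real K := by
    refine norm_setIntegral_le_of_norm_le_const hb.measure_lt_top fun x hx => ?_
    rw [h.eqOn hx]
    exact (norm_sub_le_of_convex_closure hc h.cont h.deriv
      (fun y hy => h.bound' y (subset_closure hy)) hz (subset_closure hx)).trans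
      (mul_le_mul_of_nonneg_left (hs x hx) hL)
  rw [h1, norm_smul, norm_inv, Real.norm_of_nonneg hpos.le, inv_mul_le_iff₀ hpos]
  linarith

theorem IsCellTensor.norm_meanTensor_le (h : IsCellTensor K D g g' M L) (hKo : IsOpen K)
    (hb : Bornology.IsBounded K) (hne : K.Nonempty) : ‖meanTensor D K‖ ≤ M := by
  have hpos : 0 < volume.real K :=
    ENNReal.toReal_pos (hKo.measure_pos volume hne).ne' hb.measure_lt_top.ne
  have h2 : ‖∫ x in K, D x‖ ≤ M * volume.real K := by
    refine norm_setIntegral_le_of_norm_le_const hb.measure_lt_top fun x hx => ?_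
    rw [h.eqOn hx]
    exact h.bound x (subset_closure hx)
  rw [meanTensor, norm_smul, norm_inv, Real.norm_of_nonneg hpos.le, inv_mul_le_iff₀ hpos]
  linarith

end Mean

namespace AdmissibleMesh

/-! ### Transmissibilities and stability of regular meshes -/

section Lambda

variable {d : ℕ} {Ω : Set (Sp d)} {D : Sp d → Sp d →L[ℝ] Sp d} {ι ε : Type} [Fintype ι]

/-- The factor with `foot σ - center i = lam i σ • D_i n_{i,σ}`. -/
def lam (𝒯 : AdmissibleMesh Ω D ι ε) (i : ι) (σ : ε) : ℝ := 𝒯.distEdge i σ / 𝒯.diffEdge i σ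

/-- The resistance of an edge, `mes(σ) / τ_σ`. -/
def resist (𝒯 : AdmissibleMesh Ω D ι ε) (i : ι) (σ : ε) : ℝ :=
  match 𝒯.nbr i σ with
  | some j => 𝒯.lam i σ + 𝒯.lam j σ
  | none => 𝒯.lam i σ

variable {𝒯 : AdmissibleMesh Ω D ι ε} {M L c₁ : ℝ}

theorem diffEdge_le (hΩ : Bornology.IsBounded Ω) (htb : 𝒯.TensorBound M L) {i : ι} {σ : ε}
    (hσ : σ ∈ 𝒯.edges i) : 𝒯.diffEdge i σ ≤ M := by
  obtain ⟨g, g', ht⟩ := htb i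
  refine (ContinuousLinearMap.le_opNorm _ _).trans ?_
  rw [𝒯.normal_norm i σ hσ, mul_one]
  exact ht.norm_meanTensor_le (𝒯.cell_open i) (𝒯.cell_bounded hΩ i) (𝒯.cell_nonempty i)

theorem le_inner_meanTensor (hΩ : Bornology.IsBounded Ω) (htb : 𝒯.TensorBound M L)
    (he : ∀ x ∈ Ω, ∀ ξ : Sp d, c₁ * ‖ξ‖ ^ 2 ≤ ⟪D x ξ, ξ⟫) {i : ι} {σ : ε} (hσ : σ ∈ 𝒯.edges i) :
    c₁ ≤ ⟪meanTensor D (𝒯.cell i) (𝒯.normal i σ), 𝒯.normal i σ⟫ := by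
  obtain ⟨g, g', ht⟩ := htb i
  have := ht.meanTensor_elliptic (𝒯.cell_open i) (𝒯.cell_bounded hΩ i) (𝒯.cell_nonempty i)
    (fun x hx => he x (𝒯.cell_subset i hx)) (𝒯.normal i σ)
  simpa [𝒯.normal_norm i σ hσ] using this

theorem le_diffEdge (hΩ : Bornology.IsBounded Ω) (htb : 𝒯.TensorBound M L)
    (he : ∀ x ∈ Ω, ∀ ξ : Sp d, c₁ * ‖ξ‖ ^ 2 ≤ ⟪D x ξ, ξ⟫) {i : ι} {σ : ε} (hσ : σ ∈ 𝒯.edges i) :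
    c₁ ≤ 𝒯.diffEdge i σ := by
  refine (le_inner_meanTensor hΩ htb he hσ).trans ((real_inner_le_norm _ _).trans ?_)
  rw [𝒯.normal_norm i σ hσ, mul_one]
  rfl

theorem distEdge_le_size (hΩ : Bornology.IsBounded Ω) {i : ι} {σ : ε} (hσ : σ ∈ 𝒯.edges i) :
    𝒯.distEdge i σ ≤ 𝒯.size := by
  rw [distEdge, dist_eq_norm]
  exact 𝒯.norm_sub_le_size hΩ (𝒯.center_mem i) (𝒯.face_subset_closure hσ (𝒯.foot_mem i σ hσ))

theorem lam_nonneg (i : ι) (σ : ε) : 0 ≤ 𝒯.lam i σ := div_nonneg dist_nonneg (norm_nonneg _)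

/-- Orthogonality for `D_i⁻¹` says that `D_i⁻¹ (y_σ - x_i)` is normal to the edge, so `y_σ - x_i` is
a multiple of `D_i n`. The factor is nonnegative by ellipticity, since the center is on the inner
side, and its value is fixed by the length. It is zero if the center lies on the edge. -/
theorem foot_sub_center (hΩ : Bornology.IsBounded Ω) (htb : 𝒯.TensorBound M L) (hc₁ : 0 < c₁)
    (he : ∀ x ∈ Ω, ∀ ξ : Sp d, c₁ * ‖ξ‖ ^ 2 ≤ ⟪D x ξ, ξ⟫) {i : ι} {σ : ε} (hσ : σ ∈ 𝒯.edges i) :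
    𝒯.foot σ - 𝒯.center i = 𝒯.lam i σ • meanTensor D (𝒯.cell i) (𝒯.normal i σ) := by
  obtain ⟨w, hw, hperp⟩ := 𝒯.perp i σ hσ
  set ν := 𝒯.normal i σ with hν
  have hν1 : ‖ν‖ = 1 := 𝒯.normal_norm i σ hσ
  set a := ⟪ν, w⟫ with ha
  have hwa : w = a • ν := by
    have h1 : ⟪ν, w - a • ν⟫ = 0 := by
      rw [inner_sub_right, real_inner_smul_right, real_inner_self_eq_norm_sq, hν1]; simp [ha]
    have h2 := hperp _ h1
    have h3 : ⟪w - a • ν, w - a • ν⟫ = 0 := by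
      rw [inner_sub_left, real_inner_smul_left, h1, h2]; ring
    exact sub_eq_zero.1 (inner_self_eq_zero.1 h3)
  have h4 : 𝒯.foot σ - 𝒯.center i = a • meanTensor D (𝒯.cell i) ν := by
    rw [← hw, hwa, map_smul]
  have hell := le_inner_meanTensor hΩ htb he hσ
  have h5 : ⟪ν, 𝒯.center i - 𝒯.foot σ⟫ ≤ 0 := by
    have hcl : IsClosed {x : Sp d | ⟪ν, x - 𝒯.foot σ⟫ ≤ 0} :=
      isClosed_le (by fun_prop) continuous_const
    exact closure_minimal (fun x hx => (𝒯.cell_side i σ hσ x hx).le) hcl (𝒯.center_mem i)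
  have ha0 : 0 ≤ a := by
    have h6 : 0 ≤ ⟪ν, 𝒯.foot σ - 𝒯.center i⟫ := by
      rw [← neg_sub, inner_neg_right]; linarith
    rw [h4, real_inner_smul_right, real_inner_comm] at h6
    exact nonneg_of_mul_nonneg_left h6 (hc₁.trans_le hell)
  have hpos : 0 < 𝒯.diffEdge i σ := hc₁.trans_le (le_diffEdge hΩ htb he hσ)
  have hlam : 𝒯.lam i σ = a := by
    rw [lam, div_eq_iff hpos.ne', distEdge, dist_comm, dist_eq_norm, h4, norm_smul,
      Real.norm_of_nonneg ha0]
    rfl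
  rw [h4, hlam]

theorem distEdge_eq (hΩ : Bornology.IsBounded Ω) (htb : 𝒯.TensorBound M L) (hc₁ : 0 < c₁)
    (he : ∀ x ∈ Ω, ∀ ξ : Sp d, c₁ * ‖ξ‖ ^ 2 ≤ ⟪D x ξ, ξ⟫) {i : ι} {σ : ε} (hσ : σ ∈ 𝒯.edges i) :
    𝒯.distEdge i σ = 𝒯.lam i σ * 𝒯.diffEdge i σ := by
  rw [lam, div_mul_cancel₀ _ (hc₁.trans_le (le_diffEdge hΩ htb he hσ)).ne']

theorem lam_le (hΩ : Bornology.IsBounded Ω) (htb : 𝒯.TensorBound M L) (hc₁ : 0 < c₁)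
    (he : ∀ x ∈ Ω, ∀ ξ : Sp d, c₁ * ‖ξ‖ ^ 2 ≤ ⟪D x ξ, ξ⟫) {i : ι} {σ : ε} (hσ : σ ∈ 𝒯.edges i) :
    𝒯.lam i σ ≤ 𝒯.size / c₁ :=
  div_le_div₀ 𝒯.size_nonneg (distEdge_le_size hΩ hσ) hc₁ (le_diffEdge hΩ htb he hσ)

theorem resist_le (hΩ : Bornology.IsBounded Ω) (htb : 𝒯.TensorBound M L) (hc₁ : 0 < c₁)
    (he : ∀ x ∈ Ω, ∀ ξ : Sp d, c₁ * ‖ξ‖ ^ 2 ≤ ⟪D x ξ, ξ⟫) {i : ι} {σ : ε} (hσ : σ ∈ 𝒯.edges i) :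
    𝒯.resist i σ ≤ 2 / c₁ * 𝒯.size := by
  have h1 := lam_le hΩ htb hc₁ he hσ
  have h0 : 0 ≤ 𝒯.size / c₁ := div_nonneg 𝒯.size_nonneg hc₁.le
  have h2 : 2 / c₁ * 𝒯.size = 𝒯.size / c₁ + 𝒯.size / c₁ := by ring
  rw [h2]
  unfold resist
  cases hn : 𝒯.nbr i σ with
  | none => simp only; linarith
  | some j =>
    obtain ⟨-, hσj, -⟩ := 𝒯.interior_edge i σ hσ j hn
    exact add_le_add h1 (lam_le hΩ htb hc₁ he hσj)

/-- The individual factors `lam` may vanish. This comparison makes their sum, the resistance,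
positive, because `d_σ` is bounded from below on regular meshes. -/
theorem distSigma_le (hΩ : Bornology.IsBounded Ω) (htb : 𝒯.TensorBound M L) (hc₁ : 0 < c₁)
    (he : ∀ x ∈ Ω, ∀ ξ : Sp d, c₁ * ‖ξ‖ ^ 2 ≤ ⟪D x ξ, ξ⟫) {i : ι} {σ : ε} (hσ : σ ∈ 𝒯.edges i) :
    𝒯.distSigma i σ ≤ M * 𝒯.resist i σ := by
  have key : ∀ i, σ ∈ 𝒯.edges i → 𝒯.distEdge i σ ≤ M * 𝒯.lam i σ := by
    intro i hσ
    rw [distEdge_eq hΩ htb hc₁ he hσ, mul_comm]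
    exact mul_le_mul_of_nonneg_right (diffEdge_le hΩ htb hσ) (lam_nonneg i σ)
  unfold distSigma resist
  cases hn : 𝒯.nbr i σ with
  | none => exact key i hσ
  | some j =>
    obtain ⟨-, hσj, -⟩ := 𝒯.interior_edge i σ hσ j hn
    simp only
    refine (dist_triangle_right _ _ (𝒯.foot σ)).trans ?_
    rw [mul_add]
    exact add_le_add (key i hσ) (key j hσj)

/-- With `d_{i,σ} = lam * D_{i,σ}` the harmonic mean becomes two resistances in series, and the
factor `d_σ` in `mu` cancels. Consistency is proved one side at a time in this form. -/
theorem tau_eq (hΩ : Bornology.IsBounded Ω) (htb : 𝒯.TensorBound M L) (hc₁ : 0 < c₁)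
    (he : ∀ x ∈ Ω, ∀ ξ : Sp d, c₁ * ‖ξ‖ ^ 2 ≤ ⟪D x ξ, ξ⟫) {i : ι} {σ : ε} (hσ : σ ∈ 𝒯.edges i)
    (hd : 0 < 𝒯.distSigma i σ) : 𝒯.tau i σ = 𝒯.mesEdge σ / 𝒯.resist i σ := by
  have hr : 𝒯.resist i σ ≠ 0 := by
    intro h
    have := distSigma_le hΩ htb hc₁ he hσ
    rw [h, mul_zero] at this
    linarith
  have hi := (hc₁.trans_le (le_diffEdge hΩ htb he hσ)).ne'
  have hdi := distEdge_eq hΩ htb hc₁ he hσ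
  rw [tau, mul_div_assoc, div_eq_mul_inv (𝒯.mesEdge σ)]
  congr 1
  cases hn : 𝒯.nbr i σ with
  | none =>
    simp only [distSigma, hn] at hd
    simp only [resist, hn] at hr
    simp only [mu, distSigma, resist, hn]
    rw [hdi]
    field_simp
  | some j =>
    obtain ⟨-, hσj, -⟩ := 𝒯.interior_edge i σ hσ j hn
    have hj := (hc₁.trans_le (le_diffEdge hΩ htb he hσj)).ne'
    have hdj := distEdge_eq hΩ htb hc₁ he hσj
    simp only [distSigma, hn] at hd
    simp only [resist, hn] at hr
    simp only [mu, distSigma, resist, hn]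
    rw [hdi, hdj, mul_div_assoc, mul_comm, div_mul_cancel₀ _ hd.ne']
    have : 𝒯.diffEdge j σ * (𝒯.lam i σ * 𝒯.diffEdge i σ) +
        𝒯.diffEdge i σ * (𝒯.lam j σ * 𝒯.diffEdge j σ) =
        𝒯.diffEdge i σ * 𝒯.diffEdge j σ * (𝒯.lam i σ + 𝒯.lam j σ) := by ring
    rw [this]
    field_simp

end Lambda

section Regularity

variable {n : ℕ} {Ω : Set (Sp (n + 1))} {D : Sp (n + 1) → Sp (n + 1) →L[ℝ] Sp (n + 1)}
  {ι ε : Type} [Fintype ι] {𝒯 : AdmissibleMesh Ω D ι ε} {M L c₁ ζ₁ ζ₂ : ℝ}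

theorem Regular.mesEdge_pos (hreg : 𝒯.Regular ζ₁ ζ₂) (hζ₁ : 0 < ζ₁) (hΩ : Bornology.IsBounded Ω)
    (i : ι) {σ : ε} (hσ : σ ∈ 𝒯.edges i) : 0 < 𝒯.mesEdge σ :=
  (mul_pos hζ₁ (pow_pos (size_pos hΩ i) _)).trans_le (hreg.mes_edge i σ hσ).1

theorem Regular.distSigma_pos (hreg : 𝒯.Regular ζ₁ ζ₂) (hζ₁ : 0 < ζ₁) (hΩ : Bornology.IsBounded Ω)
    {i : ι} {σ : ε} (hσ : σ ∈ 𝒯.edges i) : 0 < 𝒯.distSigma i σ :=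
  (mul_pos hζ₁ (size_pos hΩ i)).trans_le (hreg.dist_sigma i σ hσ).1

theorem Regular.resist_pos (hreg : 𝒯.Regular ζ₁ ζ₂) (hζ₁ : 0 < ζ₁) (hΩ : Bornology.IsBounded Ω)
    (htb : 𝒯.TensorBound M L) (hM : 0 < M) (hc₁ : 0 < c₁)
    (he : ∀ x ∈ Ω, ∀ ξ : Sp (n + 1), c₁ * ‖ξ‖ ^ 2 ≤ ⟪D x ξ, ξ⟫) {i : ι} {σ : ε}
    (hσ : σ ∈ 𝒯.edges i) : 0 < 𝒯.resist i σ :=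
  pos_of_mul_pos_right ((hreg.distSigma_pos hζ₁ hΩ hσ).trans_le (distSigma_le hΩ htb hc₁ he hσ))
    hM.le

theorem conservative_flux (hpos : ∀ i, ∀ σ ∈ 𝒯.edges i, 0 < 𝒯.mesEdge σ)
    (q : Sp (n + 1) → Sp (n + 1)) : 𝒯.Conservative (𝒯.flux q) := by
  intro i σ hσ j hn
  unfold flux
  rw [normal_neg hpos hσ hn, ← integral_neg]
  simp only [inner_neg_right]

theorem sum_flux_eq_zero (hΩ : Bornology.IsBounded Ω) {q : Sp (n + 1) → Sp (n + 1)}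
    (hq : IsVelocity Ω q) (i : ι) : ∑ σ ∈ 𝒯.edges i, 𝒯.flux q i σ = 0 := by
  obtain ⟨q', h1, h2, h3⟩ := hq.c1
  have h4 := (isPolytope (𝒯 := 𝒯) hΩ i).setIntegral_divergence (h1.mono (𝒯.closure_cell_subset i))
    (h2.mono (𝒯.closure_cell_subset i)) fun x hx => h3 x (𝒯.cell_subset i hx)
  refine Eq.trans h4.symm ?_
  refine setIntegral_eq_zero_of_forall_eq_zero fun x hx => ?_
  have h5 := hq.div_free x (𝒯.cell_subset i hx)
  rwa [divergence, (h3 x (𝒯.cell_subset i hx)).fderiv] at h5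

theorem abs_flux_le (hΩ : Bornology.IsBounded Ω) {q : Sp (n + 1) → Sp (n + 1)} {Q : ℝ}
    (hQ : ∀ x ∈ closure Ω, ‖q x‖ ≤ Q) {i : ι} {σ : ε} (hσ : σ ∈ 𝒯.edges i) :
    |𝒯.flux q i σ| ≤ Q * 𝒯.mesEdge σ := by
  rw [← Real.norm_eq_abs, flux]
  refine norm_setIntegral_le_of_norm_le_const ((isPolytope hΩ i).measure_face_lt_top hσ)
    fun x hx => ?_
  refine (norm_inner_le_norm _ _).trans ?_
  rw [𝒯.normal_norm i σ hσ, mul_one]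
  exact hQ x (𝒯.closure_cell_subset i (𝒯.face_subset_closure hσ hx))

/-- The constant in the bound for the perimeter of a control volume. -/
def perimeterConst (n : ℕ) : ℝ :=
  2 * (n + 1) * (volume : Measure (Sp n)).real (Metric.closedBall 0 1)

theorem perimeterConst_nonneg (n : ℕ) : 0 ≤ perimeterConst n := by
  have : 0 ≤ (volume : Measure (Sp n)).real (Metric.closedBall 0 1) := measureReal_nonneg
  unfold perimeterConst
  positivity

/-- Edge sums weighted by `h * mes(σ)` are turned into cell measures, without counting edges: the
perimeter of a convex cell is at most a constant times `h^n`, and `ζ₁ h^(n+1)` is at most its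
volume. -/
theorem Regular.size_mul_sum_mesEdge_le (hreg : 𝒯.Regular ζ₁ ζ₂) (hζ₁ : 0 < ζ₁)
    (hΩ : Bornology.IsBounded Ω) (i : ι) :
    𝒯.size * ∑ σ ∈ 𝒯.edges i, 𝒯.mesEdge σ ≤ perimeterConst n / ζ₁ * 𝒯.mesCell i := by
  have h1 := mul_le_mul_of_nonneg_left (𝒯.sum_mesEdge_le hΩ i) 𝒯.size_nonneg
  refine h1.trans ?_
  have h2 := mul_le_mul_of_nonneg_left (hreg.mes_cell i).1
    (div_nonneg (perimeterConst_nonneg n) hζ₁.le)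
  refine le_trans (le_of_eq ?_) h2
  unfold perimeterConst
  rw [pow_succ]
  field_simp

/-- The constant comes from `q_σ² / τ_σ = q_σ² * resist / mes(σ)`, which is at most `Q² (2/c₁) h
mes(σ)`, summed over the edges of a cell by the perimeter bound; the factor `2` counts both values
that upwinding may select. -/
theorem Regular.stable (hreg : 𝒯.Regular ζ₁ ζ₂) (hζ₁ : 0 < ζ₁) (hΩ : Bornology.IsBounded Ω)
    (htb : 𝒯.TensorBound M L) (hM : 0 < M) (hc₁ : 0 < c₁)
    (he : ∀ x ∈ Ω, ∀ ξ : Sp (n + 1), c₁ * ‖ξ‖ ^ 2 ≤ ⟪D x ξ, ξ⟫)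
    {q : Sp (n + 1) → Sp (n + 1)} (hq : IsVelocity Ω q) {Q : ℝ}
    (hQ : ∀ x ∈ closure Ω, ‖q x‖ ≤ Q) :
    𝒯.Stable q √(2 * (Q ^ 2 * (2 / c₁) * (perimeterConst n / ζ₁))) := by
  have hpos : ∀ i, ∀ σ ∈ 𝒯.edges i, 0 < 𝒯.mesEdge σ := fun i σ hσ => hreg.mesEdge_pos hζ₁ hΩ i hσ
  have hres : ∀ i, ∀ σ ∈ 𝒯.edges i, 0 < 𝒯.resist i σ := fun i σ hσ =>
    hreg.resist_pos hζ₁ hΩ htb hM hc₁ he hσ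
  have htau : ∀ i, ∀ σ ∈ 𝒯.edges i, 𝒯.tau i σ = 𝒯.mesEdge σ / 𝒯.resist i σ := fun i σ hσ =>
    tau_eq hΩ htb hc₁ he hσ (hreg.distSigma_pos hζ₁ hΩ hσ)
  have htpos : ∀ i, ∀ σ ∈ 𝒯.edges i, 0 < 𝒯.tau i σ := fun i σ hσ => by
    rw [htau i σ hσ]; exact div_pos (hpos i σ hσ) (hres i σ hσ)
  have hcons := conservative_flux hpos q
  refine ⟨htpos, hcons, sum_flux_eq_zero hΩ hq, fun z w => ?_⟩
  have hQc : 0 ≤ Q ^ 2 * (2 / c₁) := by positivity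
  have h1 := convForm_le (𝒯 := 𝒯) hcons htpos
    (m := fun σ => Q ^ 2 * (2 / c₁) * (𝒯.size * 𝒯.mesEdge σ))
    (C := Q ^ 2 * (2 / c₁) * (perimeterConst n / ζ₁)) ?_ ?_ z w
  · refine h1.trans (le_of_eq ?_)
    rw [Real.sqrt_mul, norm0]
    have := perimeterConst_nonneg n
    positivity
  · intro i σ hσ
    have hm := hpos i σ hσ
    rw [htau i σ hσ, div_div_eq_mul_div, div_le_iff₀ hm]
    have h2 : 𝒯.flux q i σ ^ 2 ≤ (Q * 𝒯.mesEdge σ) ^ 2 := by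
      rw [← sq_abs]
      exact pow_le_pow_left₀ (abs_nonneg _) (abs_flux_le hΩ hQ hσ) 2
    calc 𝒯.flux q i σ ^ 2 * 𝒯.resist i σ
        ≤ (Q * 𝒯.mesEdge σ) ^ 2 * (2 / c₁ * 𝒯.size) :=
          mul_le_mul h2 (resist_le hΩ htb hc₁ he hσ) (hres i σ hσ).le (sq_nonneg _)
      _ = _ := by ring
  · intro i
    rw [← Finset.mul_sum, ← Finset.mul_sum, mul_assoc _ (perimeterConst n / ζ₁)]
    exact mul_le_mul_of_nonneg_left (hreg.size_mul_sum_mesEdge_le hζ₁ hΩ i) hQc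

end Regularity

end AdmissibleMesh

/-! ### Integration by parts on a polytope -/

theorem IsPolytope.setIntegral_divergence_mul {n : ℕ} {ε : Type} {K : Set (Sp (n + 1))} {E : Finset ε}
    {F : ε → Set (Sp (n + 1))} {ν p : ε → Sp (n + 1)} (hK : IsPolytope K E F ν p)
    {f : Sp (n + 1) → Sp (n + 1)} {f' : Sp (n + 1) → Sp (n + 1) →L[ℝ] Sp (n + 1)}
    {φ : Sp (n + 1) → ℝ} {φ' : Sp (n + 1) → Sp (n + 1)}
    (hf : ContinuousOn f (closure K)) (hf' : ContinuousOn f' (closure K))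
    (hd : ∀ x ∈ K, HasFDerivAt f (f' x) x) (hφ : ContinuousOn φ (closure K))
    (hφ' : ContinuousOn φ' (closure K)) (hφd : ∀ x ∈ K, HasGradientAt φ (φ' x) x) :
    ∫ x in K, ((∑ k, f' x (EuclideanSpace.single k 1) k) * φ x + ⟪f x, φ' x⟫) =
      ∑ σ ∈ E, ∫ x in F σ, φ x * ⟪f x, ν σ⟫ ∂μHE[n] := by
  have h := hK.setIntegral_divergence (f := fun x => φ x • f x)
    (f' := fun x => φ x • f' x + ((InnerProductSpace.toDual ℝ _ (φ' x))).smulRight (f x))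
    (hφ.smul hf) ((hφ.smul hf').add ?_) fun x hx => (hφd x hx).hasFDerivAt.smul (hd x hx)
  · convert h using 1
    · refine integral_congr_ae (.of_forall fun x => ?_)
      simp only [add_apply, smul_apply,
        ContinuousLinearMap.smulRight_apply, PiLp.add_apply, PiLp.smul_apply, smul_eq_mul,
        Finset.sum_add_distrib, ← Finset.mul_sum, InnerProductSpace.toDual_apply_apply]
      rw [mul_comm, PiLp.inner_apply]
      refine congrArg _ (Finset.sum_congr rfl fun k _ => ?_)
      simp [EuclideanSpace.inner_single_right]
    · refine Finset.sum_congr rfl fun σ _ => integral_congr_ae (.of_forall fun x => ?_)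
      simp [real_inner_smul_left]
  · have : ContinuousOn (fun x => InnerProductSpace.toDual ℝ (Sp (n + 1)) (φ' x)) (closure K) :=
      (LinearIsometryEquiv.continuous _).comp_continuousOn hφ'
    exact ((ContinuousLinearMap.smulRightL ℝ (Sp (n+1)) (Sp (n+1))).continuous.comp_continuousOn
      this).clm_apply hf

/-! ### Approximation of point values by smooth weights -/

theorem exists_smooth_weight {d : ℕ} {U : Set (Sp d)} (hU : IsOpen U) {x : Sp d} (hx : x ∈ U) :
    ∃ φ : Sp d → ℝ, ContDiff ℝ ∞ φ ∧ HasCompactSupport φ ∧ tsupport φ ⊆ U ∧ (∀ y, 0 ≤ φ y) ∧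
      ∫ y, φ y = 1 := by
  obtain ⟨r, hr, hrU⟩ := Metric.isOpen_iff.1 hU x hx
  let b : ContDiffBump x := ⟨r / 4, r / 2, by positivity, by linarith⟩
  refine ⟨b.normed volume, b.contDiff_normed, b.hasCompactSupport_normed, ?_, b.nonneg_normed,
    b.integral_normed⟩
  rw [b.tsupport_normed_eq]
  exact (Metric.closedBall_subset_ball (by simp only [b]; linarith)).trans hrU

theorem abs_setIntegral_mul_sub_le {d : ℕ} {U V : Set (Sp d)} {u φ : Sp d → ℝ} {c η : ℝ}
    (hU : IsOpen U) (hUV : U ⊆ V) (hφ : Continuous φ) (hφc : HasCompactSupport φ)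
    (hφU : tsupport φ ⊆ U) (hφ0 : ∀ y, 0 ≤ φ y) (hφ1 : ∫ y, φ y = 1)
    (hu : ContinuousOn u U) (h : ∀ y ∈ U, |u y - c| ≤ η) :
    |(∫ y in V, u y * φ y) - c| ≤ η := by
  have hint : Integrable φ := hφ.integrable_of_hasCompactSupport hφc
  have hz : ∀ y, y ∉ U → φ y = 0 := fun y hy => by
    by_contra hne
    exact hy (hφU (subset_tsupport φ hne))
  have h1 : ∫ y in V, u y * φ y = ∫ y, u y * φ y :=
    setIntegral_eq_integral_of_forall_compl_eq_zero fun y hy => by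
      rw [hz y fun h => hy (hUV h), mul_zero]
  have hce : Continuous fun y => u y * φ y :=
    (hu.mul hφ.continuousOn).continuous_of_tsupport_subset hU
      ((tsupport_mul_subset_right).trans hφU)
  have h2 : Integrable fun y => u y * φ y :=
    hce.integrable_of_hasCompactSupport hφc.mul_left
  have h3 : (∫ y, u y * φ y) - c = ∫ y, (u y - c) * φ y := by
    simp only [sub_mul]
    rw [integral_sub h2 (hint.const_mul c), integral_const_mul, hφ1, mul_one]
  rw [h1, h3, ← Real.norm_eq_abs]
  refine (norm_integral_le_of_norm_le (hint.const_mul η) (.of_forall fun y => ?_)).trans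
    (by rw [integral_const_mul, hφ1, mul_one])
  by_cases hy : y ∈ U
  · rw [norm_mul, Real.norm_eq_abs, Real.norm_of_nonneg (hφ0 y)]
    exact mul_le_mul_of_nonneg_right (h y hy) (hφ0 y)
  · simp [hz y hy]

/-! ### The solution inside a control volume -/

/-- `X` is twice continuously differentiable in space, up to the boundary, with gradient `G` and
second derivative `H`. -/
structure IsSpaceC2 {d : ℕ} (Ω : Set (Sp d)) (T : ℝ) (X : ℝ → Sp d → ℝ) (G : ℝ → Sp d → Sp d)
    (H : ℝ → Sp d → Sp d →L[ℝ] Sp d) : Prop where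
  cont : ContinuousOn (fun p : ℝ × Sp d => X p.1 p.2) (Icc 0 T ×ˢ closure Ω)
  cont_grad : ContinuousOn (fun p : ℝ × Sp d => G p.1 p.2) (Icc 0 T ×ˢ closure Ω)
  cont_hess : ContinuousOn (fun p : ℝ × Sp d => H p.1 p.2) (Icc 0 T ×ˢ closure Ω)
  grad : ∀ t ∈ Icc 0 T, ∀ x ∈ Ω, HasGradientAt (X t) (G t x) x
  hess : ∀ t ∈ Icc 0 T, ∀ x ∈ Ω, HasFDerivAt (G t) (H t x) x

theorem continuousOn_slice {A B Y : Type*} [TopologicalSpace A] [TopologicalSpace B]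
    [TopologicalSpace Y] {f : A → B → Y} {S : Set A} {C : Set B}
    (hf : ContinuousOn (fun p : A × B => f p.1 p.2) (S ×ˢ C)) {t : A} (ht : t ∈ S) :
    ContinuousOn (f t) C :=
  hf.comp (f := fun x => (t, x)) (by fun_prop) fun _ hx => ⟨ht, hx⟩

theorem IsReaction.continuousOn {d : ℕ} {Ω : Set (Sp d)} {T : ℝ} {R : Sp d → ℝ → ℝ → ℝ}
    (hR : IsReaction Ω T R) {X : ℝ → Sp d → ℝ}
    (hX : ContinuousOn (fun p : ℝ × Sp d => X p.1 p.2) (Icc 0 T ×ˢ closure Ω)) :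
    ContinuousOn (fun p : ℝ × Sp d => R p.2 p.1 (X p.1 p.2)) (Icc 0 T ×ˢ closure Ω) := by
  obtain ⟨L, hL, hlip⟩ := hR.lip
  rintro ⟨t₀, x₀⟩ ⟨ht₀, hx₀⟩
  obtain ⟨K, hK⟩ := hR.lip_xt |X t₀ x₀|
  have hb : Filter.Tendsto (fun p : ℝ × Sp d => L * |X p.1 p.2 - X t₀ x₀| +
      K * (‖p.2 - x₀‖ + |p.1 - t₀|)) (nhdsWithin (t₀, x₀) (Icc 0 T ×ˢ closure Ω)) (nhds 0) := by
    have h1 : ContinuousWithinAt (fun p : ℝ × Sp d => L * |X p.1 p.2 - X t₀ x₀| +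
        K * (‖p.2 - x₀‖ + |p.1 - t₀|)) (Icc 0 T ×ˢ closure Ω) (t₀, x₀) :=
      (continuousWithinAt_const.mul ((hX _ ⟨ht₀, hx₀⟩).sub continuousWithinAt_const).abs).add
        (Continuous.continuousWithinAt (by fun_prop))
    have h2 := h1.tendsto
    simpa using h2
  refine tendsto_iff_norm_sub_tendsto_zero.2 (squeeze_zero' (.of_forall fun _ => norm_nonneg _)
    ?_ hb)
  filter_upwards [self_mem_nhdsWithin] with p hp
  have h1 := hlip p.2 hp.2 p.1 hp.1 (X p.1 p.2) (X t₀ x₀)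
  have h2 := hK p.2 hp.2 x₀ hx₀ p.1 hp.1 t₀ ht₀ (X t₀ x₀) le_rfl
  rw [Real.norm_eq_abs]
  exact (abs_sub_le _ (R p.2 p.1 (X t₀ x₀)) _).trans (add_le_add h1 h2)

/-- The derivative of `x ↦ g x (G t x)`. -/
def cellFluxDeriv {d : ℕ} (g : Sp d → Sp d →L[ℝ] Sp d) (g' : Sp d → Sp d →L[ℝ] Sp d →L[ℝ] Sp d)
    (G : ℝ → Sp d → Sp d) (H : ℝ → Sp d → Sp d →L[ℝ] Sp d) (t : ℝ) (x : Sp d) : Sp d →L[ℝ] Sp d :=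
  (g x).comp (H t x) + (g' x).flip (G t x)

/-- The value of `∂ₜX` that the equation prescribes inside a control volume. -/
def cellRate {d : ℕ} (g : Sp d → Sp d →L[ℝ] Sp d) (g' : Sp d → Sp d →L[ℝ] Sp d →L[ℝ] Sp d)
    (q : Sp d → Sp d) (R : Sp d → ℝ → ℝ → ℝ) (X : ℝ → Sp d → ℝ)
    (G : ℝ → Sp d → Sp d) (H : ℝ → Sp d → Sp d →L[ℝ] Sp d) (t : ℝ) (x : Sp d) : ℝ :=
  (∑ k, cellFluxDeriv g g' G H t x (EuclideanSpace.single k 1) k) - ⟪q x, G t x⟫ + R x t (X t x)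

section CellSolution

variable {d : ℕ} {Ω K : Set (Sp d)} {T M L : ℝ} {D g : Sp d → Sp d →L[ℝ] Sp d}
  {g' : Sp d → Sp d →L[ℝ] Sp d →L[ℝ] Sp d} {q : Sp d → Sp d} {R : Sp d → ℝ → ℝ → ℝ}
  {X : ℝ → Sp d → ℝ} {G : ℝ → Sp d → Sp d} {H : ℝ → Sp d → Sp d →L[ℝ] Sp d}

theorem IsSpaceC2.continuousOn_cellFluxDeriv (hS : IsSpaceC2 Ω T X G H) (hKΩ : K ⊆ Ω)
    (hg : IsCellTensor K D g g' M L) :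
    ContinuousOn (fun p : ℝ × Sp d => cellFluxDeriv g g' G H p.1 p.2) (Icc 0 T ×ˢ closure K) := by
  have hsub : Icc 0 T ×ˢ closure K ⊆ Icc 0 T ×ˢ closure Ω := prod_mono le_rfl (closure_mono hKΩ)
  have h1 : ContinuousOn (fun p : ℝ × Sp d => g p.2) (Icc 0 T ×ˢ closure K) :=
    hg.cont.comp continuousOn_snd fun p hp => hp.2
  have h2 : ContinuousOn (fun p : ℝ × Sp d => g' p.2) (Icc 0 T ×ˢ closure K) :=
    hg.cont'.comp continuousOn_snd fun p hp => hp.2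
  have h3 : ContinuousOn (fun p : ℝ × Sp d => (g' p.2).flip) (Icc 0 T ×ˢ closure K) :=
    (ContinuousLinearMap.flipₗᵢ ℝ (Sp d) (Sp d) (Sp d)).continuous.comp_continuousOn h2
  exact (h1.clm_comp (hS.cont_hess.mono hsub)).add (h3.clm_apply (hS.cont_grad.mono hsub))

theorem IsSpaceC2.continuousOn_cellRate (hS : IsSpaceC2 Ω T X G H) (hKΩ : K ⊆ Ω)
    (hg : IsCellTensor K D g g' M L) (hq : ContinuousOn q (closure Ω)) (hR : IsReaction Ω T R) :
    ContinuousOn (fun p : ℝ × Sp d => cellRate g g' q R X G H p.1 p.2) (Icc 0 T ×ˢ closure K) := by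
  have hsub : Icc 0 T ×ˢ closure K ⊆ Icc 0 T ×ˢ closure Ω := prod_mono le_rfl (closure_mono hKΩ)
  have h1 : ContinuousOn (fun p : ℝ × Sp d => q p.2) (Icc 0 T ×ˢ closure K) :=
    hq.comp continuousOn_snd fun p hp => closure_mono hKΩ hp.2
  refine (ContinuousOn.sub (continuousOn_finsetSum _ fun k _ => ?_)
    (h1.inner (𝕜 := ℝ) (hS.cont_grad.mono hsub))).add ((hR.continuousOn hS.cont).mono hsub)
  exact (EuclideanSpace.proj (𝕜 := ℝ) k).continuous.comp_continuousOn
    ((hS.continuousOn_cellFluxDeriv hKΩ hg).clm_apply continuousOn_const)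

theorem IsSpaceC2.hasFDerivAt_cellFlux (hS : IsSpaceC2 Ω T X G H) (hKΩ : K ⊆ Ω)
    (hg : IsCellTensor K D g g' M L) {t : ℝ} (ht : t ∈ Icc 0 T) {x : Sp d} (hx : x ∈ K) :
    HasFDerivAt (fun y => g y (G t y)) (cellFluxDeriv g g' G H t x) x :=
  (hg.deriv x hx).clm_apply (hS.hess t ht x (hKΩ hx))

end CellSolution

section PolytopeSolution

variable {n : ℕ} {ε : Type} {Ω K : Set (Sp (n + 1))} {E : Finset ε} {F : ε → Set (Sp (n + 1))}
  {ν p : ε → Sp (n + 1)} {T M L : ℝ} {D g : Sp (n + 1) → Sp (n + 1) →L[ℝ] Sp (n + 1)}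
  {g' : Sp (n + 1) → Sp (n + 1) →L[ℝ] Sp (n + 1) →L[ℝ] Sp (n + 1)}
  {q : Sp (n + 1) → Sp (n + 1)} {R : Sp (n + 1) → ℝ → ℝ → ℝ}
  {X : ℝ → Sp (n + 1) → ℝ} {X₀ : Sp (n + 1) → ℝ} {G : ℝ → Sp (n + 1) → Sp (n + 1)}
  {H : ℝ → Sp (n + 1) → Sp (n + 1) →L[ℝ] Sp (n + 1)}

theorem IsSpaceC2.continuousOn_cellFlux (hS : IsSpaceC2 Ω T X G H) (hKΩ : K ⊆ Ω)
    (hg : IsCellTensor K D g g' M L) {t : ℝ} (ht : t ∈ Icc 0 T) :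
    ContinuousOn (fun y => g y (G t y)) (closure K) :=
  hg.cont.clm_apply ((continuousOn_slice hS.cont_grad ht).mono (closure_mono hKΩ))

/-- The weak form of the equation, integrated by parts on a single control volume. -/
theorem IsSpaceC2.setIntegral_weak (hS : IsSpaceC2 Ω T X G H) (hK : IsPolytope K E F ν p)
    (hKΩ : K ⊆ Ω) (hg : IsCellTensor K D g g' M L) (hq : ContinuousOn q (closure Ω))
    (hR : IsReaction Ω T R) {φ : Sp (n + 1) → ℝ} (hφ : ContDiff ℝ ∞ φ) {t : ℝ} (ht : t ∈ Icc 0 T) :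
    IntegrableOn (fun x => R x t (X t x) * φ x - ⟪D x (gradient (X t) x), gradient φ x⟫
          - ⟪q x, gradient (X t) x⟫ * φ x) K ∧
    ∫ x in K, (R x t (X t x) * φ x - ⟪D x (gradient (X t) x), gradient φ x⟫
          - ⟪q x, gradient (X t) x⟫ * φ x) =
      (∫ x in K, cellRate g g' q R X G H t x * φ x) -
        ∑ σ ∈ E, ∫ x in F σ, φ x * ⟪g x (G t x), ν σ⟫ ∂μHE[n] := by
  have hφd : Differentiable ℝ φ := hφ.differentiable (by simp)
  have hφ' : Continuous (gradient φ) := by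
    have : Continuous (fderiv ℝ φ) := hφ.continuous_fderiv (by simp)
    exact (InnerProductSpace.toDual ℝ (Sp (n + 1))).symm.continuous.comp this
  have hJ := hS.continuousOn_cellFlux hKΩ hg ht
  have hJ' := continuousOn_slice (hS.continuousOn_cellFluxDeriv hKΩ hg) ht
  have hZ := continuousOn_slice (hS.continuousOn_cellRate hKΩ hg hq hR) ht
  have hibp := hK.setIntegral_divergence_mul hJ hJ'
    (fun x hx => hS.hasFDerivAt_cellFlux hKΩ hg ht hx) hφ.continuous.continuousOn
    hφ'.continuousOn fun x _ => (hφd x).hasGradientAt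
  have hi1 : IntegrableOn (fun x => cellRate g g' q R X G H t x * φ x) K :=
    ((hZ.mul hφ.continuous.continuousOn).integrableOn_compact hK.isCompact_closure).mono_set
      subset_closure
  have hi2 : IntegrableOn (fun x => (∑ k, cellFluxDeriv g g' G H t x (EuclideanSpace.single k 1) k)
      * φ x + ⟪g x (G t x), gradient φ x⟫) K := by
    refine (ContinuousOn.integrableOn_compact hK.isCompact_closure ?_).mono_set subset_closure
    refine ((continuousOn_finsetSum _ fun k _ => ?_).mul hφ.continuous.continuousOn).add
      (hJ.inner (𝕜 := ℝ) hφ'.continuousOn)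
    exact (EuclideanSpace.proj (𝕜 := ℝ) k).continuous.comp_continuousOn
      (hJ'.clm_apply continuousOn_const)
  have heq : EqOn (fun x => R x t (X t x) * φ x - ⟪D x (gradient (X t) x), gradient φ x⟫
          - ⟪q x, gradient (X t) x⟫ * φ x)
      (fun x => cellRate g g' q R X G H t x * φ x -
        ((∑ k, cellFluxDeriv g g' G H t x (EuclideanSpace.single k 1) k) * φ x +
          ⟪g x (G t x), gradient φ x⟫)) K := by
    intro x hx
    simp only [(hS.grad t ht x (hKΩ hx)).gradient, hg.eqOn hx, cellRate]
    ring
  refine ⟨(hi1.sub hi2).congr_fun heq.symm hK.isOpen.measurableSet, ?_⟩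
  rw [setIntegral_congr_fun hK.isOpen.measurableSet heq, integral_sub hi1 hi2, hibp]

end PolytopeSolution

/-! ### The time derivative of the solution -/

section TimeDerivative

variable {n : ℕ} {ε : Type} {Ω K : Set (Sp (n + 1))} {E : Finset ε} {F : ε → Set (Sp (n + 1))}
  {ν p : ε → Sp (n + 1)} {T M L : ℝ} {D g : Sp (n + 1) → Sp (n + 1) →L[ℝ] Sp (n + 1)}
  {g' : Sp (n + 1) → Sp (n + 1) →L[ℝ] Sp (n + 1) →L[ℝ] Sp (n + 1)}
  {q : Sp (n + 1) → Sp (n + 1)} {R : Sp (n + 1) → ℝ → ℝ → ℝ}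
  {X : ℝ → Sp (n + 1) → ℝ} {X₀ : Sp (n + 1) → ℝ} {G : ℝ → Sp (n + 1) → Sp (n + 1)}
  {H : ℝ → Sp (n + 1) → Sp (n + 1) →L[ℝ] Sp (n + 1)}

/-- A test function supported in one control volume vanishes on its faces, so integration by parts
leaves no boundary term and the derivative falls on the smooth extension of `D`. -/
theorem IsClassicalSolution.hasDerivWithinAt_integral (hX : IsClassicalSolution Ω T D q R X₀ X)
    (hS : IsSpaceC2 Ω T X G H) (hK : IsPolytope K E F ν p) (hΩ : IsOpen Ω)
    (hKΩ : K ⊆ Ω) (hg : IsCellTensor K D g g' M L) (hq : ContinuousOn q (closure Ω))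
    (hR : IsReaction Ω T R) {φ : Sp (n + 1) → ℝ} (hφ : ContDiff ℝ ∞ φ)
    (hφc : HasCompactSupport φ) (hφK : tsupport φ ⊆ K) {t : ℝ} (ht : t ∈ Icc 0 T) :
    HasDerivWithinAt (fun s => ∫ x in Ω, X s x * φ x)
      (∫ x in K, cellRate g g' q R X G H t x * φ x) (Icc 0 T) t := by
  have h1 := hX.equation φ hφ hφc (hφK.trans hKΩ) t ht
  have hz : ∀ x, x ∉ K → φ x = 0 := fun x hx => by
    by_contra hne
    exact hx (hφK (subset_tsupport φ hne))
  have hz' : ∀ x, x ∉ K → gradient φ x = 0 := fun x hx => by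
    have : fderiv ℝ φ x = 0 := by
      by_contra hne
      exact hx (hφK (support_fderiv_subset ℝ hne))
    simp [gradient, this]
  have h2 := (hS.setIntegral_weak hK hKΩ hg hq hR hφ ht).2
  have h3 : ∑ σ ∈ E, ∫ x in F σ, φ x * ⟪g x (G t x), ν σ⟫ ∂μHE[n] = 0 := by
    refine Finset.sum_eq_zero fun σ hσ => setIntegral_eq_zero_of_forall_eq_zero fun x hx => ?_
    have h4 := hK.face_subset_frontier hσ hx
    rw [hK.isOpen.frontier_eq] at h4
    rw [hz x h4.2, zero_mul]
  rw [h3, sub_zero] at h2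
  rw [← h2]
  convert h1 using 1
  refine (setIntegral_eq_of_subset_of_forall_sdiff_eq_zero hΩ.measurableSet hKΩ fun x hx => ?_).symm
  simp [hz x hx.2, hz' x hx.2]

/-- Inside a control volume the equation holds pointwise. -/
theorem IsClassicalSolution.hasDerivWithinAt (hX : IsClassicalSolution Ω T D q R X₀ X)
    (hS : IsSpaceC2 Ω T X G H) (hK : IsPolytope K E F ν p) (hΩ : IsOpen Ω)
    (hKΩ : K ⊆ Ω) (hg : IsCellTensor K D g g' M L) (hq : ContinuousOn q (closure Ω))
    (hR : IsReaction Ω T R) {s : ℝ} (hs : s ∈ Icc 0 T) {x : Sp (n + 1)} (hx : x ∈ K) :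
    HasDerivWithinAt (fun t => X t x) (cellRate g g' q R X G H s x) (Icc 0 T) s := by
  set Z := cellRate g g' q R X G H with hZdef
  have hZ : ContinuousOn (fun p : ℝ × Sp (n + 1) => Z p.1 p.2) (Icc 0 T ×ˢ closure K) :=
    hS.continuousOn_cellRate hKΩ hg hq hR
  rw [hasDerivWithinAt_iff_isLittleO, Asymptotics.isLittleO_iff]
  intro η hη
  obtain ⟨δ, hδ, hball⟩ := Metric.continuousOn_iff.1 hZ (s, x) ⟨hs, subset_closure hx⟩ η hη
  have hev : ∀ᶠ t in nhdsWithin s (Icc 0 T), t ∈ Icc 0 T ∩ Metric.ball s δ :=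
    (Filter.Eventually.and self_mem_nhdsWithin
      (mem_nhdsWithin_of_mem_nhds (Metric.ball_mem_nhds s hδ)))
  filter_upwards [hev] with t ht
  rw [Real.norm_eq_abs, Real.norm_eq_abs, smul_eq_mul]
  -- For fixed `t`, point values at `x` are replaced by averages against a weight concentrated near
  -- `x`, at a cost `κ` that may be arbitrarily small. The weight depends on `t` and `κ`, but the
  -- bound `η |t - s|` for the averages does not.
  refine le_of_forall_pos_le_add fun κ hκ => ?_
  have hu : ContinuousOn (fun y => X t y - X s y) K :=
    ((continuousOn_slice hS.cont ht.1).sub (continuousOn_slice hS.cont hs)).mono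
      (hKΩ.trans subset_closure)
  obtain ⟨δ₂, hδ₂, hball₂⟩ := Metric.continuousOn_iff.1 hu x hx κ hκ
  set U := K ∩ Metric.ball x (min δ δ₂) with hU
  have hUo : IsOpen U := hK.isOpen.inter Metric.isOpen_ball
  have hxU : x ∈ U := ⟨hx, Metric.mem_ball_self (lt_min hδ hδ₂)⟩
  obtain ⟨φ, hφ, hφc, hφU, hφ0, hφ1⟩ := exists_smooth_weight hUo hxU
  have hUK : U ⊆ K := inter_subset_left
  have hint : ∀ r ∈ Icc 0 T, IntegrableOn (fun y => X r y * φ y) Ω := fun r hr => by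
    have hce : Continuous fun y => X r y * φ y :=
      (((continuousOn_slice hS.cont hr).mono (hUK.trans (hKΩ.trans subset_closure))).mul
        hφ.continuous.continuousOn).continuous_of_tsupport_subset hUo
        ((tsupport_mul_subset_right).trans hφU)
    exact (hce.integrable_of_hasCompactSupport hφc.mul_left).integrableOn
  have h1 : |((∫ y in Ω, X t y * φ y) - t * Z s x) - ((∫ y in Ω, X s y * φ y) - s * Z s x)|
      ≤ η * |t - s| := by
    have := Convex.norm_image_sub_le_of_norm_hasDerivWithin_le (𝕜 := ℝ) (C := η)
      (f := fun r => (∫ y in Ω, X r y * φ y) - r * Z s x)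
      (f' := fun r => (∫ y in K, Z r y * φ y) - 1 * Z s x) (s := Icc 0 T ∩ Metric.ball s δ)
      (fun r hr => ((hX.hasDerivWithinAt_integral hS hK hΩ hKΩ hg hq hR hφ hφc (hφU.trans hUK)
        hr.1).mono inter_subset_left).sub ((hasDerivWithinAt_id _ _).mul_const _)) ?_
      ((convex_Icc _ _).inter (convex_ball _ _)) (x := s) (y := t) ⟨hs, Metric.mem_ball_self hδ⟩ ht
    · simpa only [Real.norm_eq_abs] using this
    · intro r hr
      rw [Real.norm_eq_abs, one_mul]
      refine abs_setIntegral_mul_sub_le hUo hUK hφ.continuous hφc hφU hφ0 hφ1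
        ((continuousOn_slice hZ hr.1).mono (hUK.trans subset_closure)) fun y hy => ?_
      have := hball (r, y) ⟨hr.1, subset_closure hy.1⟩ (by
        rw [Prod.dist_eq]
        exact max_lt hr.2 (lt_of_lt_of_le hy.2 (min_le_left _ _)))
      rw [Real.dist_eq] at this
      exact this.le
  have h2 : |(∫ y in Ω, (X t y - X s y) * φ y) - (X t x - X s x)| ≤ κ := by
    refine abs_setIntegral_mul_sub_le hUo (hUK.trans hKΩ) hφ.continuous hφc hφU hφ0 hφ1
      (hu.mono hUK) fun y hy => ?_
    have := hball₂ y hy.1 (lt_of_lt_of_le hy.2 (min_le_right _ _))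
    rw [Real.dist_eq] at this
    exact this.le
  have h3 : ∫ y in Ω, (X t y - X s y) * φ y =
      (∫ y in Ω, X t y * φ y) - ∫ y in Ω, X s y * φ y := by
    rw [← integral_sub (hint t ht.1) (hint s hs)]
    simp only [sub_mul]
  rw [h3] at h2
  rw [abs_le] at h1 h2 ⊢
  constructor <;> linarith [h1.1, h1.2, h2.1, h2.2]

/-- Differentiation under the integral over a control volume. -/
theorem IsClassicalSolution.hasDerivAt_setIntegral (hX : IsClassicalSolution Ω T D q R X₀ X)
    (hS : IsSpaceC2 Ω T X G H) (hK : IsPolytope K E F ν p) (hΩ : IsOpen Ω)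
    (hKΩ : K ⊆ Ω) (hg : IsCellTensor K D g g' M L) (hq : ContinuousOn q (closure Ω))
    (hR : IsReaction Ω T R) {φ : Sp (n + 1) → ℝ} (hφ : Continuous φ) {t : ℝ} (ht : t ∈ Ioo 0 T) :
    HasDerivAt (fun s => ∫ x in K, X s x * φ x)
      (∫ x in K, cellRate g g' q R X G H t x * φ x) t := by
  have hZ := hS.continuousOn_cellRate hKΩ hg hq hR
  have hc : IsCompact (Icc 0 T ×ˢ closure K) := isCompact_Icc.prod hK.isCompact_closure
  obtain ⟨B, hB⟩ := hc.exists_bound_of_continuousOn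
    (hZ.mul (hφ.comp continuous_snd).continuousOn)
  have hfin : IsFiniteMeasure (volume.restrict K) := ⟨by
    rw [Measure.restrict_apply_univ]; exact hK.bounded.measure_lt_top⟩
  have hint : ∀ {u : Sp (n + 1) → ℝ}, ContinuousOn u (closure K) →
      IntegrableOn (fun x => u x * φ x) K := fun hu =>
    ((hu.mul hφ.continuousOn).integrableOn_compact hK.isCompact_closure).mono_set subset_closure
  have hXs : ∀ s ∈ Icc 0 T, IntegrableOn (fun x => X s x * φ x) K := fun s hs =>
    hint ((continuousOn_slice hS.cont hs).mono (closure_mono hKΩ))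
  refine (hasDerivAt_integral_of_dominated_loc_of_deriv_le (μ := volume.restrict K)
    (F := fun s x => X s x * φ x) (bound := fun _ => B)
    (F' := fun s x => cellRate g g' q R X G H s x * φ x) (Ioo_mem_nhds ht.1 ht.2)
    ?_ (hXs t (Ioo_subset_Icc_self ht)) ?_ ?_ (integrable_const _) ?_).2
  · filter_upwards [Ioo_mem_nhds ht.1 ht.2] with s hs
    exact (hXs s (Ioo_subset_Icc_self hs)).aestronglyMeasurable
  · exact (hint (continuousOn_slice hZ (Ioo_subset_Icc_self ht))).aestronglyMeasurable
  · refine (ae_restrict_iff' hK.isOpen.measurableSet).2 (.of_forall fun x hx s hs => ?_)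
    exact hB (s, x) ⟨Ioo_subset_Icc_self hs, subset_closure hx⟩
  · refine (ae_restrict_iff' hK.isOpen.measurableSet).2 (.of_forall fun x hx s hs => ?_)
    exact ((hX.hasDerivWithinAt hS hK hΩ hKΩ hg hq hR (Ioo_subset_Icc_self hs) hx).hasDerivAt
      (Icc_mem_nhds hs.1 hs.2)).mul_const _

end TimeDerivative

/-! ### Regularity of the solution in time -/

/-- Interpolation: a small function with a moderate second derivative has a small gradient. -/
theorem exists_gradient_interpolation {d : ℕ} {K : Set (Sp d)} (hK : Convex ℝ K) (hKo : IsOpen K)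
    (hKn : K.Nonempty) (hKb : Bornology.IsBounded K) {T : ℝ} (hT : 0 < T) :
    ∃ C, 0 ≤ C ∧ ∀ (f : Sp d → ℝ) (G : Sp d → Sp d) (B N τ : ℝ), 0 ≤ B → 0 ≤ N → 0 < τ → τ ≤ T →
      (∀ x ∈ K, |f x| ≤ B * τ) →
      (∀ x ∈ K, ∀ y ∈ K, |f y - f x - ⟪G x, y - x⟫| ≤ N * ‖y - x‖ ^ 2) →
      ∀ x ∈ K, ‖G x‖ ≤ C * (B + N) * √τ := by
  obtain ⟨z, hz⟩ := hKn
  obtain ⟨r, hr, hrK⟩ := Metric.isOpen_iff.1 hKo z hz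
  set δ := Metric.diam K
  have hδ : 0 ≤ δ := Metric.diam_nonneg
  have hsT : 0 < √T := Real.sqrt_pos.2 hT
  -- Taylor's formula is compared at two points that differ by `lm • e`, with `e` of length `r/2`
  -- along `G x`. This gives `lm (r/2) ‖G x‖ ≤ 2Bτ + 2N (lm δ)²`, and the choice `lm = √τ/√T`
  -- balances the two terms. Contracting toward `x` keeps both points in `K` even when `x` is close
  -- to its boundary.
  refine ⟨4 / r * (√T + δ ^ 2 / √T), by positivity, ?_⟩
  intro f G B N τ hB hN hτ hτT hf hfG x hx
  have hsτ : 0 < √τ := Real.sqrt_pos.2 hτ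
  set lm := √τ / √T with hlm
  have hlm0 : 0 < lm := div_pos hsτ hsT
  have hlm1 : lm ≤ 1 := (div_le_one hsT).2 (Real.sqrt_le_sqrt hτT)
  by_cases hG : G x = 0
  · rw [hG, norm_zero]; positivity
  have hGn : 0 < ‖G x‖ := norm_pos_iff.2 hG
  set e := (r / 2 / ‖G x‖) • G x with he
  have hen : ‖e‖ = r / 2 := by
    rw [he, norm_smul, Real.norm_of_nonneg (by positivity)]; field_simp
  have hzK : z + e ∈ K := hrK (by rw [mem_ball_iff_norm, add_sub_cancel_left, hen]; linarith)
  have hy : ∀ w ∈ K, x + lm • (w - x) ∈ K ∧ ‖(x + lm • (w - x)) - x‖ ≤ lm * δ := by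
    intro w hw
    refine ⟨hK.add_smul_sub_mem hx hw ⟨hlm0.le, hlm1⟩, ?_⟩
    rw [add_sub_cancel_left, norm_smul, Real.norm_of_nonneg hlm0.le]
    refine mul_le_mul_of_nonneg_left ?_ hlm0.le
    rw [← dist_eq_norm]
    exact Metric.dist_le_diam_of_mem hKb hw hx
  have hT' : ∀ w ∈ K, |f (x + lm • (w - x)) - f x - lm * ⟪G x, w - x⟫| ≤ N * (lm * δ) ^ 2 := by
    intro w hw
    have h1 := hfG x hx _ (hy w hw).1
    have h2 : ⟪G x, (x + lm • (w - x)) - x⟫ = lm * ⟪G x, w - x⟫ := by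
      rw [add_sub_cancel_left, real_inner_smul_right]
    rw [h2] at h1
    exact h1.trans (mul_le_mul_of_nonneg_left
      (pow_le_pow_left₀ (norm_nonneg _) (hy w hw).2 2) hN)
  have h1 := hT' z hz
  have h2 := hT' (z + e) hzK
  have h3 := hf _ (hy z hz).1
  have h4 := hf _ (hy _ hzK).1
  have h5 : ⟪G x, z + e - x⟫ = ⟪G x, z - x⟫ + r / 2 * ‖G x‖ := by
    rw [add_sub_right_comm, inner_add_right, he, real_inner_smul_right, real_inner_self_eq_norm_sq]
    field_simp
  rw [h5] at h2
  have h6 : lm * (r / 2 * ‖G x‖) ≤ 2 * (B * τ) + 2 * (N * (lm * δ) ^ 2) := by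
    rw [abs_le] at h1 h2 h3 h4
    linarith [h1.1, h1.2, h2.1, h2.2, h3.1, h3.2, h4.1, h4.2]
  have hττ : τ = lm * (√T * √τ) := by
    rw [hlm]
    field_simp
    rw [Real.sq_sqrt hτ.le]
  have h7 : lm * ‖G x‖ ≤ lm * (4 / r * (B * √T + N * (δ ^ 2 / √T)) * √τ) := by
    have h8 : lm * ‖G x‖ ≤ 2 / r * (2 * (B * τ) + 2 * (N * (lm * δ) ^ 2)) := by
      have := mul_le_mul_of_nonneg_left h6 (by positivity : 0 ≤ 2 / r)
      refine le_trans (le_of_eq ?_) this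
      field_simp
    refine h8.trans (le_of_eq ?_)
    have h9 : (lm * δ) ^ 2 = lm * (δ ^ 2 / √T * √τ) := by rw [hlm]; field_simp
    rw [h9]
    nth_rw 1 [hττ]
    ring
  refine (le_of_mul_le_mul_left h7 hlm0).trans ?_
  refine mul_le_mul_of_nonneg_right ?_ hsτ.le
  rw [mul_assoc]
  refine mul_le_mul_of_nonneg_left ?_ (by positivity)
  have hδT : 0 ≤ δ ^ 2 / √T := by positivity
  nlinarith [mul_nonneg hB hδT, mul_nonneg hN hsT.le]

namespace AdmissibleMesh

variable {n : ℕ} {Ω : Set (Sp (n + 1))} {D : Sp (n + 1) → Sp (n + 1) →L[ℝ] Sp (n + 1)}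
  {ι ε : Type} [Fintype ι] {𝒯 : AdmissibleMesh Ω D ι ε} {T M L : ℝ}
  {q : Sp (n + 1) → Sp (n + 1)} {R : Sp (n + 1) → ℝ → ℝ → ℝ}
  {X : ℝ → Sp (n + 1) → ℝ} {X₀ : Sp (n + 1) → ℝ} {G : ℝ → Sp (n + 1) → Sp (n + 1)}
  {H : ℝ → Sp (n + 1) → Sp (n + 1) →L[ℝ] Sp (n + 1)}

/-- In each cell the equation identifies `∂ₜX` with `cellRate`, which is continuous up to the
boundary of the cell and hence bounded. Density of the cells extends the bound to `closure Ω`,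
although the rates of neighbouring cells need not match. -/
theorem exists_time_lipschitz (htb : 𝒯.TensorBound M L) (hΩb : Bornology.IsBounded Ω)
    (hX : IsClassicalSolution Ω T D q R X₀ X)
    (hS : IsSpaceC2 Ω T X G H) (hΩ : IsOpen Ω) (hq : ContinuousOn q (closure Ω))
    (hR : IsReaction Ω T R) :
    ∃ B, 0 ≤ B ∧ ∀ s ∈ Icc 0 T, ∀ t ∈ Icc 0 T, ∀ x ∈ closure Ω, |X t x - X s x| ≤ B * |t - s| := by
  have hcell : ∀ i, ∃ B, ∀ s ∈ Icc 0 T, ∀ t ∈ Icc 0 T, ∀ x ∈ 𝒯.cell i,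
      |X t x - X s x| ≤ B * |t - s| := by
    intro i
    obtain ⟨g, g', hg⟩ := htb i
    have hK := isPolytope (𝒯 := 𝒯) hΩb i
    obtain ⟨B, hB⟩ := (isCompact_Icc.prod hK.isCompact_closure).exists_bound_of_continuousOn
      (hS.continuousOn_cellRate (𝒯.cell_subset i) hg hq hR)
    refine ⟨B, fun s hs t ht x hx => ?_⟩
    exact Convex.norm_image_sub_le_of_norm_hasDerivWithin_le (𝕜 := ℝ) (f := fun t => X t x)
      (fun r hr => hX.hasDerivWithinAt hS hK hΩ (𝒯.cell_subset i) hg hq hR hr hx)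
      (fun r hr => hB (r, x) ⟨hr, subset_closure hx⟩) (convex_Icc 0 T) hs ht
  choose B hB using hcell
  refine ⟨∑ i, |B i|, Finset.sum_nonneg fun i _ => abs_nonneg _, fun s hs t ht => ?_⟩
  refine le_on_closure (S := ⋃ i, 𝒯.cell i)
    ((continuousOn_slice hS.cont ht).sub (continuousOn_slice hS.cont hs)).abs
    ((iUnion_subset 𝒯.cell_subset).trans subset_closure) 𝒯.dense_cells.le fun x hx => ?_
  obtain ⟨i, hi⟩ := mem_iUnion.1 hx
  refine (hB i s hs t ht x hi).trans (mul_le_mul_of_nonneg_right ?_ (abs_nonneg _))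
  exact (le_abs_self _).trans
    (Finset.single_le_sum (f := fun i => |B i|) (fun i _ => abs_nonneg _) (Finset.mem_univ i))

/-- Interpolation is applied to `X t - X s`, which is at most `B |t - s|` and has second derivative
at most `2N`. It is done on each convex cell of one mesh, as `Ω` itself has no regularity. -/
theorem exists_gradient_holder (𝒯 : AdmissibleMesh Ω D ι ε) (hΩb : Bornology.IsBounded Ω)
    (hT : 0 < T) (hS : IsSpaceC2 Ω T X G H) {B N : ℝ} (hB0 : 0 ≤ B) (hN0 : 0 ≤ N)
    (hB : ∀ s ∈ Icc 0 T, ∀ t ∈ Icc 0 T, ∀ x ∈ closure Ω, |X t x - X s x| ≤ B * |t - s|)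
    (hN : ∀ t ∈ Icc 0 T, ∀ x ∈ closure Ω, ‖H t x‖ ≤ N) :
    ∃ C, 0 ≤ C ∧ ∀ s ∈ Icc 0 T, ∀ t ∈ Icc 0 T, ∀ x ∈ closure Ω,
      ‖G t x - G s x‖ ≤ C * √|t - s| := by
  have hcell : ∀ i, ∃ C, 0 ≤ C ∧ ∀ s ∈ Icc 0 T, ∀ t ∈ Icc 0 T, ∀ x ∈ 𝒯.cell i,
      ‖G t x - G s x‖ ≤ C * √|t - s| := by
    intro i
    obtain ⟨C, hC0, hC⟩ := exists_gradient_interpolation (𝒯.cell_convex i) (𝒯.cell_open i)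
      (𝒯.cell_nonempty i) (𝒯.cell_bounded hΩb i) hT
    refine ⟨C * (B + 2 * N), by positivity, fun s hs t ht x hx => ?_⟩
    rcases eq_or_ne t s with rfl | hts
    · simp
    have hsub := 𝒯.cell_subset i
    have htay : ∀ r ∈ Icc 0 T, ∀ x ∈ 𝒯.cell i, ∀ y ∈ 𝒯.cell i,
        |X r y - X r x - ⟪G r x, y - x⟫| ≤ N * ‖y - x‖ ^ 2 := fun r hr x hx y hy =>
      abs_taylor_le_of_convex_closure (𝒯.cell_convex i)
        ((continuousOn_slice hS.cont hr).mono (𝒯.closure_cell_subset i))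
        ((continuousOn_slice hS.cont_grad hr).mono (𝒯.closure_cell_subset i))
        (fun z hz => hS.grad r hr z (hsub hz)) (fun z hz => hS.hess r hr z (hsub hz))
        (fun z hz => hN r hr z (subset_closure (hsub hz))) (subset_closure hx) (subset_closure hy)
    refine hC (fun y => X t y - X s y) (fun y => G t y - G s y) B (2 * N) |t - s| hB0 (by positivity)
      (abs_pos.2 (sub_ne_zero.2 hts)) ?_ (fun y hy => hB s hs t ht y (subset_closure (hsub hy)))
      ?_ x hx
    · rw [abs_le]; constructor <;> linarith [hs.1, hs.2, ht.1, ht.2]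
    · intro a ha b hb
      have h1 := htay t ht a ha b hb
      have h2 := htay s hs a ha b hb
      rw [inner_sub_left]
      rw [abs_le] at h1 h2 ⊢
      constructor <;> linarith [h1.1, h1.2, h2.1, h2.2]
  choose C hC0 hC using hcell
  refine ⟨∑ i, C i, Finset.sum_nonneg fun i _ => hC0 i, fun s hs t ht => ?_⟩
  refine le_on_closure (S := ⋃ i, 𝒯.cell i)
    ((continuousOn_slice hS.cont_grad ht).sub (continuousOn_slice hS.cont_grad hs)).norm
    ((iUnion_subset 𝒯.cell_subset).trans subset_closure) 𝒯.dense_cells.le fun x hx => ?_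
  obtain ⟨i, hi⟩ := mem_iUnion.1 hx
  refine (hC i s hs t ht x hi).trans (mul_le_mul_of_nonneg_right ?_ (Real.sqrt_nonneg _))
  exact Finset.single_le_sum (fun i _ => hC0 i) (Finset.mem_univ i)

/-! ### Conservation of the diffusive flux -/

/-- The diffusive flux of the solution through an edge, seen from the control volume `i`. -/
def exactFlux (𝒯 : AdmissibleMesh Ω D ι ε) (g : ι → Sp (n + 1) → Sp (n + 1) →L[ℝ] Sp (n + 1))
    (V : Sp (n + 1) → Sp (n + 1)) (i : ι) (σ : ε) : ℝ :=
  ∫ x in 𝒯.face σ, ⟪g i x (V x), 𝒯.normal i σ⟫ ∂μHE[n]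

variable {g : ι → Sp (n + 1) → Sp (n + 1) →L[ℝ] Sp (n + 1)}
  {g' : ι → Sp (n + 1) → Sp (n + 1) →L[ℝ] Sp (n + 1) →L[ℝ] Sp (n + 1)}

/-- The derivative of `∫ X φ` is computed twice: from the weak equation integrated by parts in each
cell, and from the pointwise equation in the cells. The two results differ exactly by the face
integrals. -/
theorem sum_face_integral_eq_zero (hΩb : Bornology.IsBounded Ω)
    (hg : ∀ i, IsCellTensor (𝒯.cell i) D (g i) (g' i) M L)
    (hX : IsClassicalSolution Ω T D q R X₀ X)
    (hS : IsSpaceC2 Ω T X G H) (hΩ : IsOpen Ω) (hq : ContinuousOn q (closure Ω))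
    (hR : IsReaction Ω T R) {t : ℝ} (ht : t ∈ Ioo 0 T) {φ : Sp (n + 1) → ℝ} (hφ : ContDiff ℝ ∞ φ)
    (hφc : HasCompactSupport φ) (hφΩ : tsupport φ ⊆ Ω) :
    ∑ i, ∑ σ ∈ 𝒯.edges i, ∫ x in 𝒯.face σ, φ x * ⟪g i x (G t x), 𝒯.normal i σ⟫ ∂μHE[n] = 0 := by
  have htI := Ioo_subset_Icc_self ht
  have hK := fun i => isPolytope (𝒯 := 𝒯) hΩb i
  have hw := fun i => hS.setIntegral_weak (hK i) (𝒯.cell_subset i) (hg i) hq hR hφ htI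
  have h1 := (hX.equation φ hφ hφc hφΩ t htI).hasDerivAt (Icc_mem_nhds ht.1 ht.2)
  rw [𝒯.setIntegral_eq_sum fun i => (hw i).1, Finset.sum_congr rfl fun i _ => (hw i).2,
    Finset.sum_sub_distrib] at h1
  have h2 : HasDerivAt (fun s => ∫ x in Ω, X s x * φ x)
      (∑ i, ∫ x in 𝒯.cell i, cellRate (g i) (g' i) q R X G H t x * φ x) t := by
    have h3 := HasDerivAt.fun_sum (u := Finset.univ) fun i _ => hX.hasDerivAt_setIntegral hS (hK i) hΩ
      (𝒯.cell_subset i) (hg i) hq hR hφ.continuous ht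
    refine h3.congr_of_eventuallyEq ?_
    filter_upwards [Icc_mem_nhds ht.1 ht.2] with s hs
    refine 𝒯.setIntegral_eq_sum fun i => ?_
    exact ((((continuousOn_slice hS.cont hs).mono (𝒯.closure_cell_subset i)).mul
      hφ.continuous.continuousOn).integrableOn_compact (hK i).isCompact_closure).mono_set
      subset_closure
  have h3 := h1.unique h2
  linarith

/-- The face integrals vanish for all test functions, so the sum of the one-sided normal fluxes is
zero almost everywhere, for the area measure, on the faces inside `Ω`. On an interior edge only the
fluxes of its two cells contribute to this sum. -/
theorem exactFlux_conservative (hΩb : Bornology.IsBounded Ω)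
    (hpos : ∀ i, ∀ σ ∈ 𝒯.edges i, 0 < 𝒯.mesEdge σ)
    (hg : ∀ i, IsCellTensor (𝒯.cell i) D (g i) (g' i) M L)
    (hX : IsClassicalSolution Ω T D q R X₀ X)
    (hS : IsSpaceC2 Ω T X G H) (hΩ : IsOpen Ω) (hq : ContinuousOn q (closure Ω))
    (hR : IsReaction Ω T R) {t : ℝ} (ht : t ∈ Ioo 0 T) :
    𝒯.Conservative (𝒯.exactFlux g (G t)) := by
  classical
  have htI := Ioo_subset_Icc_self ht
  have hK := fun i => isPolytope (𝒯 := 𝒯) hΩb i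
  have hm : ∀ i, ∀ σ ∈ 𝒯.edges i, MeasurableSet (𝒯.face σ) := fun i σ hσ =>
    (𝒯.face_closed i σ hσ).measurableSet
  set b : ι → ε → Sp (n + 1) → ℝ := fun i σ x => ⟪g i x (G t x), 𝒯.normal i σ⟫ with hb
  have hint : ∀ i, ∀ σ ∈ 𝒯.edges i, IntegrableOn (b i σ) (𝒯.face σ) μHE[n] := fun i σ hσ =>
    (hK i).integrableOn_face hσ
      ((hS.continuousOn_cellFlux (𝒯.cell_subset i) (hg i) htI).inner (𝕜 := ℝ) continuousOn_const)
  have hintI : ∀ i, ∀ σ ∈ 𝒯.edges i, Integrable ((𝒯.face σ).indicator (b i σ)) μHE[n] :=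
    fun i σ hσ => (integrable_indicator_iff (hm i σ hσ)).2 (hint i σ hσ)
  set f : Sp (n + 1) → ℝ := fun x => ∑ i, ∑ σ ∈ 𝒯.edges i, (𝒯.face σ).indicator (b i σ) x with hf
  have hfint : Integrable f μHE[n] :=
    integrable_finsetSum _ fun i _ => integrable_finsetSum _ fun σ hσ => hintI i σ hσ
  have hae : ∀ᵐ x ∂(μHE[n] : Measure (Sp (n + 1))), x ∈ Ω → f x = 0 := by
    refine hΩ.ae_eq_zero_of_integral_contDiff_smul_eq_zero (hfint.locallyIntegrable.locallyIntegrableOn Ω)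
      fun φ hφ hφc hφΩ => ?_
    rw [← sum_face_integral_eq_zero hΩb hg hX hS hΩ hq hR ht hφ hφc hφΩ]
    obtain ⟨B, hB⟩ := hφc.exists_bound_of_continuous hφ.continuous
    have hI : ∀ i, ∀ σ ∈ 𝒯.edges i, Integrable (fun x => φ x * (𝒯.face σ).indicator (b i σ) x)
        μHE[n] := fun i σ hσ =>
      (hintI i σ hσ).bdd_mul hφ.continuous.aestronglyMeasurable (.of_forall hB)
    simp only [hf, smul_eq_mul, Finset.mul_sum]
    rw [integral_finsetSum _ fun i _ => integrable_finsetSum _ fun σ hσ => hI i σ hσ]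
    refine Finset.sum_congr rfl fun i _ => ?_
    rw [integral_finsetSum _ fun σ hσ => hI i σ hσ]
    refine Finset.sum_congr rfl fun σ hσ => ?_
    rw [← integral_indicator (hm i σ hσ)]
    refine integral_congr_ae (.of_forall fun x => ?_)
    by_cases hx : x ∈ 𝒯.face σ <;> simp [hx, hb]
  intro i σ hσ j hn
  obtain ⟨hji, hσj, -, hface, hnull⟩ := 𝒯.interior_edge i σ hσ j hn
  have hzero : ∫ x in 𝒯.face σ, f x ∂μHE[n] = 0 := by
    refine setIntegral_eq_zero_of_ae_eq_zero ?_
    filter_upwards [hae, measure_eq_zero_iff_ae_notMem.1 hnull] with x h1 h2 hx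
    refine h1 ?_
    have h3 : x ∈ closure Ω := 𝒯.closure_cell_subset i (𝒯.face_subset_closure hσ hx)
    by_contra hxΩ
    exact h2 ⟨hx, by rw [hΩ.frontier_eq]; exact ⟨h3, hxΩ⟩⟩
  -- Other faces of `i` and `j` meet `σ` in null sets by admissibility of the mesh, faces of a third
  -- cell by convexity and disjointness.
  have hterm : ∀ k, ∀ σ' ∈ 𝒯.edges k, ∫ x in 𝒯.face σ, (𝒯.face σ').indicator (b k σ') x ∂μHE[n] =
      if σ' = σ ∧ (k = i ∨ k = j) then 𝒯.exactFlux g (G t) k σ else 0 := by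
    intro k σ' hσ'
    rw [setIntegral_indicator (hm k σ' hσ')]
    split_ifs with hc
    · obtain ⟨rfl, -⟩ := hc
      rw [inter_self]
      rfl
    · have h0 : (μHE[n] : Measure (Sp (n + 1))) (𝒯.face σ ∩ 𝒯.face σ') = 0 := by
        by_cases hki : k = i
        · subst hki
          exact 𝒯.face_inter k σ hσ σ' hσ' fun h => hc ⟨h.symm, Or.inl rfl⟩
        by_cases hkj : k = j
        · subst hkj
          exact 𝒯.face_inter k σ hσj σ' hσ' fun h => hc ⟨h.symm, Or.inr rfl⟩
        exact measure_inter_third hpos hσ hn hki hkj hσ'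
      rw [Measure.restrict_eq_zero.2 h0, integral_zero_measure]
  have hsum : ∫ x in 𝒯.face σ, f x ∂μHE[n] =
      ∑ k, ∑ σ' ∈ 𝒯.edges k, if σ' = σ ∧ (k = i ∨ k = j) then 𝒯.exactFlux g (G t) k σ else 0 := by
    simp only [hf]
    rw [integral_finsetSum _ fun k _ => integrable_finsetSum _ fun σ' hσ' =>
      (hintI k σ' hσ').integrableOn]
    refine Finset.sum_congr rfl fun k _ => ?_
    rw [integral_finsetSum _ fun σ' hσ' => (hintI k σ' hσ').integrableOn]
    exact Finset.sum_congr rfl fun σ' hσ' => hterm k σ' hσ'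
  have hsum2 : ∀ k, (∑ σ' ∈ 𝒯.edges k,
      if σ' = σ ∧ (k = i ∨ k = j) then 𝒯.exactFlux g (G t) k σ else 0) =
      (if k = i then 𝒯.exactFlux g (G t) k σ else 0) +
        if k = j then 𝒯.exactFlux g (G t) k σ else 0 := by
    intro k
    by_cases hki : k = i
    · subst hki
      simp [hji.symm, hσ]
    by_cases hkj : k = j
    · subst hkj
      simp [hji, hσj]
    simp [hki, hkj]
  rw [hsum, Finset.sum_congr rfl fun k _ => hsum2 k, Finset.sum_add_distrib] at hzero
  simp only [Finset.sum_ite_eq', Finset.mem_univ, if_true] at hzero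
  linarith

end AdmissibleMesh

/-! ### Quantitative regularity of the solution -/

/-- Bounds for the solution, its space derivatives and its modulus of continuity in time. -/
structure SolutionBounds {d : ℕ} (Ω : Set (Sp d)) (T : ℝ) (X : ℝ → Sp d → ℝ) (G : ℝ → Sp d → Sp d)
    (H : ℝ → Sp d → Sp d →L[ℝ] Sp d) (MX MG N B Cη : ℝ) : Prop extends IsSpaceC2 Ω T X G H where
  nonneg_grad : 0 ≤ MG
  nonneg_hess : 0 ≤ N
  nonneg_time : 0 ≤ B
  nonneg_holder : 0 ≤ Cη
  bound : ∀ t ∈ Icc 0 T, ∀ x ∈ closure Ω, |X t x| ≤ MX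
  bound_grad : ∀ t ∈ Icc 0 T, ∀ x ∈ closure Ω, ‖G t x‖ ≤ MG
  bound_hess : ∀ t ∈ Icc 0 T, ∀ x ∈ closure Ω, ‖H t x‖ ≤ N
  lip_time : ∀ s ∈ Icc 0 T, ∀ t ∈ Icc 0 T, ∀ x ∈ closure Ω, |X t x - X s x| ≤ B * |t - s|
  holder_grad : ∀ s ∈ Icc 0 T, ∀ t ∈ Icc 0 T, ∀ x ∈ closure Ω, ‖G t x - G s x‖ ≤ Cη * √|t - s|

namespace AdmissibleMesh

variable {n : ℕ} {Ω : Set (Sp (n + 1))} {D : Sp (n + 1) → Sp (n + 1) →L[ℝ] Sp (n + 1)}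
  {ι ε : Type} [Fintype ι] {𝒯 : AdmissibleMesh Ω D ι ε} {T M L : ℝ}
  {q : Sp (n + 1) → Sp (n + 1)} {R : Sp (n + 1) → ℝ → ℝ → ℝ}
  {X : ℝ → Sp (n + 1) → ℝ} {X₀ : Sp (n + 1) → ℝ} {G : ℝ → Sp (n + 1) → Sp (n + 1)}
  {H : ℝ → Sp (n + 1) → Sp (n + 1) →L[ℝ] Sp (n + 1)} {MX MG N B Cη c₁ Q ζ₁ ζ₂ c₀ : ℝ}
  {g : ι → Sp (n + 1) → Sp (n + 1) →L[ℝ] Sp (n + 1)}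
  {g' : ι → Sp (n + 1) → Sp (n + 1) →L[ℝ] Sp (n + 1) →L[ℝ] Sp (n + 1)}

theorem exists_solutionBounds (htb : 𝒯.TensorBound M L) (hΩb : Bornology.IsBounded Ω)
    (hT : 0 < T) (hX : IsClassicalSolution Ω T D q R X₀ X) (hS : IsSpaceC2 Ω T X G H)
    (hΩ : IsOpen Ω) (hq : ContinuousOn q (closure Ω)) (hR : IsReaction Ω T R) :
    ∃ MX MG N B Cη, SolutionBounds Ω T X G H MX MG N B Cη := by
  have hc : IsCompact (Icc 0 T ×ˢ closure Ω) := isCompact_Icc.prod hΩb.isCompact_closure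
  obtain ⟨MX, h1⟩ := hc.exists_bound_of_continuousOn hS.cont
  obtain ⟨MG, h2⟩ := hc.exists_bound_of_continuousOn hS.cont_grad
  obtain ⟨N, h3⟩ := hc.exists_bound_of_continuousOn hS.cont_hess
  obtain ⟨B, hB0, hB⟩ := exists_time_lipschitz htb hΩb hX hS hΩ hq hR
  have hN : ∀ t ∈ Icc 0 T, ∀ x ∈ closure Ω, ‖H t x‖ ≤ |N| := fun t ht x hx =>
    (h3 (t, x) ⟨ht, hx⟩).trans (le_abs_self N)
  obtain ⟨C, hC0, hC⟩ := 𝒯.exists_gradient_holder hΩb hT hS hB0 (abs_nonneg N) hB hN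
  exact ⟨MX, |MG|, |N|, B, C, { toIsSpaceC2 := hS
                                nonneg_grad := abs_nonneg _
                                nonneg_hess := abs_nonneg _
                                nonneg_time := hB0
                                nonneg_holder := hC0
                                bound := fun t ht x hx => h1 (t, x) ⟨ht, hx⟩
                                bound_grad := fun t ht x hx =>
                                  (h2 (t, x) ⟨ht, hx⟩).trans (le_abs_self MG)
                                bound_hess := hN
                                lip_time := hB
                                holder_grad := hC }⟩

/-! ### Lipschitz estimates inside a control volume -/

theorem abs_sub_le_of_mem_cell (hΩb : Bornology.IsBounded Ω)
    (hS : SolutionBounds Ω T X G H MX MG N B Cη) {t : ℝ} (ht : t ∈ Icc 0 T) {i : ι}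
    {x y : Sp (n + 1)} (hx : x ∈ closure (𝒯.cell i)) (hy : y ∈ closure (𝒯.cell i)) :
    |X t y - X t x| ≤ MG * 𝒯.size := by
  have h := norm_sub_le_of_convex_closure (𝒯.cell_convex i)
    ((continuousOn_slice hS.cont ht).mono (𝒯.closure_cell_subset i))
    (fun z hz => (hS.grad t ht z (𝒯.cell_subset i hz)).hasFDerivAt) (L := MG)
    (fun z hz => by
      rw [LinearIsometryEquiv.norm_map]
      exact hS.bound_grad t ht z (subset_closure (𝒯.cell_subset i hz))) hx hy
  exact h.trans (mul_le_mul_of_nonneg_left (𝒯.norm_sub_le_size hΩb hy hx) hS.nonneg_grad)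

theorem norm_grad_sub_le_of_mem_cell (hΩb : Bornology.IsBounded Ω)
    (hS : SolutionBounds Ω T X G H MX MG N B Cη) {t : ℝ} (ht : t ∈ Icc 0 T) {i : ι}
    {x y : Sp (n + 1)} (hx : x ∈ closure (𝒯.cell i)) (hy : y ∈ closure (𝒯.cell i)) :
    ‖G t y - G t x‖ ≤ N * 𝒯.size := by
  have h := norm_sub_le_of_convex_closure (𝒯.cell_convex i)
    ((continuousOn_slice hS.cont_grad ht).mono (𝒯.closure_cell_subset i))
    (fun z hz => hS.hess t ht z (𝒯.cell_subset i hz))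
    (fun z hz => hS.bound_hess t ht z (subset_closure (𝒯.cell_subset i hz))) hx hy
  exact h.trans (mul_le_mul_of_nonneg_left (𝒯.norm_sub_le_size hΩb hy hx) hS.nonneg_hess)

/-- The gradient of `X t - X s` is at most `Cη √|t - s|`, so its oscillation over a cell gains a
factor `h` while keeping the half power of time. This is the Hölder bound needed for `ρ`. -/
theorem abs_increment_sub_le_of_mem_cell (hΩb : Bornology.IsBounded Ω)
    (hS : SolutionBounds Ω T X G H MX MG N B Cη) {s t : ℝ} (hs : s ∈ Icc 0 T) (ht : t ∈ Icc 0 T)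
    {i : ι} {x y : Sp (n + 1)} (hx : x ∈ closure (𝒯.cell i)) (hy : y ∈ closure (𝒯.cell i)) :
    |(X t y - X s y) - (X t x - X s x)| ≤ Cη * √|t - s| * 𝒯.size := by
  have h := norm_sub_le_of_convex_closure (𝒯.cell_convex i) (f := fun z => X t z - X s z)
    (((continuousOn_slice hS.cont ht).sub (continuousOn_slice hS.cont hs)).mono
      (𝒯.closure_cell_subset i))
    (fun z hz => (hS.grad t ht z (𝒯.cell_subset i hz)).hasFDerivAt.sub
      (hS.grad s hs z (𝒯.cell_subset i hz)).hasFDerivAt) (L := Cη * √|t - s|)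
    (fun z hz => by
      rw [← map_sub, LinearIsometryEquiv.norm_map]
      exact hS.holder_grad s hs t ht z (subset_closure (𝒯.cell_subset i hz))) hx hy
  exact h.trans (mul_le_mul_of_nonneg_left (𝒯.norm_sub_le_size hΩb hy hx)
    (mul_nonneg hS.nonneg_holder (Real.sqrt_nonneg _)))

/-! ### Consistency of the numerical fluxes -/

/-- Consistency of the one-sided difference quotient. -/
theorem abs_oneSided_le (hΩb : Bornology.IsBounded Ω) (hc₁ : 0 < c₁)
    (hsymm : ∀ x ∈ Ω, ∀ ξ η : Sp (n + 1), ⟪D x ξ, η⟫ = ⟪ξ, D x η⟫)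
    (he : ∀ x ∈ Ω, ∀ ξ : Sp (n + 1), c₁ * ‖ξ‖ ^ 2 ≤ ⟪D x ξ, ξ⟫)
    (hM : 0 < M) (hL : 0 < L) (hg : ∀ i, IsCellTensor (𝒯.cell i) D (g i) (g' i) M L)
    (hS : SolutionBounds Ω T X G H MX MG N B Cη) {t : ℝ} (ht : t ∈ Icc 0 T) {i : ι} {σ : ε}
    (hσ : σ ∈ 𝒯.edges i) :
    |𝒯.mesEdge σ * (X t (𝒯.foot σ) - X t (𝒯.center i)) - 𝒯.lam i σ * 𝒯.exactFlux g (G t) i σ| ≤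
      𝒯.lam i σ * ((L * MG + 2 * (M * N)) * 𝒯.size * 𝒯.mesEdge σ) := by
  have htb : 𝒯.TensorBound M L := fun i => ⟨g i, g' i, hg i⟩
  have hK := isPolytope (𝒯 := 𝒯) hΩb i
  set y := 𝒯.foot σ with hy
  set c := 𝒯.center i with hcdef
  set ν := 𝒯.normal i σ with hν
  set Di := meanTensor D (𝒯.cell i) with hDi
  have hν1 : ‖ν‖ = 1 := 𝒯.normal_norm i σ hσ
  have hyc : y ∈ closure (𝒯.cell i) := 𝒯.face_subset_closure hσ (𝒯.foot_mem i σ hσ)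
  have hcc : c ∈ closure (𝒯.cell i) := 𝒯.center_mem i
  have hsz := 𝒯.size_nonneg
  have hlam := 𝒯.lam_nonneg i σ
  have hN := hS.nonneg_hess
  have hMG := hS.nonneg_grad
  have hfc : y - c = 𝒯.lam i σ • Di ν := foot_sub_center hΩb htb hc₁ he hσ
  have hmes : 0 ≤ 𝒯.mesEdge σ := measureReal_nonneg
  have htay : |X t c - X t y - ⟪G t y, c - y⟫| ≤ N * ‖c - y‖ ^ 2 :=
    abs_taylor_le_of_convex_closure (𝒯.cell_convex i)
      ((continuousOn_slice hS.cont ht).mono (𝒯.closure_cell_subset i))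
      ((continuousOn_slice hS.cont_grad ht).mono (𝒯.closure_cell_subset i))
      (fun z hz => hS.grad t ht z (𝒯.cell_subset i hz))
      (fun z hz => hS.hess t ht z (𝒯.cell_subset i hz))
      (fun z hz => hS.bound_hess t ht z (subset_closure (𝒯.cell_subset i hz))) hyc hcc
  -- The segment from center to foot points along `D_i n`. By symmetry of `D_i`, the increment of
  -- `X` along it approximates the normal component of `D_i ∇X`, not of `∇X`.
  have hin : ⟪G t y, c - y⟫ = -(𝒯.lam i σ * ⟪Di (G t y), ν⟫) := by
    rw [← neg_sub, inner_neg_right, hfc, real_inner_smul_right,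
      (hg i).meanTensor_symm (𝒯.cell_open i) (𝒯.cell_bounded hΩb i)
        (fun x hx => hsymm x (𝒯.cell_subset i hx))]
  -- One of the two factors is kept as `lam`, so that the final error is proportional to `lam` and
  -- can be divided by the resistance even if one of the two centers lies on the edge.
  have hcy : ‖c - y‖ ^ 2 ≤ 𝒯.lam i σ * M * 𝒯.size := by
    have h1 : ‖c - y‖ = 𝒯.distEdge i σ := by rw [distEdge, dist_eq_norm]
    have h2 : 𝒯.distEdge i σ ≤ 𝒯.lam i σ * M := by
      rw [distEdge_eq hΩb htb hc₁ he hσ]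
      exact mul_le_mul_of_nonneg_left (diffEdge_le hΩb htb hσ) hlam
    rw [h1, sq]
    exact mul_le_mul h2 (distEdge_le_size hΩb hσ) dist_nonneg (by positivity)
  have hx : ∀ x ∈ 𝒯.face σ, ‖⟪g i x (G t x), ν⟫ - ⟪Di (G t y), ν⟫‖ ≤
      (L * MG + M * N) * 𝒯.size := by
    intro x hx
    have hxc : x ∈ closure (𝒯.cell i) := 𝒯.face_subset_closure hσ hx
    rw [← inner_sub_left]
    refine (norm_inner_le_norm _ _).trans ?_
    rw [hν1, mul_one]
    have h1 : g i x (G t x) - Di (G t y) = g i x (G t x - G t y) - (Di - g i x) (G t y) := by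
      simp only [map_sub, sub_apply]; abel
    have h2 : ‖Di - g i x‖ ≤ L * 𝒯.size :=
      (hg i).norm_meanTensor_sub_le (𝒯.cell_open i) (𝒯.cell_bounded hΩb i) (𝒯.cell_convex i)
        (𝒯.cell_nonempty i) hL.le hxc
        fun z hz => 𝒯.norm_sub_le_size hΩb (subset_closure hz) hxc
    have h3 : ‖g i x (G t x - G t y)‖ ≤ M * (N * 𝒯.size) :=
      ContinuousLinearMap.le_of_opNorm_le_of_le _ ((hg i).bound x hxc)
        (norm_grad_sub_le_of_mem_cell hΩb hS ht hyc hxc)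
    have h4 : ‖(Di - g i x) (G t y)‖ ≤ L * 𝒯.size * MG :=
      ContinuousLinearMap.le_of_opNorm_le_of_le _ h2
        (hS.bound_grad t ht y (𝒯.closure_cell_subset i hyc))
    rw [h1]
    refine (norm_sub_le _ _).trans ((add_le_add h3 h4).trans (le_of_eq ?_))
    ring
  have hfl : |𝒯.exactFlux g (G t) i σ - 𝒯.mesEdge σ * ⟪Di (G t y), ν⟫| ≤
      (L * MG + M * N) * 𝒯.size * 𝒯.mesEdge σ := by
    have hi : IntegrableOn (fun x => ⟪g i x (G t x), ν⟫) (𝒯.face σ) μHE[n] :=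
      hK.integrableOn_face hσ ((hS.continuousOn_cellFlux (𝒯.cell_subset i) (hg i) ht).inner
        (𝕜 := ℝ) continuousOn_const)
    have h1 : 𝒯.exactFlux g (G t) i σ - 𝒯.mesEdge σ * ⟪Di (G t y), ν⟫ =
        ∫ x in 𝒯.face σ, (⟪g i x (G t x), ν⟫ - ⟪Di (G t y), ν⟫) ∂μHE[n] := by
      rw [integral_sub hi (integrableOn_const (hK.measure_face_lt_top hσ).ne), setIntegral_const,
        smul_eq_mul]
      rfl
    rw [h1, ← Real.norm_eq_abs]
    exact norm_setIntegral_le_of_norm_le_const (hK.measure_face_lt_top hσ) hx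
  rw [hin] at htay
  have h5 : |X t y - X t c - 𝒯.lam i σ * ⟪Di (G t y), ν⟫| ≤ N * (𝒯.lam i σ * M * 𝒯.size) := by
    rw [← abs_neg]
    refine le_trans (le_of_eq (congrArg _ ?_)) (htay.trans (mul_le_mul_of_nonneg_left hcy hN))
    ring
  calc |𝒯.mesEdge σ * (X t y - X t c) - 𝒯.lam i σ * 𝒯.exactFlux g (G t) i σ|
      = |𝒯.mesEdge σ * (X t y - X t c - 𝒯.lam i σ * ⟪Di (G t y), ν⟫) -
          𝒯.lam i σ * (𝒯.exactFlux g (G t) i σ - 𝒯.mesEdge σ * ⟪Di (G t y), ν⟫)| := by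
        congr 1; ring
    _ ≤ 𝒯.mesEdge σ * (N * (𝒯.lam i σ * M * 𝒯.size)) +
          𝒯.lam i σ * ((L * MG + M * N) * 𝒯.size * 𝒯.mesEdge σ) := by
        refine (abs_sub _ _).trans ?_
        rw [abs_mul, abs_mul, abs_of_nonneg hmes, abs_of_nonneg hlam]
        exact add_le_add (mul_le_mul_of_nonneg_left h5 hmes) (mul_le_mul_of_nonneg_left hfl hlam)
    _ = _ := by ring

/-- Consistency of the diffusive fluxes. -/
theorem abs_diffusive_residual_le (hΩb : Bornology.IsBounded Ω) (hc₁ : 0 < c₁)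
    (hsymm : ∀ x ∈ Ω, ∀ ξ η : Sp (n + 1), ⟪D x ξ, η⟫ = ⟪ξ, D x η⟫)
    (he : ∀ x ∈ Ω, ∀ ξ : Sp (n + 1), c₁ * ‖ξ‖ ^ 2 ≤ ⟪D x ξ, ξ⟫)
    (hM : 0 < M) (hL : 0 < L) (hg : ∀ i, IsCellTensor (𝒯.cell i) D (g i) (g' i) M L)
    (hS : SolutionBounds Ω T X G H MX MG N B Cη) (hreg : 𝒯.Regular ζ₁ ζ₂) (hζ₁ : 0 < ζ₁)
    {t : ℝ} (ht : t ∈ Icc 0 T) (hbd : ∀ x ∈ frontier Ω, X t x = 0)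
    (hcons : 𝒯.Conservative (𝒯.exactFlux g (G t))) {i : ι} {σ : ε} (hσ : σ ∈ 𝒯.edges i) :
    |𝒯.exactFlux g (G t) i σ - 𝒯.tau i σ * (𝒯.across (𝒯.proj (X t)) i σ - 𝒯.proj (X t) i)| ≤
      (L * MG + 2 * (M * N)) * 𝒯.size * 𝒯.mesEdge σ := by
  have htb : 𝒯.TensorBound M L := fun i => ⟨g i, g' i, hg i⟩
  have hr := hreg.resist_pos hζ₁ hΩb htb hM hc₁ he hσ
  rw [tau_eq hΩb htb hc₁ he hσ (hreg.distSigma_pos hζ₁ hΩb hσ)]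
  set E := (L * MG + 2 * (M * N)) * 𝒯.size * 𝒯.mesEdge σ with hE
  have hi := abs_oneSided_le hΩb hc₁ hsymm he hM hL hg hS ht hσ
  rw [← hE] at hi
  set S := 𝒯.resist i σ with hSdef
  set Φ := 𝒯.exactFlux g (G t) i σ with hΦ
  set m := 𝒯.mesEdge σ
  -- After multiplication by the resistance, the flux error is the sum of the two one-sided errors:
  -- the value of `X` at the common foot cancels, and the exact fluxes are opposite. On a boundary
  -- edge that value is zero.
  suffices h : |S * Φ - m * (𝒯.across (𝒯.proj (X t)) i σ - 𝒯.proj (X t) i)| ≤ S * E by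
    have h1 : Φ - m / S * (𝒯.across (𝒯.proj (X t)) i σ - 𝒯.proj (X t) i) =
        (S * Φ - m * (𝒯.across (𝒯.proj (X t)) i σ - 𝒯.proj (X t) i)) / S := by
      field_simp
    rw [h1, abs_div, abs_of_pos hr, div_le_iff₀ hr, mul_comm E]
    exact h
  cases hn : 𝒯.nbr i σ with
  | none =>
    have h2 : S = 𝒯.lam i σ := by simp [hSdef, resist, hn]
    have h3 : X t (𝒯.foot σ) = 0 :=
      hbd _ (𝒯.boundary_edge i σ hσ hn (𝒯.foot_mem i σ hσ))
    rw [𝒯.across_none hn, h2, abs_sub_comm]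
    rw [h3] at hi
    exact hi
  | some j =>
    obtain ⟨-, hσj, -⟩ := 𝒯.interior_edge i σ hσ j hn
    have hj := abs_oneSided_le hΩb hc₁ hsymm he hM hL hg hS ht hσj
    rw [← hE, hcons i σ hσ j hn] at hj
    have h2 : S = 𝒯.lam i σ + 𝒯.lam j σ := by simp [hSdef, resist, hn]
    rw [𝒯.across_some hn, h2]
    simp only [proj]
    rw [abs_le] at hi hj ⊢
    constructor <;> linarith [hi.1, hi.2, hj.1, hj.2]

/-- Consistency of the convective fluxes. -/
theorem abs_convective_residual_le (hΩb : Bornology.IsBounded Ω)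
    (hq : ContinuousOn q (closure Ω)) (hQ : ∀ x ∈ closure Ω, ‖q x‖ ≤ Q)
    (hS : SolutionBounds Ω T X G H MX MG N B Cη)
    {t : ℝ} (ht : t ∈ Icc 0 T) (hbd : ∀ x ∈ frontier Ω, X t x = 0) {i : ι} {σ : ε}
    (hσ : σ ∈ 𝒯.edges i) :
    |𝒯.flux q i σ * 𝒯.upwind q (𝒯.proj (X t)) i σ - 𝒯.flux (fun x => X t x • q x) i σ| ≤
      MG * Q * 𝒯.size * 𝒯.mesEdge σ := by
  have hK := isPolytope (𝒯 := 𝒯) hΩb i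
  -- Whichever side is upwind, the edge lies in the closure of the corresponding cell. On an inflow
  -- edge of the boundary the upwind value `0` is exact.
  have hup : ∀ x ∈ 𝒯.face σ, |𝒯.upwind q (𝒯.proj (X t)) i σ - X t x| ≤ MG * 𝒯.size := by
    intro x hx
    unfold upwind
    split_ifs
    · exact abs_sub_le_of_mem_cell hΩb hS ht (𝒯.face_subset_closure hσ hx) (𝒯.center_mem i)
    · cases hn : 𝒯.nbr i σ with
      | none =>
        rw [𝒯.across_none hn, hbd x (𝒯.boundary_edge i σ hσ hn hx), sub_zero, abs_zero]
        exact mul_nonneg hS.nonneg_grad 𝒯.size_nonneg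
      | some j =>
        obtain ⟨-, hσj, -⟩ := 𝒯.interior_edge i σ hσ j hn
        rw [𝒯.across_some hn]
        exact abs_sub_le_of_mem_cell hΩb hS ht (𝒯.face_subset_closure hσj hx) (𝒯.center_mem j)
  have hqn : ContinuousOn (fun x => ⟪q x, 𝒯.normal i σ⟫) (closure (𝒯.cell i)) :=
    (hq.mono (𝒯.closure_cell_subset i)).inner (𝕜 := ℝ) continuousOn_const
  have hXc := (continuousOn_slice hS.cont ht).mono (𝒯.closure_cell_subset i)
  have h1 : 𝒯.flux q i σ * 𝒯.upwind q (𝒯.proj (X t)) i σ - 𝒯.flux (fun x => X t x • q x) i σ =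
      ∫ x in 𝒯.face σ, (𝒯.upwind q (𝒯.proj (X t)) i σ - X t x) * ⟪q x, 𝒯.normal i σ⟫ ∂μHE[n] := by
    unfold flux
    simp only [real_inner_smul_left, sub_mul]
    rw [mul_comm]
    refine (Eq.trans (integral_sub ?_ ?_) ?_).symm
    · exact (hK.integrableOn_face hσ hqn).const_mul _
    · exact hK.integrableOn_face hσ (hXc.mul hqn)
    · rw [integral_const_mul]; rfl
  rw [h1, ← Real.norm_eq_abs]
  refine (norm_setIntegral_le_of_norm_le_const (C := MG * 𝒯.size * Q)
    (hK.measure_face_lt_top hσ) fun x hx => ?_).trans (le_of_eq ?_)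
  · rw [norm_mul, Real.norm_eq_abs]
    refine mul_le_mul (hup x hx) ?_ (norm_nonneg _) (mul_nonneg hS.nonneg_grad 𝒯.size_nonneg)
    refine (norm_inner_le_norm _ _).trans ?_
    rw [𝒯.normal_norm i σ hσ, mul_one]
    exact hQ x (𝒯.closure_cell_subset i (𝒯.face_subset_closure hσ hx))
  · rw [mesEdge_eq]; ring

end AdmissibleMesh

namespace AdmissibleMesh

variable {n : ℕ} {Ω : Set (Sp (n + 1))} {D : Sp (n + 1) → Sp (n + 1) →L[ℝ] Sp (n + 1)}
  {ι ε : Type} [Fintype ι] {𝒯 : AdmissibleMesh Ω D ι ε} {T M L : ℝ}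
  {q : Sp (n + 1) → Sp (n + 1)} {R : Sp (n + 1) → ℝ → ℝ → ℝ}
  {X : ℝ → Sp (n + 1) → ℝ} {X₀ : Sp (n + 1) → ℝ} {G : ℝ → Sp (n + 1) → Sp (n + 1)}
  {H : ℝ → Sp (n + 1) → Sp (n + 1) →L[ℝ] Sp (n + 1)} {MX MG N B Cη c₁ Q ζ₁ ζ₂ c₀ : ℝ}
  {g : ι → Sp (n + 1) → Sp (n + 1) →L[ℝ] Sp (n + 1)}
  {g' : ι → Sp (n + 1) → Sp (n + 1) →L[ℝ] Sp (n + 1) →L[ℝ] Sp (n + 1)}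

/-! ### Averages over control volumes -/

/-- The mean values of a function over the control volumes. -/
def cellAvg (𝒯 : AdmissibleMesh Ω D ι ε) (f : Sp (n + 1) → ℝ) (i : ι) : ℝ :=
  (𝒯.mesCell i)⁻¹ * ∫ x in 𝒯.cell i, f x

theorem integrableOn_cell (hΩb : Bornology.IsBounded Ω) {i : ι} {f : Sp (n + 1) → ℝ}
    (hf : ContinuousOn f (closure (𝒯.cell i))) : IntegrableOn f (𝒯.cell i) :=
  (hf.integrableOn_compact (𝒯.cell_bounded hΩb i).isCompact_closure).mono_set subset_closure

theorem abs_cellAvg_sub_le (hΩb : Bornology.IsBounded Ω) {i : ι} {f : Sp (n + 1) → ℝ} {a c : ℝ}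
    (hf : ContinuousOn f (closure (𝒯.cell i))) (h : ∀ x ∈ 𝒯.cell i, |f x - a| ≤ c) :
    |𝒯.cellAvg f i - a| ≤ c := by
  have hpos := 𝒯.mesCell_pos hΩb i
  have hlt : volume (𝒯.cell i) < ⊤ := (𝒯.cell_bounded hΩb i).measure_lt_top
  have h1 : 𝒯.cellAvg f i - a = (𝒯.mesCell i)⁻¹ * ∫ x in 𝒯.cell i, (f x - a) := by
    have hc : IntegrableOn (fun _ : Sp (n + 1) => a) (𝒯.cell i) := integrableOn_const hlt.ne
    rw [integral_sub (integrableOn_cell hΩb hf) hc, setIntegral_const,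
      smul_eq_mul, mul_sub, cellAvg]
    congr 1
    rw [mesCell] at hpos ⊢
    rw [inv_mul_cancel_left₀ hpos.ne']
  have h2 : ‖∫ x in 𝒯.cell i, (f x - a)‖ ≤ c * 𝒯.mesCell i :=
    norm_setIntegral_le_of_norm_le_const hlt h
  rw [h1, abs_mul, abs_of_pos (inv_pos.2 hpos), inv_mul_le_iff₀ hpos, mul_comm]
  exact h2

theorem cellAvg_sub (hΩb : Bornology.IsBounded Ω) {i : ι} {f₁ f₂ : Sp (n + 1) → ℝ}
    (h₁ : ContinuousOn f₁ (closure (𝒯.cell i))) (h₂ : ContinuousOn f₂ (closure (𝒯.cell i))) :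
    𝒯.cellAvg (f₁ - f₂) i = 𝒯.cellAvg f₁ i - 𝒯.cellAvg f₂ i := by
  rw [cellAvg]
  simp only [Pi.sub_apply]
  rw [integral_sub (integrableOn_cell hΩb h₁) (integrableOn_cell hΩb h₂), mul_sub]
  rfl

theorem norm0_le_of_abs_le (hΩb : Bornology.IsBounded Ω) {u : ι → ℝ} {c : ℝ} (hc : 0 ≤ c)
    (h : ∀ i, |u i| ≤ c) : 𝒯.norm0 u ≤ c * √(volume.real Ω) := by
  rw [norm0, ← Real.sqrt_sq hc, ← Real.sqrt_mul (sq_nonneg c)]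
  refine Real.sqrt_le_sqrt ?_
  rw [← 𝒯.sum_mesCell hΩb, Finset.mul_sum]
  refine Finset.sum_le_sum fun i _ => ?_
  rw [mul_assoc, ← sq, ← sq_abs, mul_comm]
  exact mul_le_mul_of_nonneg_right (pow_le_pow_left₀ (abs_nonneg _) (h i) 2)
    (𝒯.mesCell_pos hΩb i).le

theorem norm0_mono (hΩb : Bornology.IsBounded Ω) {u v : ι → ℝ} (h : ∀ i, |u i| ≤ |v i|) :
    𝒯.norm0 u ≤ 𝒯.norm0 v := by
  refine Real.sqrt_le_sqrt (Finset.sum_le_sum fun i _ => ?_)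
  rw [mul_assoc, mul_assoc, ← sq, ← sq]
  exact mul_le_mul_of_nonneg_left (sq_le_sq.2 (h i)) (𝒯.mesCell_pos hΩb i).le

theorem norm0_le_of_abs_le_add (hΩb : Bornology.IsBounded Ω) {u e : ι → ℝ} {a b : ℝ} (ha : 0 ≤ a)
    (hb : 0 ≤ b) (h : ∀ i, |u i| ≤ a + b * |e i|) :
    𝒯.norm0 u ≤ a * √(volume.real Ω) + b * 𝒯.norm0 e := by
  have h1 : 𝒯.norm0 u ≤ 𝒯.norm0 ((fun _ => a) + fun i => b * |e i|) := by
    refine norm0_mono hΩb fun i => (h i).trans (le_abs_self _)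
  refine h1.trans ((𝒯.norm0_add_le _ _).trans (add_le_add ?_ (le_of_eq ?_)))
  · exact norm0_le_of_abs_le hΩb ha fun i => (abs_of_nonneg ha).le
  · rw [norm0, norm0, ← Real.sqrt_sq hb, ← Real.sqrt_mul (sq_nonneg b), Real.sqrt_sq hb]
    congr 1
    rw [inner0, inner0, Finset.mul_sum]
    refine Finset.sum_congr rfl fun i _ => ?_
    have := abs_mul_abs_self (e i)
    linear_combination (𝒯.mesCell i * b ^ 2) * this

/-! ### The residual of the exact solution -/

/-- Balance of the exact solution over a control volume. -/
theorem setIntegral_cellRate (hΩb : Bornology.IsBounded Ω) (hq : IsVelocity Ω q)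
    (hR : IsReaction Ω T R) (hg : ∀ i, IsCellTensor (𝒯.cell i) D (g i) (g' i) M L)
    (hS : IsSpaceC2 Ω T X G H) {t : ℝ} (ht : t ∈ Icc 0 T) (i : ι) :
    ∫ x in 𝒯.cell i, cellRate (g i) (g' i) q R X G H t x =
      ∑ σ ∈ 𝒯.edges i, (𝒯.exactFlux g (G t) i σ - 𝒯.flux (fun x => X t x • q x) i σ) +
        ∫ x in 𝒯.cell i, R x t (X t x) := by
  obtain ⟨q', hq1, hq2, hq3⟩ := hq.c1
  have hK := isPolytope (𝒯 := 𝒯) hΩb i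
  have hsub := 𝒯.closure_cell_subset i
  have hJ' := continuousOn_slice (hS.continuousOn_cellFluxDeriv (𝒯.cell_subset i) (hg i)) ht
  have hGc := (continuousOn_slice hS.cont_grad ht).mono hsub
  have hXc := (continuousOn_slice hS.cont ht).mono hsub
  have h1 := hK.setIntegral_divergence (hS.continuousOn_cellFlux (𝒯.cell_subset i) (hg i) ht) hJ'
    fun x hx => hS.hasFDerivAt_cellFlux (𝒯.cell_subset i) (hg i) ht hx
  have h2 := hK.setIntegral_divergence_mul (hq1.mono hsub) (hq2.mono hsub)
    (fun x hx => hq3 x (𝒯.cell_subset i hx)) hXc hGc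
    fun x hx => hS.grad t ht x (𝒯.cell_subset i hx)
  -- As `div q = 0`, the convective term is the divergence of `X q`, hence a sum of face fluxes.
  have h3 : ∫ x in 𝒯.cell i, ((∑ k, q' x (EuclideanSpace.single k 1) k) * X t x + ⟪q x, G t x⟫) =
      ∫ x in 𝒯.cell i, ⟪q x, G t x⟫ := by
    refine setIntegral_congr_fun (𝒯.cell_open i).measurableSet fun x hx => ?_
    have h5 := hq.div_free x (𝒯.cell_subset i hx)
    rw [divergence, (hq3 x (𝒯.cell_subset i hx)).fderiv] at h5
    simp only [h5, zero_mul, zero_add]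
  have hi1 : IntegrableOn (fun x => ∑ k, cellFluxDeriv (g i) (g' i) G H t x
      (EuclideanSpace.single k 1) k) (𝒯.cell i) :=
    integrableOn_cell hΩb (continuousOn_finsetSum _ fun k _ =>
      (EuclideanSpace.proj (𝕜 := ℝ) k).continuous.comp_continuousOn
        (hJ'.clm_apply continuousOn_const))
  have hi2 : IntegrableOn (fun x => ⟪q x, G t x⟫) (𝒯.cell i) :=
    integrableOn_cell hΩb ((hq1.mono hsub).inner (𝕜 := ℝ) hGc)
  have hi3 : IntegrableOn (fun x => R x t (X t x)) (𝒯.cell i) :=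
    integrableOn_cell hΩb ((continuousOn_slice (f := fun t x => R x t (X t x))
      (hR.continuousOn hS.cont) ht).mono hsub)
  unfold cellRate
  have hadd := integral_add (hi1.sub hi2) hi3
  simp only [Pi.sub_apply] at hadd
  rw [hadd, integral_sub hi1 hi2, h1, ← h3, h2, ← Finset.sum_sub_distrib]
  congr 1
  refine Finset.sum_congr rfl fun σ _ => ?_
  simp only [exactFlux, flux, real_inner_smul_left]
  rfl

/-- The residual of a cell is a sum of edge errors, diffusive plus convective, which are
conservative and at most `κ h mes(σ)`. Hence `r² / τ ≤ κ² h² (2/c₁) h mes(σ)`, and the perimeter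
bound makes the total `O(h²)`. The shift `c₀` acts on center values on both sides and cancels
exactly. -/
theorem abs_residual_le (hΩb : Bornology.IsBounded Ω) (hΩ : IsOpen Ω) (hc₁ : 0 < c₁)
    (hsymm : ∀ x ∈ Ω, ∀ ξ η : Sp (n + 1), ⟪D x ξ, η⟫ = ⟪ξ, D x η⟫)
    (he : ∀ x ∈ Ω, ∀ ξ : Sp (n + 1), c₁ * ‖ξ‖ ^ 2 ≤ ⟪D x ξ, ξ⟫)
    (hM : 0 < M) (hL : 0 < L) (hg : ∀ i, IsCellTensor (𝒯.cell i) D (g i) (g' i) M L)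
    (hq : IsVelocity Ω q) (hQ : ∀ x ∈ closure Ω, ‖q x‖ ≤ Q) (hR : IsReaction Ω T R)
    (hX : IsClassicalSolution Ω T D q R X₀ X)
    (hS : SolutionBounds Ω T X G H MX MG N B Cη) (hreg : 𝒯.Regular ζ₁ ζ₂) (hζ₁ : 0 < ζ₁)
    {t : ℝ} (ht : t ∈ Ioo 0 T) (ψ : ι → ℝ) :
    |𝒯.inner0 ((fun i => 𝒯.cellAvg (cellRate (g i) (g' i) q R X G H t) i) +
        𝒯.operator q c₀ (𝒯.proj (X t)) -
        (𝒯.cellAvg (fun x => R x t (X t x)) + c₀ • 𝒯.proj (X t))) ψ| ≤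
      √((L * MG + 2 * (M * N) + MG * Q) ^ 2 * (2 / c₁) * (perimeterConst n / ζ₁) * volume.real Ω) *
        𝒯.size * √(𝒯.sq1 ψ) := by
  have htI := Ioo_subset_Icc_self ht
  have htb : 𝒯.TensorBound M L := fun i => ⟨g i, g' i, hg i⟩
  have hpos : ∀ i, ∀ σ ∈ 𝒯.edges i, 0 < 𝒯.mesEdge σ := fun i σ hσ => hreg.mesEdge_pos hζ₁ hΩb i hσ
  have hres : ∀ i, ∀ σ ∈ 𝒯.edges i, 0 < 𝒯.resist i σ := fun i σ hσ =>
    hreg.resist_pos hζ₁ hΩb htb hM hc₁ he hσ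
  have htau : ∀ i, ∀ σ ∈ 𝒯.edges i, 𝒯.tau i σ = 𝒯.mesEdge σ / 𝒯.resist i σ := fun i σ hσ =>
    tau_eq hΩb htb hc₁ he hσ (hreg.distSigma_pos hζ₁ hΩb hσ)
  have hqc : ContinuousOn q (closure Ω) := hq.c1.choose_spec.1
  have hbd := hX.boundary t htI
  have hcons := exactFlux_conservative hΩb hpos hg hX hS.toIsSpaceC2 hΩ hqc hR ht
  set u := 𝒯.proj (X t) with hu
  set κ := L * MG + 2 * (M * N) + MG * Q with hκ
  set r : ι → ε → ℝ := fun i σ =>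
    (𝒯.exactFlux g (G t) i σ - 𝒯.tau i σ * (𝒯.across u i σ - u i)) +
      (𝒯.flux q i σ * 𝒯.upwind q u i σ - 𝒯.flux (fun x => X t x • q x) i σ) with hr
  have hrc : 𝒯.Conservative r := by
    intro i σ hσ j hn
    have h1 := hcons i σ hσ j hn
    have h2 := 𝒯.conservative_tau u i σ hσ j hn
    have h3 := 𝒯.conservative_flux_upwind (conservative_flux hpos q) u i σ hσ j hn
    have h4 := conservative_flux hpos (fun x => X t x • q x) i σ hσ j hn
    simp only [hr] at h2 h3 ⊢
    linarith
  have hrb : ∀ i, ∀ σ ∈ 𝒯.edges i, |r i σ| ≤ κ * 𝒯.size * 𝒯.mesEdge σ := by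
    intro i σ hσ
    refine (abs_add_le _ _).trans ((add_le_add
      (abs_diffusive_residual_le hΩb hc₁ hsymm he hM hL hg hS hreg hζ₁ htI hbd hcons hσ)
      (abs_convective_residual_le hΩb hqc hQ hS htI hbd hσ)).trans (le_of_eq ?_))
    rw [hκ]; ring
  have hB : ∑ i, ∑ σ ∈ 𝒯.edges i, r i σ ^ 2 / 𝒯.tau i σ ≤
      (κ ^ 2 * (2 / c₁) * (perimeterConst n / ζ₁) * volume.real Ω) * 𝒯.size ^ 2 := by
    have hk : 0 ≤ κ ^ 2 * (2 / c₁) * 𝒯.size ^ 2 := by positivity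
    have h1 : ∀ i, ∑ σ ∈ 𝒯.edges i, r i σ ^ 2 / 𝒯.tau i σ ≤
        κ ^ 2 * (2 / c₁) * 𝒯.size ^ 2 * (perimeterConst n / ζ₁ * 𝒯.mesCell i) := by
      intro i
      refine le_trans ?_ (mul_le_mul_of_nonneg_left (hreg.size_mul_sum_mesEdge_le hζ₁ hΩb i) hk)
      rw [Finset.mul_sum, Finset.mul_sum]
      refine Finset.sum_le_sum fun σ hσ => ?_
      have hm := hpos i σ hσ
      rw [htau i σ hσ, div_div_eq_mul_div, div_le_iff₀ hm]
      have h2 : r i σ ^ 2 ≤ (κ * 𝒯.size * 𝒯.mesEdge σ) ^ 2 := by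
        rw [← sq_abs]
        exact pow_le_pow_left₀ (abs_nonneg _) (hrb i σ hσ) 2
      calc r i σ ^ 2 * 𝒯.resist i σ
          ≤ (κ * 𝒯.size * 𝒯.mesEdge σ) ^ 2 * (2 / c₁ * 𝒯.size) :=
            mul_le_mul h2 (resist_le hΩb htb hc₁ he hσ) (hres i σ hσ).le (sq_nonneg _)
        _ = _ := by ring
    refine (Finset.sum_le_sum fun i _ => h1 i).trans (le_of_eq ?_)
    rw [← Finset.mul_sum, ← Finset.mul_sum, 𝒯.sum_mesCell hΩb]
    ring
  have hkey := hrc.abs_sum_mul_le (fun i σ hσ => by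
    rw [htau i σ hσ]; exact div_pos (hpos i σ hσ) (hres i σ hσ)) hB ψ
  rw [Real.sqrt_mul' _ (sq_nonneg _), Real.sqrt_sq 𝒯.size_nonneg] at hkey
  refine le_trans (le_of_eq (congrArg _ ?_)) hkey
  unfold inner0
  refine Finset.sum_congr rfl fun i _ => ?_
  rw [← Finset.sum_mul]
  congr 1
  have hm := (𝒯.mesCell_pos hΩb i).ne'
  simp only [Pi.add_apply, Pi.sub_apply, Pi.smul_apply, smul_eq_mul, operator, cellAvg,
    LinearMap.coe_toContinuousLinearMap', LinearMap.coe_mk, AddHom.coe_mk,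
    setIntegral_cellRate hΩb hq hR hg hS.toIsSpaceC2 htI i]
  simp only [hr, Finset.sum_add_distrib, Finset.sum_sub_distrib, Finset.sum_neg_distrib]
  field_simp
  ring

/-! ### The error estimate -/

theorem hasDerivAt_cellAvg (hΩb : Bornology.IsBounded Ω) (hΩ : IsOpen Ω)
    (hg : ∀ i, IsCellTensor (𝒯.cell i) D (g i) (g' i) M L)
    (hq : ContinuousOn q (closure Ω)) (hR : IsReaction Ω T R)
    (hX : IsClassicalSolution Ω T D q R X₀ X) (hS : IsSpaceC2 Ω T X G H)
    {t : ℝ} (ht : t ∈ Ioo 0 T) :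
    HasDerivAt (fun s => 𝒯.cellAvg (X s))
      (fun i => 𝒯.cellAvg (cellRate (g i) (g' i) q R X G H t) i) t := by
  rw [hasDerivAt_pi]
  intro i
  have h := hX.hasDerivAt_setIntegral hS (isPolytope (𝒯 := 𝒯) hΩb i) hΩ (𝒯.cell_subset i) (hg i) hq
    hR (continuous_const (y := (1 : ℝ))) ht
  simp only [mul_one] at h
  exact h.const_mul _

theorem abs_cellAvg_sub_cellAvg_le (hΩb : Bornology.IsBounded Ω)
    (hS : SolutionBounds Ω T X G H MX MG N B Cη) {s t : ℝ} (hs : s ∈ Icc 0 T) (ht : t ∈ Icc 0 T)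
    (i : ι) : |𝒯.cellAvg (X t) i - 𝒯.cellAvg (X s) i| ≤ B * |t - s| := by
  have hc : ∀ r ∈ Icc 0 T, ContinuousOn (X r) (closure (𝒯.cell i)) := fun r hr =>
    (continuousOn_slice hS.cont hr).mono (𝒯.closure_cell_subset i)
  have h := abs_cellAvg_sub_le (𝒯 := 𝒯) hΩb (a := 0) ((hc t ht).sub (hc s hs)) fun x hx => by
    rw [sub_zero]
    exact hS.lip_time s hs t ht x (subset_closure (𝒯.cell_subset i hx))
  rwa [sub_zero, cellAvg_sub hΩb (hc t ht) (hc s hs)] at h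

theorem continuousOn_cellAvg (hΩb : Bornology.IsBounded Ω)
    (hS : SolutionBounds Ω T X G H MX MG N B Cη) :
    ContinuousOn (fun s => 𝒯.cellAvg (X s)) (Icc 0 T) := by
  refine continuousOn_pi.2 fun i => ?_
  have : LipschitzOnWith ⟨B, hS.nonneg_time⟩ (fun s => 𝒯.cellAvg (X s) i) (Icc 0 T) :=
    LipschitzOnWith.of_dist_le_mul fun t ht s hs => by
      rw [Real.dist_eq, Real.dist_eq]
      exact abs_cellAvg_sub_cellAvg_le hΩb hS hs ht i
  exact this.continuousOn

/-- The distance between point values and mean values is Hölder continuous in time. -/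
theorem norm0_proj_sub_cellAvg_le (hΩb : Bornology.IsBounded Ω)
    (hS : SolutionBounds Ω T X G H MX MG N B Cη) {s t : ℝ} (hs : s ∈ Icc 0 T) (ht : t ∈ Icc 0 T) :
    𝒯.norm0 ((𝒯.proj (X t) - 𝒯.cellAvg (X t)) - (𝒯.proj (X s) - 𝒯.cellAvg (X s))) ≤
      Cη * √(volume.real Ω) * 𝒯.size * √|t - s| := by
  have h0 : 0 ≤ Cη * √|t - s| * 𝒯.size :=
    mul_nonneg (mul_nonneg hS.nonneg_holder (Real.sqrt_nonneg _)) 𝒯.size_nonneg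
  refine (norm0_le_of_abs_le hΩb h0 fun i => ?_).trans (le_of_eq (by ring))
  have hc : ∀ r ∈ Icc 0 T, ContinuousOn (X r) (closure (𝒯.cell i)) := fun r hr =>
    (continuousOn_slice hS.cont hr).mono (𝒯.closure_cell_subset i)
  have h := abs_cellAvg_sub_le (𝒯 := 𝒯) hΩb ((hc t ht).sub (hc s hs)) fun x hx =>
    abs_increment_sub_le_of_mem_cell hΩb hS hs ht (𝒯.center_mem i) (subset_closure hx)
  have h2 := cellAvg_sub (𝒯 := 𝒯) hΩb (hc t ht) (hc s hs)
  simp only [Pi.sub_apply, proj]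
  rw [abs_sub_comm] at h
  change |X t (𝒯.center i) - X s (𝒯.center i) - 𝒯.cellAvg (X t - X s) i| ≤ _ at h
  rw [h2] at h
  refine le_trans (le_of_eq (congrArg _ ?_)) h
  ring

/-- Consistency of the reaction term. -/
theorem norm0_reaction_sub_le (hΩb : Bornology.IsBounded Ω) (hc₀ : 0 ≤ c₀)
    (hR : IsReaction Ω T R) (hS : SolutionBounds Ω T X G H MX MG N B Cη) {Λ κ : ℝ} (hΛ : 0 ≤ Λ)
    (hκ : 0 ≤ κ)
    (hlip : ∀ x ∈ closure Ω, ∀ t ∈ Icc 0 T, ∀ u v : ℝ, |R x t u - R x t v| ≤ Λ * |u - v|)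
    (hlip' : ∀ x ∈ closure Ω, ∀ y ∈ closure Ω, ∀ t ∈ Icc 0 T, ∀ s ∈ Icc 0 T, ∀ u : ℝ, |u| ≤ MX →
      |R x t u - R y s u| ≤ κ * (‖x - y‖ + |t - s|)) {s t Δt : ℝ} (hs : s ∈ Icc 0 T)
    (ht : t ∈ Icc 0 T) (hts : |t - s| ≤ Δt) (y : ι → ℝ) :
    𝒯.norm0 (𝒯.cellAvg (fun x => R x t (X t x)) + c₀ • 𝒯.proj (X t) -
        fun i => R (𝒯.center i) s (y i) + c₀ * y i) ≤
      (Λ * (MG + B) + κ + c₀ * B) * √(volume.real Ω) * (Δt + 𝒯.size) +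
        (Λ + c₀) * 𝒯.norm0 (𝒯.proj (X s) - y) := by
  have hh := 𝒯.size_nonneg
  have hΔ : 0 ≤ Δt := (abs_nonneg _).trans hts
  have hMG := hS.nonneg_grad
  have hB := hS.nonneg_time
  have h0 : 0 ≤ (Λ * (MG + B) + κ + c₀ * B) * (Δt + 𝒯.size) := by positivity
  refine (norm0_le_of_abs_le_add hΩb (e := 𝒯.proj (X s) - y) h0 (by positivity : 0 ≤ Λ + c₀)
    fun i => ?_).trans (le_of_eq (by ring))
  set c := 𝒯.center i with hc
  have hcΩ : c ∈ closure Ω := 𝒯.center_mem_closure i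
  have hav : |𝒯.cellAvg (fun x => R x t (X t x)) i - R c s (X s c)| ≤
      Λ * (MG * 𝒯.size + B * Δt) + κ * (𝒯.size + Δt) := by
    refine abs_cellAvg_sub_le hΩb ((continuousOn_slice (f := fun t x => R x t (X t x))
      (hR.continuousOn hS.cont) ht).mono (𝒯.closure_cell_subset i)) fun x hx => ?_
    have hxc : x ∈ closure (𝒯.cell i) := subset_closure hx
    have hxΩ : x ∈ closure Ω := 𝒯.closure_cell_subset i hxc
    have h1 := hlip x hxΩ t ht (X t x) (X s c)
    have h2 := hlip' x hxΩ c hcΩ t ht s hs (X s c) (hS.bound s hs c hcΩ)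
    have h3 : |X t x - X s c| ≤ MG * 𝒯.size + B * Δt := by
      have h4 := abs_sub_le_of_mem_cell hΩb hS ht (𝒯.center_mem i) hxc
      have h5 := (hS.lip_time s hs t ht c hcΩ).trans (mul_le_mul_of_nonneg_left hts hB)
      exact (abs_sub_le _ (X t c) _).trans (add_le_add h4 h5)
    have h6 : ‖x - c‖ + |t - s| ≤ 𝒯.size + Δt :=
      add_le_add (𝒯.norm_sub_le_size hΩb hxc (𝒯.center_mem i)) hts
    exact (abs_sub_le _ (R x t (X s c)) _).trans (add_le_add
      (h1.trans (mul_le_mul_of_nonneg_left h3 hΛ)) (h2.trans (mul_le_mul_of_nonneg_left h6 hκ)))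
  have hy := hlip c hcΩ s hs (X s c) (y i)
  have hct : |c₀ * (X t c - X s c)| ≤ c₀ * (B * Δt) := by
    rw [abs_mul, abs_of_nonneg hc₀]
    exact mul_le_mul_of_nonneg_left
      ((hS.lip_time s hs t ht c hcΩ).trans (mul_le_mul_of_nonneg_left hts hB)) hc₀
  have hcy : |c₀ * (X s c - y i)| = c₀ * |X s c - y i| := by rw [abs_mul, abs_of_nonneg hc₀]
  simp only [Pi.sub_apply, Pi.add_apply, Pi.smul_apply, smul_eq_mul, proj]
  rw [← hc]
  calc |𝒯.cellAvg (fun x => R x t (X t x)) i + c₀ * X t c - (R c s (y i) + c₀ * y i)|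
      = |(𝒯.cellAvg (fun x => R x t (X t x)) i - R c s (X s c)) +
          (R c s (X s c) - R c s (y i)) + c₀ * (X t c - X s c) + c₀ * (X s c - y i)| := by
        congr 1; ring
    _ ≤ (Λ * (MG * 𝒯.size + B * Δt) + κ * (𝒯.size + Δt)) + Λ * |X s c - y i| + c₀ * (B * Δt) +
          c₀ * |X s c - y i| :=
        (abs_add_le _ _).trans (add_le_add ((abs_add_le _ _).trans
          (add_le_add ((abs_add_le _ _).trans (add_le_add hav hy)) hct)) hcy.le)
    _ ≤ _ := by
        have e1 : 0 ≤ Λ * (MG * Δt) := by positivity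
        have e2 : 0 ≤ Λ * (B * 𝒯.size) := by positivity
        have e3 : 0 ≤ c₀ * (B * 𝒯.size) := by positivity
        nlinarith

/-- The constant of the error estimate. -/
def errorConst (T c₀ C Cr Cρ CF : ℝ) : ℝ :=
  ((2 * (√(2 * (1 + 2 * T * C ^ 2 + T * c₀)) * (Cr + Cρ)) + Cρ) * √T + CF * T) * Real.exp (CF * T)

theorem norm0_error_le (hΩb : Bornology.IsBounded Ω) (hΩ : IsOpen Ω) (hT : 0 < T) (hc₁ : 0 < c₁)
    (hsymm : ∀ x ∈ Ω, ∀ ξ η : Sp (n + 1), ⟪D x ξ, η⟫ = ⟪ξ, D x η⟫)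
    (he : ∀ x ∈ Ω, ∀ ξ : Sp (n + 1), c₁ * ‖ξ‖ ^ 2 ≤ ⟪D x ξ, ξ⟫)
    (hM : 0 < M) (hL : 0 < L) (htb : 𝒯.TensorBound M L)
    (hq : IsVelocity Ω q) (hQ : ∀ x ∈ closure Ω, ‖q x‖ ≤ Q) (hR : IsReaction Ω T R)
    (hX : IsClassicalSolution Ω T D q R X₀ X)
    (hS : SolutionBounds Ω T X G H MX MG N B Cη) (hreg : 𝒯.Regular ζ₁ ζ₂) (hζ₁ : 0 < ζ₁)
    (hc₀ : 0 ≤ c₀) {Λ κ : ℝ} (hΛ : 0 ≤ Λ) (hκ : 0 ≤ κ)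
    (hlip : ∀ x ∈ closure Ω, ∀ t ∈ Icc 0 T, ∀ u v : ℝ, |R x t u - R x t v| ≤ Λ * |u - v|)
    (hlip' : ∀ x ∈ closure Ω, ∀ y ∈ closure Ω, ∀ t ∈ Icc 0 T, ∀ s ∈ Icc 0 T, ∀ u : ℝ, |u| ≤ MX →
      |R x t u - R y s u| ≤ κ * (‖x - y‖ + |t - s|)) {Δt : ℝ} (hΔt : 0 < Δt) {m : ℕ}
    (hm : m * Δt ≤ T) :
    𝒯.norm0 (𝒯.proj (X (m * Δt)) - etd1 𝒯 q R c₀ X₀ Δt m) ≤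
      errorConst T c₀ √(2 * (Q ^ 2 * (2 / c₁) * (perimeterConst n / ζ₁)))
        √((L * MG + 2 * (M * N) + MG * Q) ^ 2 * (2 / c₁) * (perimeterConst n / ζ₁) * volume.real Ω)
        (Cη * √(volume.real Ω))
        ((Λ * (MG + B) + κ + c₀ * B) * √(volume.real Ω) + (Λ + c₀)) * (Δt + 𝒯.size) := by
  choose g g' hg using htb
  have htb : 𝒯.TensorBound M L := fun i => ⟨g i, g' i, hg i⟩
  have hqc : ContinuousOn q (closure Ω) := hq.c1.choose_spec.1
  have hMG := hS.nonneg_grad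
  have hB := hS.nonneg_time
  have hρ0 : 0 ≤ Cη * √(volume.real Ω) := mul_nonneg hS.nonneg_holder (Real.sqrt_nonneg _)
  have hF1 : 0 ≤ (Λ * (MG + B) + κ + c₀ * B) * √(volume.real Ω) := by positivity
  have hF2 : 0 ≤ Λ + c₀ := by positivity
  -- Means carry the time derivative, center values enter the operator, and the source is the mean
  -- of the reaction plus `c₀` times the center values.
  refine (hreg.stable hζ₁ hΩb htb hM hc₁ he hq hQ).error_bound hΩb hc₀ hT.le 𝒯.size_nonneg
    (Real.sqrt_nonneg _) hρ0 (add_nonneg hF1 hF2) hΔt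
    (Xb := fun t => 𝒯.cellAvg (X t)) (Xt := fun t => 𝒯.proj (X t))
    (Fb := fun t => 𝒯.cellAvg (fun x => R x t (X t x)) + c₀ • 𝒯.proj (X t))
    (F := fun k i => R (𝒯.center i) (k * Δt) (etd1 𝒯 q R c₀ X₀ Δt k i)
          + c₀ * etd1 𝒯 q R c₀ X₀ Δt k i)
    (continuousOn_cellAvg hΩb hS)
    (fun t ht => hasDerivAt_cellAvg hΩb hΩ hg hqc hR hX hS.toIsSpaceC2 ht)
    (fun t ht ψ => abs_residual_le hΩb hΩ hc₁ hsymm he hM hL hg hq hQ hR hX hS hreg hζ₁ ht ψ)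
    (fun s hs t ht => norm0_proj_sub_cellAvg_le hΩb hS hs ht) hm ?_ (fun k => rfl) ?_
  · funext i
    exact (hX.initial _ (𝒯.center_mem_closure i)).symm
  · intro k hk t ht
    have hk1 : ((k + 1 : ℕ) : ℝ) * Δt ≤ T :=
      (mul_le_mul_of_nonneg_right (by exact_mod_cast hk) hΔt.le).trans hm
    have hk0 : (0 : ℝ) ≤ k * Δt := by positivity
    have hkk : ((k + 1 : ℕ) : ℝ) * Δt = k * Δt + Δt := by push_cast; ring
    have htI : t ∈ Icc 0 T := ⟨hk0.trans ht.1, ht.2.trans hk1⟩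
    have hsI : (k : ℝ) * Δt ∈ Icc 0 T := ⟨hk0, by linarith⟩
    have hts : |t - k * Δt| ≤ Δt := by
      rw [abs_of_nonneg (by linarith [ht.1])]
      linarith [ht.2]
    refine (norm0_reaction_sub_le hΩb hc₀ hR hS hΛ hκ hlip hlip' hsI htI hts _).trans ?_
    have e1 : 0 ≤ Δt + 𝒯.size := add_nonneg hΔt.le 𝒯.size_nonneg
    have e2 := 𝒯.norm0_nonneg (𝒯.proj (X (k * Δt)) - etd1 𝒯 q R c₀ X₀ Δt k)
    have e3 := mul_nonneg hF2 e1
    have e4 := mul_nonneg hF1 e2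
    rw [add_mul, add_mul]
    linarith

end AdmissibleMesh

end FVETD

end

/-! ### The convergence theorem -/

theorem theorem4p1 (d : ℕ) (hd₁ : 1 ≤ d) (hd₃ : d ≤ 3)
    (Ω : Set (FVETD.Sp d)) (hΩ : IsOpen Ω) (hΩb : Bornology.IsBounded Ω)
    (T : ℝ) (hT : 0 < T)
    (D : FVETD.Sp d → FVETD.Sp d →L[ℝ] FVETD.Sp d) (hD : FVETD.IsDiffusionTensor Ω D)
    (q : FVETD.Sp d → FVETD.Sp d) (hq : FVETD.IsVelocity Ω q)
    (R : FVETD.Sp d → ℝ → ℝ → ℝ) (hR : FVETD.IsReaction Ω T R)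
    (X₀ : FVETD.Sp d → ℝ) (X : ℝ → FVETD.Sp d → ℝ)
    (hX : FVETD.IsClassicalSolution Ω T D q R X₀ X)
    (c₀ : ℝ) (hc₀ : 0 ≤ c₀) (ζ₁ ζ₂ : ℝ) (hζ₁ : 0 < ζ₁) (hζ₂ : 0 < ζ₂) :
    ∃ C : ℝ, 0 < C ∧
      ∀ (ι ε : Type) [Fintype ι] (𝒯 : FVETD.AdmissibleMesh Ω D ι ε), 𝒯.Regular ζ₁ ζ₂ →
        ∀ Δt : ℝ, 0 < Δt → ∀ m : ℕ, m * Δt ≤ T →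
          𝒯.norm0 (𝒯.proj (X (m * Δt)) - FVETD.etd1 𝒯 q R c₀ X₀ Δt m) ≤ C * (Δt + 𝒯.size) := by
  -- Writing `d = n + 1` makes `d - 1` equal to `n`, the dimension of the faces.
  obtain ⟨n, rfl⟩ : ∃ n, d = n + 1 := ⟨d - 1, by omega⟩
  -- The constant must be fixed before the mesh. Any single regular mesh serves as a reference that
  -- supplies the bounds of `D` and the regularity of `X`; if there is none, the claim is vacuous.
  by_cases hex : ∃ (ι ε : Type) (_ : Fintype ι) (𝒯 : FVETD.AdmissibleMesh Ω D ι ε),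
      𝒯.Regular ζ₁ ζ₂
  · obtain ⟨ι₀, ε₀, _, 𝒯₀, hreg₀⟩ := hex
    obtain ⟨M, L, hM, hL, htb₀⟩ := hreg₀.exists_tensorBound hΩb
    obtain ⟨c₁, hc₁, he⟩ := hD.elliptic
    obtain ⟨G, H, hXc, hGc, hHc, hd⟩ := hX.c2
    have hqc : ContinuousOn q (closure Ω) := hq.c1.choose_spec.1
    have hC2 : FVETD.IsSpaceC2 Ω T X G H :=
      ⟨hXc, hGc, hHc, fun t ht x hx => (hd t ht x hx).1, fun t ht x hx => (hd t ht x hx).2⟩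
    obtain ⟨MX, MG, N, B, Cη, hS⟩ := FVETD.AdmissibleMesh.exists_solutionBounds htb₀ hΩb hT hX hC2
      hΩ hqc hR
    obtain ⟨Q, hQ⟩ := hΩb.isCompact_closure.exists_bound_of_continuousOn hqc
    obtain ⟨Λ, hΛ, hlip⟩ := hR.lip
    obtain ⟨κ, hκ⟩ := hR.lip_xt MX
    -- The maximum with `1` only ensures positivity. All other entries depend on the data and the
    -- reference mesh, not on the mesh of the scheme.
    refine ⟨max 1 (FVETD.AdmissibleMesh.errorConst T c₀
      √(2 * (Q ^ 2 * (2 / c₁) * (FVETD.AdmissibleMesh.perimeterConst n / ζ₁)))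
      √((L * MG + 2 * (M * N) + MG * Q) ^ 2 * (2 / c₁) *
        (FVETD.AdmissibleMesh.perimeterConst n / ζ₁) * volume.real Ω)
      (Cη * √(volume.real Ω))
      ((Λ * (MG + B) + |κ| + c₀ * B) * √(volume.real Ω) + (Λ + c₀))),
      lt_max_of_lt_left one_pos, ?_⟩
    intro ι ε _ 𝒯 hreg Δt hΔt m hm
    refine (FVETD.AdmissibleMesh.norm0_error_le hΩb hΩ hT hc₁ hD.symm he hM hL
      (htb₀.transfer hreg) hq hQ hR hX hS hreg hζ₁ hc₀ hΛ.le (abs_nonneg κ) hlip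
      (fun x hx y hy t ht s hs u hu => (hκ x hx y hy t ht s hs u hu).trans
        (mul_le_mul_of_nonneg_right (le_abs_self κ) (by positivity))) hΔt hm).trans ?_
    exact mul_le_mul_of_nonneg_right (le_max_right _ _) (add_nonneg hΔt.le 𝒯.size_nonneg)
  · exact ⟨1, one_pos, fun ι ε _ 𝒯 hreg => absurd ⟨ι, ε, _, 𝒯, hreg⟩ hex⟩
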